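/- Let $\alpha>0$, $0<\rho<1$, and let $h:[1,\infty)\to[0,\infty)$ be continuous, eventually positive and slowly varying, i.e. $h(\lambda x)/h(x)\to1$ as $x\to\infty$ for every $\lambda>0$. Put $c_k=h(k)\,k^{\alpha-1}\rho^{-k}$ for $k\ge1$, $C(x)=\sum_{k\ge1}c_kx^k$ for $0\le x<\rho$, and let $m\ge 1$ be the smallest integer with $c_m\ne0$. Let $(p_n)_{n\in\mathbb N}$ be positive integers with $p_n\to\infty$, and let $x_n=\rho e^{-\chi_n}$ with $\chi_n>0$ and $\chi_n\to0$ as $n\to\infty$. For each $n$ let $C_{1},C_{2},\dots$ be independent random variables, all with the Boltzmann distribution $$\Pr[C_{i}=k]=\frac{c_kx_n^k}{C(x_n)},\qquad k\ge1,$$ and for $p=p_n$ put $L_p=\sum_{1\le i\le p}(C_{i}-m)$, $\mu_p=\mathbb E[L_p]$ and $\sigma_p=\sqrt{\operatorname{Var}[L_p]}$. Then, as $n\to\infty$, uniformly for $t=o(p^{1/6})$ (that is, for every sequence $s_n=o(p_n^{1/6})$, uniformly over all real $t$ with $|t|\le s_n$), $$\Pr[L_p=\mu_p+t\sigma_p]\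 \sim\ e^{-t^2/2}\,\Pr[L_p=\mu_p]\ \sim\ e^{-t^2/2}\frac1{\sqrt{2\pi}\,\sigma_p}\ \sim\ e^{-t^2/2}\frac1{\sqrt{2\pi}}\frac{\chi_n}{\sqrt{p\alpha}}.$$ As $L_p$ is integer-valued, the probability on the left is considered only for those $t$ with $\mu_p+t\sigma_p\in\mathbb Z$, and the term $e^{-t^2/2}\Pr[L_p=\mu_p]$ only for those $n$ for which also $\mu_p\in\mathbb Z$; the asymptotic equivalences between the remaining terms hold without the latter restriction. In particular, let $N_n\in\mathbb N$ satisfy $N_n\to\infty$ and $n-mN_n\to\infty$, and suppose that for all large $n$ the pair $(x_n,y_n)$ satisfies $0<x_n<\rho$, $y_n>0$, $x_n^my_n<1$ and $$x_ny_nC'(x_n)+mc_m\frac{x_n^my_n}{1-x_n^my_n}=n,\qquad y_nC(x_n)+c_m\frac{x_n^my_n}{1-x_n^my_n}=N_n.$$ Then $\chi_n:=\ln(\rho/x_n)\to0$, and so the above holds with these $x_n$. -/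

import Mathlib

open Filter Topology MeasureTheory ProbabilityTheory Asymptotics

noncomputable section

/-- Slow variation at infinity. -/
def SlowlyVarying (h : ℝ → ℝ) : Prop :=
  ∀ l : ℝ, 0 < l → Tendsto (fun x => h (l * x) / h x) atTop (𝓝 1)

/-- The parameters of an expansive sequence `c_n = h(n) n^(α-1) ρ^(-n)`; only the values of `h` on
`[1, ∞)` matter. -/
structure ExpansiveData (h : ℝ → ℝ) (α ρ : ℝ) : Prop where
  nonneg : ∀ x, 1 ≤ x → 0 ≤ h x
  eventually_pos : ∀ᶠ x in atTop, 0 < h x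
  continuousOn : ContinuousOn h (Set.Ici 1)
  slowlyVarying : SlowlyVarying h
  alpha_pos : 0 < α
  rho_pos : 0 < ρ
  rho_lt_one : ρ < 1

/-- The expansive sequence `c_n = h(n) n^(α-1) ρ^(-n)`, `n ≥ 1`, with `c_0 = 0`. -/
def expansiveSeq (h : ℝ → ℝ) (α ρ : ℝ) (n : ℕ) : ℝ :=
  if n = 0 then 0 else h n * (n : ℝ) ^ (α - 1) * (ρ ^ n)⁻¹

/-- The generating series `C(x) = ∑ c_k x^k`. -/
def genSeries (c : ℕ → ℝ) (x : ℝ) : ℝ := ∑' k : ℕ, c k * x ^ k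

/-- The smallest index `m` with `c_m ≠ 0`. -/
def minIndex (c : ℕ → ℝ) : ℕ := sInf {k : ℕ | c k ≠ 0}

/-- `X` has the Boltzmann distribution for `c` at `x`. -/
def HasBoltzmannLaw {Ω : Type*} [MeasurableSpace Ω] (P : Measure Ω) (c : ℕ → ℝ) (x : ℝ)
    (X : Ω → ℕ) : Prop :=
  ∀ k : ℕ, P.real {ω | X ω = k} = c k * x ^ k / genSeries c x

/-- `L_p = ∑_{1 ≤ i ≤ p} (X_i - m)`. -/
def shiftedSum {Ω : Type*} (m p : ℕ) (X : ℕ → Ω → ℕ) (ω : Ω) : ℝ :=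
  ∑ i ∈ Finset.range p, ((X i ω : ℝ) - m)

/-- `σ(L) = √Var[L]`. -/
def stdDev {Ω : Type*} [MeasurableSpace Ω] (P : Measure Ω) (L : Ω → ℝ) : ℝ :=
  √(variance L P)

/-- The point `E[L] + t σ(L)`. -/
def stdPoint {Ω : Type*} [MeasurableSpace Ω] (P : Measure Ω) (L : Ω → ℝ) (t : ℝ) : ℝ :=
  (∫ ω, L ω ∂P) + t * stdDev P L

/-- `A_n(t) ~ B_n(t)` as `n → ∞`, uniformly over `t ∈ S_n`. -/
def UnifEquiv (S : ℕ → Set ℝ) (A B : ℕ → ℝ → ℝ) : Prop :=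
  ∀ ε : ℝ, 0 < ε → ∀ᶠ n in atTop, ∀ t ∈ S n, |A n t / B n t - 1| ≤ ε

/-- The local limit theorem for random variables `L_n`, uniformly over `t = o(p_n^(1/6))`, that is,
uniformly over `|t| ≤ s_n` for every sequence `s_n = o(p_n^(1/6))`. The variables `L_n` are
integer-valued, so a probability `P[L_n = u]` is only considered at integers `u`. -/
def LocalLimit {Ω : ℕ → Type*} [∀ n, MeasurableSpace (Ω n)] (P : ∀ n, Measure (Ω n))
    (L : ∀ n, Ω n → ℝ) (p : ℕ → ℕ) (α : ℝ) (χ : ℕ → ℝ) : Prop :=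
  ∀ s : ℕ → ℝ, (s =o[atTop] fun n => (p n : ℝ) ^ (1 / 6 : ℝ)) →
    UnifEquiv
      (fun n => {t | |t| ≤ s n ∧ (∃ z : ℤ, stdPoint (P n) (L n) t = z) ∧
        ∃ z : ℤ, ∫ ω, L n ω ∂(P n) = z})
      (fun n t => (P n).real {ω | L n ω = stdPoint (P n) (L n) t})
      (fun n t => Real.exp (-t ^ 2 / 2) * (P n).real {ω | L n ω = ∫ ω', L n ω' ∂(P n)}) ∧
    UnifEquiv
      (fun n => {t | |t| ≤ s n ∧ ∃ z : ℤ, stdPoint (P n) (L n) t = z})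
      (fun n t => (P n).real {ω | L n ω = stdPoint (P n) (L n) t})
      (fun n t => Real.exp (-t ^ 2 / 2) * (1 / (√(2 * Real.pi) * stdDev (P n) (L n)))) ∧
    UnifEquiv
      (fun n => {t | |t| ≤ s n})
      (fun n t => Real.exp (-t ^ 2 / 2) * (1 / (√(2 * Real.pi) * stdDev (P n) (L n))))
      (fun n t => Real.exp (-t ^ 2 / 2) * (1 / √(2 * Real.pi)) * (χ n / √(p n * α)))

/-- `(x, y)` solves the saddle-point equations for `(n, N)`; here `0 < x < ρ` is the range in which
the series `C` with radius of convergence `ρ` is evaluated. -/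
structure IsSaddlePoint (c : ℕ → ℝ) (ρ : ℝ) (n N : ℕ) (x y : ℝ) : Prop where
  x_pos : 0 < x
  x_lt : x < ρ
  y_pos : 0 < y
  lt_one : x ^ minIndex c * y < 1
  size_eq : x * y * deriv (genSeries c) x + minIndex c * c (minIndex c) *
    (x ^ minIndex c * y / (1 - x ^ minIndex c * y)) = n
  count_eq : y * genSeries c x + c (minIndex c) *
    (x ^ minIndex c * y / (1 - x ^ minIndex c * y)) = N

end

/-! Substituting `x = ρ e^{-χ}` turns the Boltzmann law into the law proportional to `w_k e^{-χk}`
with `w_k = h(k) k^{α-1}`, and `ρ` disappears. For small `χ` this law, at scale `1/χ`, looks like a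
Gamma law of shape `α`. The theorem is a local central limit theorem for sums of `p` such variables,
where the law changes with `n`. Both `p → ∞` and `χ → 0` are allowed, in any relation to each other.

The input on `h` is local uniformity of slow variation and Potter's bound. Together they give
Karamata's Abelian theorem `∑ h(k) k^{β-1} e^{-sk} ~ Γ(β) s^{-β} h(1/s)`. Everything the limit
theorem needs is then collected in `TameWeight`: the variance is asymptotic to `α/s²`; halving `s`
multiplies the Laplace series by at most a constant, which yields exponential moments at scale
`1/s`; the characteristic function satisfies `|φ(θ)| ≤ 1 - c min(1, (θ/s)²)` on `[-π, π]`; and some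
moment `∫ |φ|^{2q}` is `O(s)`. The third property comes from a uniform component of the law on
`[1/s, 2/s]`. The last comes from Parseval applied to a `q`-fold convolution: for small `α` a single
tilted law has atoms too large near `0`, but enough convolutions smooth it to a law with atoms
`O(s)`.

The local probability is a Cauchy integral of the centred moment generating function. Since `|t|`
may grow, the contour is moved to `Re z = t/σ`, the saddle point of the Gaussian model `exp(σ² z²/2
- z t σ)`, whose value there is `e^{-t²/2}`; `llKernel` is the integrand divided by this value. The
cubic Taylor error accumulates to order `|t|³/√p`, which vanishes exactly when `t = o(p^{1/6})`.
Near the real axis, dominated convergence gives the Gaussian integral `√(2π)/σ`. Away from it, `2q`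
factors of `φ` are spent on the moment bound and the others decay geometrically in `p`. This is
`TameWeight.tendsto_integral_llKernel`.

Uniformity in `t` is obtained by proving the limits along an arbitrary countably generated filter
and then using a filter on pairs `(n, t)`. For the saddle-point equations, eliminating `N` gives `n
- mN = y ∑ c_k (k - m) x^k`; as `x^m y < 1`, this stays bounded while `x` stays below a fixed `r <
ρ`, so `n - mN → ∞` forces `x → ρ`. -/

noncomputable section

/-! ### Slow variation: local uniformity and Potter's bound. -/

/-- Uniform convergence theorem for continuous functions with vanishing increments at infinity. -/
theorem tendsto_increment_atTop_prod_nhds {g : ℝ → ℝ} (hg : Continuous g)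
    (hlim : ∀ u, Tendsto (fun x => g (x + u) - g x) atTop (𝓝 0)) (u₀ : ℝ) :
    Tendsto (fun q : ℝ × ℝ => g (q.1 + q.2) - g q.1) (atTop ×ˢ 𝓝 u₀) (𝓝 0) := by
  rw [Metric.tendsto_nhds]
  intro ε hε
  have key : ∃ r > 0, ∀ᶠ y in atTop, ∀ v, |v| < r → |g (y + v) - g y| ≤ ε / 2 := by
    -- Baire category: the closed sets `E n` cover the line, so one of them contains a ball around
    -- some `a`. An increment by `v` from `y` is the difference of the increments by `a + v` and by
    -- `a` from `y - a`, each at most `ε / 4`.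
    let E : ℕ → Set ℝ := fun n => {u | ∀ x, (n : ℝ) ≤ x → |g (x + u) - g x| ≤ ε / 4}
    have hE : ∀ n, IsClosed (E n) := by
      intro n
      have : E n = ⋂ x, ⋂ (_ : (n : ℝ) ≤ x), {u | |g (x + u) - g x| ≤ ε / 4} := by
        ext u; simp [E]
      rw [this]
      refine isClosed_iInter fun x => isClosed_iInter fun _ => ?_
      exact isClosed_le (by fun_prop) continuous_const
    have hU : ⋃ n, E n = Set.univ := by
      refine Set.eq_univ_of_forall fun u => ?_
      have h1 := (Metric.tendsto_nhds.1 (hlim u)) (ε / 4) (by positivity)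
      obtain ⟨X, hX⟩ := eventually_atTop.1 h1
      obtain ⟨n, hn⟩ := exists_nat_ge X
      refine Set.mem_iUnion.2 ⟨n, fun x hx => ?_⟩
      have := hX x (hn.trans hx)
      rw [Real.dist_eq, sub_zero] at this
      exact this.le
    obtain ⟨n, a, ha⟩ := nonempty_interior_of_iUnion_of_closed hE hU
    obtain ⟨r, hr, hball⟩ := Metric.isOpen_iff.1 isOpen_interior a ha
    refine ⟨r, hr, eventually_atTop.2 ⟨n + a, fun y hy v hv => ?_⟩⟩
    have h1 : a + v ∈ E n := interior_subset (hball (by simpa [Real.dist_eq] using hv))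
    have h2 : a ∈ E n := interior_subset ha
    have h3 := h1 (y - a) (by linarith)
    have h4 := h2 (y - a) (by linarith)
    rw [show y - a + (a + v) = y + v by ring] at h3
    rw [show y - a + a = y by ring] at h4
    rw [abs_le] at *
    constructor <;> linarith [h3.1, h3.2, h4.1, h4.2]
  obtain ⟨r, hr, hev⟩ := key
  have h0 := (Metric.tendsto_nhds.1 (hlim u₀)) (ε / 2) (by positivity)
  have hev' := (tendsto_atTop_add_const_right atTop u₀ tendsto_id).eventually hev
  refine ((hev'.and h0).prod_mk (Metric.ball_mem_nhds u₀ hr)).mono ?_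
  rintro ⟨x, u⟩ ⟨⟨h1, h2⟩, h3⟩
  have h4 := h1 (u - u₀) (by simpa [Real.dist_eq] using h3)
  simp only [id, Real.dist_eq, sub_zero] at h4 h2 ⊢
  rw [show x + u₀ + (u - u₀) = x + u by ring] at h4
  rw [abs_lt] at *
  rw [abs_le] at h4
  constructor <;> linarith [h4.1, h4.2, h2.1, h2.2]

/-- Increments of a function with uniformly small unit increments grow at most linearly. -/
theorem abs_sub_le_of_unit_increment {g : ℝ → ℝ} {ε X : ℝ}
    (hstep : ∀ x, X ≤ x → ∀ u ∈ Set.Icc (0 : ℝ) 1, |g (x + u) - g x| ≤ ε)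
    {x y : ℝ} (hx : X ≤ x) (hy : X ≤ y) : |g y - g x| ≤ ε * (|y - x| + 1) := by
  have hε : 0 ≤ ε := (abs_nonneg _).trans (hstep X le_rfl 0 (by simp))
  have hn : ∀ n : ℕ, ∀ x y, X ≤ x → x ≤ y → y ≤ x + n → |g y - g x| ≤ ε * n := by
    intro n
    induction n with
    | zero =>
      intro x y _ h1 h2
      have : y = x := le_antisymm (by simpa using h2) h1
      simp [this]
    | succ n ih =>
      intro x y hx h1 h2
      push_cast at h2 ⊢
      rcases le_total y (x + 1) with h | h
      · have := hstep x hx (y - x) ⟨by linarith, by linarith⟩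
        rw [add_sub_cancel] at this
        nlinarith [mul_nonneg hε n.cast_nonneg]
      · have h3 := ih (x + 1) y (by linarith) h (by linarith)
        have h4 := hstep x hx 1 (by simp)
        calc |g y - g x| ≤ |g y - g (x + 1)| + |g (x + 1) - g x| := abs_sub_le _ _ _
          _ ≤ _ := by linarith
  have hw : ∀ x y, X ≤ x → x ≤ y → |g y - g x| ≤ ε * (|y - x| + 1) := by
    intro x y hx hxy
    refine (hn ⌈y - x⌉₊ x y hx hxy (by linarith [Nat.le_ceil (y - x)])).trans ?_
    rw [abs_of_nonneg (sub_nonneg.2 hxy)]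
    exact mul_le_mul_of_nonneg_left (Nat.ceil_lt_add_one (sub_nonneg.2 hxy)).le hε
  rcases le_total x y with h | h
  · exact hw x y hx h
  · rw [abs_sub_comm, abs_sub_comm y x]; exact hw y x hy h

section SlowVariation

variable {h : ℝ → ℝ}

/-- A continuous eventually positive function is, from some point on, the exponential of a
continuous function of the logarithm. -/
theorem SlowlyVarying.exists_log_form (hsv : SlowlyVarying h) (hpos : ∀ᶠ x in atTop, 0 < h x)
    (hcont : ContinuousOn h (Set.Ici 1)) :
    ∃ g : ℝ → ℝ, ∃ X : ℝ, 1 ≤ X ∧ Continuous g ∧ (∀ x, X ≤ x → h x = Real.exp (g (Real.log x))) ∧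
      ∀ u, Tendsto (fun x => g (x + u) - g x) atTop (𝓝 0) := by
  obtain ⟨X₀, hX₀⟩ := eventually_atTop.1 hpos
  set X := max X₀ 1
  have hX1 : 1 ≤ X := le_max_right _ _
  have hXpos : ∀ x, X ≤ x → 0 < h x := fun x hx => hX₀ x ((le_max_left _ _).trans hx)
  have hE : ∀ y, X ≤ Real.exp (max y (Real.log X)) := by
    intro y
    calc X = Real.exp (Real.log X) := (Real.exp_log (by linarith)).symm
      _ ≤ _ := Real.exp_le_exp.2 (le_max_right _ _)
  -- The argument is frozen below `log X`, so that `g` is continuous on the whole line although `h`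
  -- is controlled only from `X` on.
  refine ⟨fun y => Real.log (h (Real.exp (max y (Real.log X)))), X, hX1, ?_, ?_, ?_⟩
  · rw [← continuousOn_univ]
    refine ContinuousOn.log ?_ fun y _ => (hXpos _ (hE y)).ne'
    exact hcont.comp (by fun_prop) fun y _ => hX1.trans (hE y)
  · intro x hx
    have : max (Real.log x) (Real.log X) = Real.log x :=
      max_eq_left (Real.log_le_log (by linarith) hx)
    have hxx : Real.exp (Real.log x) = x := Real.exp_log (by linarith)
    simp only [this, hxx]
    rw [Real.exp_log (hXpos x hx)]
  · intro u
    have h1 := ((hsv (Real.exp u) (Real.exp_pos u)).comp Real.tendsto_exp_atTop).log one_ne_zero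
    rw [Real.log_one] at h1
    refine h1.congr' ?_
    filter_upwards [eventually_ge_atTop (Real.log X), eventually_ge_atTop (Real.log X - u)]
      with x h2 h3
    simp only [Function.comp]
    rw [max_eq_left h2, max_eq_left (by linarith), Real.log_div, ← Real.exp_add, add_comm]
    · rw [← Real.exp_add]
      refine (hXpos _ ?_).ne'
      calc X = Real.exp (Real.log X) := (Real.exp_log (by linarith)).symm
        _ ≤ _ := Real.exp_le_exp.2 (by linarith)
    · refine (hXpos _ ?_).ne'
      calc X = Real.exp (Real.log X) := (Real.exp_log (by linarith)).symm
        _ ≤ _ := Real.exp_le_exp.2 (by linarith)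

/-- Slow variation is locally uniform. -/
theorem SlowlyVarying.tendsto_prod (hsv : SlowlyVarying h) (hpos : ∀ᶠ x in atTop, 0 < h x)
    (hcont : ContinuousOn h (Set.Ici 1)) {l : ℝ} (hl : 0 < l) :
    Tendsto (fun q : ℝ × ℝ => h (q.2 * q.1) / h q.1) (atTop ×ˢ 𝓝 l) (𝓝 1) := by
  obtain ⟨g, X, hX, hg, hgh, hlim⟩ := hsv.exists_log_form hpos hcont
  have h1 := tendsto_increment_atTop_prod_nhds hg hlim (Real.log l)
  have h2 : Tendsto (fun q : ℝ × ℝ => (Real.log q.1, Real.log q.2)) (atTop ×ˢ 𝓝 l)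
      (atTop ×ˢ 𝓝 (Real.log l)) :=
    Real.tendsto_log_atTop.prodMap (Real.continuousAt_log hl.ne')
  have h3 := (Real.continuous_exp.tendsto 0).comp (h1.comp h2)
  rw [Real.exp_zero] at h3
  refine h3.congr' ?_
  have h4 : Tendsto (fun q : ℝ × ℝ => q.2 * q.1) (atTop ×ˢ 𝓝 l) atTop :=
    tendsto_snd.pos_mul_atTop hl tendsto_fst
  filter_upwards [h4.eventually_ge_atTop X, tendsto_fst.eventually (eventually_ge_atTop X),
    tendsto_snd.eventually (lt_mem_nhds hl)] with q h5 h6 h7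
  simp only [Function.comp]
  rw [hgh _ h5, hgh _ h6, ← Real.exp_sub, Real.log_mul h7.ne' (by linarith), add_comm]

/-- Potter's bound. -/
theorem SlowlyVarying.potter (hsv : SlowlyVarying h) (hpos : ∀ᶠ x in atTop, 0 < h x)
    (hcont : ContinuousOn h (Set.Ici 1)) {ε : ℝ} (hε : 0 < ε) :
    ∃ K X : ℝ, 0 < K ∧ 1 ≤ X ∧ ∀ x, X ≤ x → 0 < h x ∧
      ∀ y, 1 ≤ y → h y ≤ K * h x * ((y / x) ^ ε + (x / y) ^ ε) := by
  obtain ⟨g, X₀, hX₀, hg, hgh, hlim⟩ := hsv.exists_log_form hpos hcont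
  -- Compactness of `[0, 1]` upgrades local uniformity to all unit increments. In logarithmic scale
  -- `g` then grows with slope at most `ε`, which exponentiates to Potter's power `ε`.
  have hstep : ∀ᶠ x in atTop, ∀ u ∈ Set.Icc (0 : ℝ) 1, |g (x + u) - g x| ≤ ε := by
    refine isCompact_Icc.induction_on (p := fun s => ∀ᶠ x in atTop, ∀ u ∈ s, |g (x + u) - g x| ≤ ε)
      (by simp) (fun s t hst ht => ht.mono fun x hx u hu => hx u (hst hu)) ?_ ?_
    · intro s t hs ht
      filter_upwards [hs, ht] with x h1 h2 u hu
      exact hu.elim (h1 u) (h2 u)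
    · intro u _
      have h1 := (Metric.tendsto_nhds.1 (tendsto_increment_atTop_prod_nhds hg hlim u)) ε hε
      obtain ⟨pa, hpa, pb, hpb, hab⟩ := eventually_prod_iff.1 h1
      refine ⟨{v | pb v}, mem_nhdsWithin_of_mem_nhds hpb, hpa.mono fun x hx v hv => ?_⟩
      have := hab hx hv
      rw [Real.dist_eq, sub_zero] at this
      exact this.le
  obtain ⟨X₁, hX₁⟩ := eventually_atTop.1 hstep
  set X := max X₀ (Real.exp X₁)
  have hX1 : 1 ≤ X := hX₀.trans (le_max_left _ _)
  have hXlog : ∀ x, X ≤ x → X₁ ≤ Real.log x := fun x hx => by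
    rw [Real.le_log_iff_exp_le (by linarith)]
    exact (le_max_right _ _).trans hx
  have hXh : ∀ x, X ≤ x → h x = Real.exp (g (Real.log x)) := fun x hx =>
    hgh x ((le_max_left _ _).trans hx)
  have main : ∀ x y, X ≤ x → X ≤ y →
      h y ≤ Real.exp ε * h x * ((y / x) ^ ε + (x / y) ^ ε) := by
    intro x y hx hy
    have hx0 : 0 < x := by linarith
    have hy0 : 0 < y := by linarith
    have h1 := abs_sub_le_of_unit_increment hX₁ (hXlog x hx) (hXlog y hy)
    have h2 : Real.exp (ε * |Real.log y - Real.log x|) ≤ (y / x) ^ ε + (x / y) ^ ε := by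
      rw [Real.rpow_def_of_pos (by positivity), Real.rpow_def_of_pos (by positivity),
        Real.log_div hy0.ne' hx0.ne', Real.log_div hx0.ne' hy0.ne']
      rcases abs_cases (Real.log y - Real.log x) with ⟨h3, _⟩ | ⟨h3, _⟩ <;> rw [h3]
      · rw [mul_comm]; linarith [Real.exp_pos ((Real.log x - Real.log y) * ε)]
      · rw [show ε * -(Real.log y - Real.log x) = (Real.log x - Real.log y) * ε by ring]
        linarith [Real.exp_pos ((Real.log y - Real.log x) * ε)]
    rw [hXh x hx, hXh y hy]
    calc Real.exp (g (Real.log y))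
        ≤ Real.exp (ε + g (Real.log x) + ε * |Real.log y - Real.log x|) :=
          Real.exp_le_exp.2 (by linarith [le_abs_self (g (Real.log y) - g (Real.log x))])
      _ = Real.exp ε * Real.exp (g (Real.log x)) * Real.exp (ε * |Real.log y - Real.log x|) := by
          rw [Real.exp_add, Real.exp_add]
      _ ≤ _ := by gcongr
  obtain ⟨H, hH⟩ := (isCompact_Icc (a := (1 : ℝ)) (b := X)).bddAbove_image
    (f := h) (hcont.mono fun x hx => hx.1)
  set H' := max H 0
  have hXX : 0 < h X := by rw [hXh X le_rfl]; exact Real.exp_pos _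
  -- This constant serves `1 ≤ y ≤ X`, where `h y ≤ H'` by compactness. Comparing `h X` with `h x`
  -- costs a factor `2 x^ε`, and `y ≤ X` gives `x^ε ≤ X^ε (x / y)^ε`.
  set A := H' * (Real.exp ε * 2) / h X * X ^ ε
  have hA : 0 ≤ A := by positivity
  refine ⟨max (Real.exp ε) A, X, lt_max_of_lt_left (Real.exp_pos _), hX1, fun x hx => ?_⟩
  have hx0 : 0 < x := by linarith
  have hhx : 0 < h x := by rw [hXh x hx]; exact Real.exp_pos _
  refine ⟨hhx, fun y hy => ?_⟩
  have hy0 : 0 < y := by linarith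
  rcases le_total X y with hXy | hXy
  · exact (main x y hx hXy).trans (by gcongr; exact le_max_left _ _)
  · have h1 : h y ≤ H' := (hH ⟨y, ⟨hy, hXy⟩, rfl⟩).trans (le_max_left _ _)
    have h2 : h X ≤ Real.exp ε * h x * (2 * x ^ ε) := by
      refine (main x X hx le_rfl).trans ?_
      have h3 : (X / x) ^ ε ≤ x ^ ε := by
        gcongr
        rw [div_le_iff₀ hx0]; nlinarith
      have h4 : (x / X) ^ ε ≤ x ^ ε := by
        gcongr
        exact div_le_self hx0.le hX1
      gcongr
      linarith
    have h5 : x ^ ε ≤ X ^ ε * (x / y) ^ ε := by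
      rw [← Real.mul_rpow (by linarith) (by positivity)]
      gcongr
      rw [mul_div_assoc', le_div_iff₀ hy0, mul_comm]
      gcongr
    calc h y ≤ H' * 1 := by linarith
      _ ≤ H' * (Real.exp ε * h x * (2 * x ^ ε) / h X) := by
          gcongr
          rwa [le_div_iff₀ hXX, one_mul]
      _ ≤ H' * (Real.exp ε * h x * (2 * (X ^ ε * (x / y) ^ ε)) / h X) := by gcongr
      _ = A * h x * (x / y) ^ ε := by simp only [A]; ring
      _ ≤ max (Real.exp ε) A * h x * ((y / x) ^ ε + (x / y) ^ ε) := by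
          gcongr
          · exact le_max_right _ _
          · have : 0 ≤ (y / x) ^ ε := by positivity
            linarith

end SlowVariation

/-! ### Karamata's Abelian theorem for Laplace series. -/

/-- The regularly varying weights `h(k) k^(β-1)`, `k ≥ 1`. -/
def regWeight (h : ℝ → ℝ) (β : ℝ) (k : ℕ) : ℝ :=
  if k = 0 then 0 else h k * (k : ℝ) ^ (β - 1)

/-- The Laplace series `∑ h(k) k^(β-1) e^(-sk)`. -/
def regLaplace (h : ℝ → ℝ) (β s : ℝ) : ℝ := ∑' k : ℕ, regWeight h β k * Real.exp (-(s * k))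

/-- A series over the positive integers as the integral of a step function of mesh `s`. -/
theorem integral_step_eq_tsum {a : ℕ → ℝ} (h0 : a 0 = 0) (ha : Summable a) {s : ℝ} (hs : 0 < s) :
    ∫ u in Set.Ioi (0 : ℝ), a ⌈u / s⌉₊ = s * ∑' k, a k := by
  have hU : Set.Ioi (0 : ℝ) = ⋃ n : ℕ, Set.Ioc (s * n) (s * (n + 1)) := by
    ext u
    simp only [Set.mem_Ioi, Set.mem_iUnion, Set.mem_Ioc]
    constructor
    · intro hu
      have hu' : 0 < u / s := by positivity
      refine ⟨⌈u / s⌉₊ - 1, ?_⟩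
      have h1 : 1 ≤ ⌈u / s⌉₊ := Nat.one_le_ceil_iff.2 hu'
      rw [Nat.cast_sub h1]
      have h2 := Nat.le_ceil (u / s)
      have h3 := Nat.ceil_lt_add_one hu'.le
      rw [div_le_iff₀ hs] at h2
      have h4 : (⌈u / s⌉₊ : ℝ) - 1 < u / s := by linarith
      rw [lt_div_iff₀ hs] at h4
      push_cast
      constructor <;> nlinarith
    · rintro ⟨n, h1, -⟩
      exact lt_of_le_of_lt (by positivity) h1
  have hval : ∀ n : ℕ, ∀ u ∈ Set.Ioc (s * (n : ℝ)) (s * (n + 1)), a ⌈u / s⌉₊ = a (n + 1) := by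
    rintro n u ⟨h1, h2⟩
    congr 1
    rw [Nat.ceil_eq_iff (by simp)]
    rw [lt_div_iff₀ hs, div_le_iff₀ hs, Nat.add_sub_cancel]
    push_cast
    constructor <;> nlinarith
  have hdisj : Pairwise (Function.onFun Disjoint fun n : ℕ => Set.Ioc (s * (n : ℝ)) (s * (n + 1))) := by
    intro i j hij
    rw [Function.onFun, Set.disjoint_left]
    rintro u ⟨h1, h2⟩ ⟨h3, h4⟩
    apply hij
    have h5 : (i : ℝ) < j + 1 := by
      by_contra! hc; nlinarith [mul_le_mul_of_nonneg_left hc hs.le]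
    have h6 : (j : ℝ) < i + 1 := by
      by_contra! hc; nlinarith [mul_le_mul_of_nonneg_left hc hs.le]
    have h5' : i < j + 1 := by exact_mod_cast h5
    have h6' : j < i + 1 := by exact_mod_cast h6
    omega
  have hint : ∀ (f : ℝ → ℝ) (b : ℝ) (n : ℕ), (∀ u ∈ Set.Ioc (s * (n : ℝ)) (s * (n + 1)), f u = b) →
      ∫ u in Set.Ioc (s * (n : ℝ)) (s * (n + 1)), f u = s * b := by
    intro f b n hf
    rw [setIntegral_congr_fun measurableSet_Ioc hf, setIntegral_const, Real.volume_real_Ioc_of_le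
      (by nlinarith), smul_eq_mul]
    ring
  have hsum1 : Summable fun n => a (n + 1) := (summable_nat_add_iff 1).2 ha
  rw [hU, integral_iUnion (fun n => measurableSet_Ioc) hdisj]
  · rw [tsum_congr fun n => hint _ _ n (hval n), tsum_mul_left, ha.tsum_eq_zero_add, h0, zero_add]
  · refine integrableOn_iUnion_of_summable_integral_norm (fun n => ?_) ?_
    · refine (integrableOn_const (C := a (n + 1)) (by simp)).congr_fun (fun u hu => (hval n u hu).symm)
        measurableSet_Ioc
    · have : ∀ n : ℕ, ∫ u in Set.Ioc (s * (n : ℝ)) (s * (n + 1)), ‖a ⌈u / s⌉₊‖ = s * ‖a (n + 1)‖ :=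
        fun n => hint _ _ n fun u hu => by rw [hval n u hu]
      simp_rw [this]
      exact hsum1.norm.mul_left s

/-- An upper bound for `y^(γ-1) e^(-y)` on `[u, u+1]`. -/
theorem rpow_mul_exp_neg_le {γ u y : ℝ} (hu : 0 < u) (h1 : u ≤ y) (h2 : y ≤ u + 1) :
    y ^ (γ - 1) * Real.exp (-y) ≤ (u ^ (γ - 1) + (u + 1) ^ (γ - 1)) * Real.exp (-u) := by
  have h3 : Real.exp (-y) ≤ Real.exp (-u) := Real.exp_le_exp.2 (by linarith)
  have h4 : y ^ (γ - 1) ≤ u ^ (γ - 1) + (u + 1) ^ (γ - 1) := by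
    have p1 : 0 ≤ u ^ (γ - 1) := by positivity
    have p2 : 0 ≤ (u + 1) ^ (γ - 1) := by positivity
    rcases le_total 0 (γ - 1) with h | h
    · have := Real.rpow_le_rpow (by linarith) h2 h
      linarith
    · have := Real.rpow_le_rpow_of_nonpos hu h1 h
      linarith
  have : 0 ≤ y ^ (γ - 1) := by have := hu.trans_le h1; positivity
  gcongr

theorem integrableOn_rpow_add_one_mul_exp_neg {γ : ℝ} (hγ : 0 < γ) :
    IntegrableOn (fun u : ℝ => (u ^ (γ - 1) + (u + 1) ^ (γ - 1)) * Real.exp (-u)) (Set.Ioi 0) := by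
  have h1 := Real.GammaIntegral_convergent hγ
  have h2 : IntegrableOn (fun u : ℝ => Real.exp (-(u + 1)) * (u + 1) ^ (γ - 1)) (Set.Ioi 0) := by
    have h3 : IntegrableOn (fun x : ℝ => Real.exp (-x) * x ^ (γ - 1)) (Set.Ioi 1) :=
      h1.mono_set (Set.Ioi_subset_Ioi zero_le_one)
    have h4 := (MeasurePreserving.integrableOn_comp_preimage
      (measurePreserving_add_right (volume : Measure ℝ) 1)
      (MeasurableEquiv.addRight (1 : ℝ)).measurableEmbedding
      (f := fun x : ℝ => Real.exp (-x) * x ^ (γ - 1)) (s := Set.Ioi 1)).2 h3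
    simpa [Function.comp_def] using h4
  refine (h1.add (h2.const_mul (Real.exp 1))).congr_fun (fun u _ => ?_) measurableSet_Ioi
  simp only [Pi.add_apply]
  rw [← mul_assoc, ← Real.exp_add, show 1 + -(u + 1) = -u by ring]
  ring

section Laplace

variable {h : ℝ → ℝ}

theorem regWeight_nonneg (hnn : ∀ x, 1 ≤ x → 0 ≤ h x) (β : ℝ) (k : ℕ) : 0 ≤ regWeight h β k := by
  unfold regWeight
  split_ifs with hk
  · exact le_rfl
  · have : (1 : ℝ) ≤ k := by exact_mod_cast Nat.one_le_iff_ne_zero.2 hk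
    have := hnn _ this
    positivity

theorem regWeight_mul_pow (h : ℝ → ℝ) (β : ℝ) (k j : ℕ) :
    regWeight h β k * (k : ℝ) ^ j = regWeight h (β + j) k := by
  unfold regWeight
  split_ifs with hk
  · simp
  · have : (0 : ℝ) < k := by exact_mod_cast Nat.pos_of_ne_zero hk
    rw [mul_assoc, ← Real.rpow_natCast, ← Real.rpow_add this]
    ring_nf

theorem SlowlyVarying.summable_regWeight (hsv : SlowlyVarying h) (hpos : ∀ᶠ x in atTop, 0 < h x)
    (hcont : ContinuousOn h (Set.Ici 1)) (hnn : ∀ x, 1 ≤ x → 0 ≤ h x) (β : ℝ) {s : ℝ}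
    (hs : 0 < s) : Summable fun k : ℕ => regWeight h β k * Real.exp (-(s * k)) := by
  obtain ⟨K, X, hK, hX, hP⟩ := hsv.potter hpos hcont one_pos
  obtain ⟨hX0, hP⟩ := hP X le_rfl
  obtain ⟨n, hn⟩ := exists_nat_ge β
  -- Potter's bound from the single base point `X`, with exponent `1`, gives `h k = O(k)`, so the
  -- terms are dominated by a polynomial times `e^{-sk}`.
  have h1 := (Real.summable_pow_mul_exp_neg_nat_mul n hs).mul_left (K * h X * (1 + X))
  refine Summable.of_nonneg_of_le (fun k => ?_) (fun k => ?_) h1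
  · have := regWeight_nonneg hnn β k
    positivity
  · unfold regWeight
    split_ifs with hk
    · simp only [zero_mul]; positivity
    · have hk1 : (1 : ℝ) ≤ k := by exact_mod_cast Nat.one_le_iff_ne_zero.2 hk
      have h2 : h k ≤ K * h X * (1 + X) * k := by
        refine (hP k hk1).trans ?_
        rw [Real.rpow_one, Real.rpow_one, mul_assoc _ (1 + X)]
        gcongr
        have : (k : ℝ) / X ≤ k := div_le_self (by positivity) hX
        have : X / k ≤ X * k := by
          rw [div_le_iff₀ (by positivity)]
          nlinarith [mul_le_mul hk1 hk1 (by positivity) (by positivity)]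
        linarith
      have h3 : (k : ℝ) * (k : ℝ) ^ (β - 1) ≤ (k : ℝ) ^ n := by
        rw [← Real.rpow_natCast]
        nth_rw 1 [← Real.rpow_one (k : ℝ)]
        rw [← Real.rpow_add (by linarith)]
        exact Real.rpow_le_rpow_of_exponent_le hk1 (by linarith)
      calc h k * (k : ℝ) ^ (β - 1) * Real.exp (-(s * k))
          ≤ K * h X * (1 + X) * k * (k : ℝ) ^ (β - 1) * Real.exp (-(s * k)) := by gcongr
        _ = K * h X * (1 + X) * (k * (k : ℝ) ^ (β - 1)) * Real.exp (-(s * k)) := by ring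
        _ ≤ K * h X * (1 + X) * (k : ℝ) ^ n * Real.exp (-(s * k)) := by gcongr
        _ = _ := by rw [neg_mul]; ring

/-- The Abelian theorem of Karamata for Laplace series. -/
theorem SlowlyVarying.tendsto_regLaplace (hsv : SlowlyVarying h) (hpos : ∀ᶠ x in atTop, 0 < h x)
    (hcont : ContinuousOn h (Set.Ici 1)) (hnn : ∀ x, 1 ≤ x → 0 ≤ h x) {β : ℝ} (hβ : 0 < β) :
    Tendsto (fun s => regLaplace h β s * s ^ β / h (1 / s)) (𝓝[>] 0) (𝓝 (Real.Gamma β)) := by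
  -- The exponent `β / 2` keeps both perturbed powers `y^{β - 1 ± β/2}` integrable at `0`.
  obtain ⟨K, X, hK, hX, hP⟩ := hsv.potter hpos hcont (half_pos hβ)
  have hinv : Tendsto (fun s : ℝ => 1 / s) (𝓝[>] 0) atTop := by
    simpa using tendsto_inv_nhdsGT_zero (𝕜 := ℝ)
  set F : ℝ → ℝ → ℝ := fun s u =>
    regWeight h β ⌈u / s⌉₊ * Real.exp (-(s * ⌈u / s⌉₊)) * (s ^ (β - 1) / h (1 / s))
  have hFeq : ∀ s u : ℝ, 0 < s → 0 < u → F s u = h (s * ⌈u / s⌉₊ * (1 / s)) / h (1 / s) *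
      ((s * ⌈u / s⌉₊) ^ (β - 1) * Real.exp (-(s * ⌈u / s⌉₊))) := by
    intro s u hs hu
    have hk : 1 ≤ ⌈u / s⌉₊ := Nat.one_le_ceil_iff.2 (by positivity)
    simp only [F, regWeight]
    rw [if_neg (by omega), Real.mul_rpow hs.le (by positivity)]
    rw [show s * (⌈u / s⌉₊ : ℝ) * (1 / s) = ⌈u / s⌉₊ by field_simp]
    ring
  have hceil : ∀ s u : ℝ, 0 < s → 0 < u → u ≤ s * ⌈u / s⌉₊ ∧ s * ⌈u / s⌉₊ ≤ u + s := by
    intro s u hs hu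
    have h1 := Nat.le_ceil (u / s)
    have h2 := (Nat.ceil_lt_add_one (div_pos hu hs).le).le
    rw [div_le_iff₀ hs] at h1
    refine ⟨by linarith, ?_⟩
    calc s * (⌈u / s⌉₊ : ℝ) ≤ s * (u / s + 1) := by gcongr
      _ = u + s := by field_simp
  have hint : ∀ᶠ s in 𝓝[>] (0 : ℝ),
      ∫ u in Set.Ioi (0 : ℝ), F s u = regLaplace h β s * s ^ β / h (1 / s) := by
    filter_upwards [self_mem_nhdsWithin] with s hs
    have hs0 : (0 : ℝ) < s := hs
    simp only [F]
    rw [integral_mul_const, integral_step_eq_tsum (a := fun k => regWeight h β k *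
      Real.exp (-(s * k))) (by simp [regWeight]) (hsv.summable_regWeight hpos hcont hnn β hs0) hs0,
      Real.rpow_sub_one hs0.ne', ← regLaplace]
    field_simp
  refine Tendsto.congr' hint ?_
  rw [Real.Gamma_eq_integral hβ]
  -- The series is a step-function integral with mesh `s`, evaluated at `y = s ⌈u / s⌉ ∈ [u, u +
  -- s]`. Keeping the powers at both ends `u` and `u + 1` makes the dominating function valid for
  -- either sign of the exponent.
  refine tendsto_integral_filter_of_dominated_convergence
    (fun u => K * ((u ^ (3 * β / 2 - 1) + (u + 1) ^ (3 * β / 2 - 1)) * Real.exp (-u) +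
      (u ^ (β / 2 - 1) + (u + 1) ^ (β / 2 - 1)) * Real.exp (-u))) ?_ ?_ ?_ ?_
  · refine Eventually.of_forall fun s => Measurable.aestronglyMeasurable ?_
    have hm : Measurable fun u : ℝ => ⌈u / s⌉₊ := Nat.measurable_ceil.comp (measurable_id.div_const s)
    exact (measurable_from_nat (f := fun k : ℕ => regWeight h β k *
      Real.exp (-(s * k)) * (s ^ (β - 1) / h (1 / s)))).comp hm
  · filter_upwards [self_mem_nhdsWithin, hinv.eventually_ge_atTop X,
      nhdsWithin_le_nhds (gt_mem_nhds (zero_lt_one (α := ℝ)))] with s hs hsX hs1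
    have hs0 : (0 : ℝ) < s := hs
    filter_upwards [ae_restrict_mem measurableSet_Ioi] with u hu
    have hu0 : (0 : ℝ) < u := hu
    obtain ⟨h1, h2⟩ := hceil s u hs0 hu0
    obtain ⟨hh, hP⟩ := hP _ hsX
    have hk : 1 ≤ ⌈u / s⌉₊ := Nat.one_le_ceil_iff.2 (by positivity)
    have hk' : (1 : ℝ) ≤ ⌈u / s⌉₊ := by exact_mod_cast hk
    rw [hFeq s u hs0 hu0]
    have hsk : s * (⌈u / s⌉₊ : ℝ) * (1 / s) = ⌈u / s⌉₊ := by field_simp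
    set y := s * (⌈u / s⌉₊ : ℝ)
    have hy : 0 < y := hu0.trans_le h1
    have h3 := hP _ hk'
    rw [← hsk] at h3
    have h4 : h (y * (1 / s)) / h (1 / s) ≤ K * (y ^ (β / 2) + (y ^ (β / 2))⁻¹) := by
      rw [div_le_iff₀ hh]
      refine h3.trans (le_of_eq ?_)
      rw [show y * (1 / s) / (1 / s) = y by field_simp, show 1 / s / (y * (1 / s)) = y⁻¹ by field_simp,
        Real.inv_rpow hy.le]
      ring
    have h5 : 0 ≤ h (y * (1 / s)) := hnn _ (by rw [hsk]; exact hk')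
    rw [Real.norm_of_nonneg (by positivity)]
    have h6 := rpow_mul_exp_neg_le (γ := 3 * β / 2) hu0 h1 (h2.trans (by linarith))
    have h7 := rpow_mul_exp_neg_le (γ := β / 2) hu0 h1 (h2.trans (by linarith))
    have h8 : y ^ (3 * β / 2 - 1) = y ^ (β / 2) * y ^ (β - 1) := by
      rw [← Real.rpow_add hy]; ring_nf
    have h9 : y ^ (β / 2 - 1) = (y ^ (β / 2))⁻¹ * y ^ (β - 1) := by
      rw [← Real.rpow_neg hy.le, ← Real.rpow_add hy]; ring_nf
    calc _ ≤ K * (y ^ (β / 2) + (y ^ (β / 2))⁻¹) * (y ^ (β - 1) * Real.exp (-y)) := by gcongr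
      _ = K * (y ^ (3 * β / 2 - 1) * Real.exp (-y) + y ^ (β / 2 - 1) * Real.exp (-y)) := by
        rw [h8, h9]; ring
      _ ≤ _ := by gcongr
  · exact ((integrableOn_rpow_add_one_mul_exp_neg (by positivity)).add
      (integrableOn_rpow_add_one_mul_exp_neg (by positivity))).const_mul K
  · filter_upwards [ae_restrict_mem measurableSet_Ioi] with u hu
    have hu0 : (0 : ℝ) < u := hu
    have hid : Tendsto (fun s : ℝ => s) (𝓝[>] 0) (𝓝 0) := tendsto_id.mono_left nhdsWithin_le_nhds
    have hy : Tendsto (fun s : ℝ => s * (⌈u / s⌉₊ : ℝ)) (𝓝[>] 0) (𝓝 u) := by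
      refine tendsto_of_tendsto_of_tendsto_of_le_of_le' tendsto_const_nhds
        (h := fun s => u + s) (by simpa using tendsto_const_nhds.add hid) ?_ ?_
      · filter_upwards [self_mem_nhdsWithin] with s hs using (hceil s u hs hu0).1
      · filter_upwards [self_mem_nhdsWithin] with s hs using (hceil s u hs hu0).2
    have h1 := (hsv.tendsto_prod hpos hcont hu0).comp (hinv.prodMk hy)
    have h2 := (hy.rpow_const (p := β - 1) (Or.inl hu0.ne')).mul
      ((Real.continuous_exp.tendsto _).comp hy.neg)
    have h3 := h1.mul h2
    rw [one_mul, mul_comm (u ^ (β - 1))] at h3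
    refine h3.congr' ?_
    filter_upwards [self_mem_nhdsWithin] with s hs
    rw [hFeq s u hs hu0]
    rfl

end Laplace

/-! ### Exponential sums over intervals. -/

section Trigonometric

/-- The geometric sum is a quotient with numerator at most `2` and denominator `2 |sin(θ/2)|`, and
Jordan's inequality bounds the latter below by `2|θ| / π`. -/
theorem norm_geom_sum_exp_le {θ : ℝ} (hθ0 : θ ≠ 0) (hθ : |θ| ≤ Real.pi) (M : ℕ) :
    ‖∑ k ∈ Finset.range M, Complex.exp (Complex.I * θ) ^ k‖ ≤ Real.pi / |θ| := by
  have habs : 0 < |θ| := abs_pos.2 hθ0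
  have h1 := geom_sum_mul (Complex.exp (Complex.I * θ)) M
  have h2 := congrArg norm h1
  rw [norm_mul, Complex.norm_exp_I_mul_ofReal_sub_one] at h2
  have h3 : ‖Complex.exp (Complex.I * θ) ^ M - 1‖ ≤ 2 := by
    refine (norm_sub_le _ _).trans ?_
    rw [norm_pow, mul_comm, Complex.norm_exp_ofReal_mul_I, one_pow, norm_one]
    norm_num
  have h4 : 2 * |θ| / Real.pi ≤ ‖2 * Real.sin (θ / 2)‖ := by
    rw [norm_mul, Real.norm_eq_abs, Real.norm_eq_abs, abs_two]
    have h5 : |Real.sin (θ / 2)| = Real.sin (|θ| / 2) := by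
      rw [Real.abs_sin_eq_sin_abs_of_abs_le_pi, abs_div, abs_two]
      rw [abs_div, abs_two]; linarith [abs_nonneg θ]
    have h6 := Real.mul_le_sin (x := |θ| / 2) (by positivity) (by linarith)
    rw [h5]
    calc 2 * |θ| / Real.pi = 2 * (2 / Real.pi * (|θ| / 2)) := by ring
      _ ≤ _ := by gcongr
  rw [le_div_iff₀ habs]
  have h7 : ‖∑ k ∈ Finset.range M, Complex.exp (Complex.I * θ) ^ k‖ * (2 * |θ| / Real.pi) ≤ 2 :=
    (mul_le_mul_of_nonneg_left h4 (norm_nonneg _)).trans (h2.le.trans h3)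
  rw [mul_div_assoc', div_le_iff₀ Real.pi_pos] at h7
  linarith

/-- Exponential sums over `2J` consecutive integers are smaller than trivial. -/
theorem norm_sum_exp_block_le {θ : ℝ} (hθ : |θ| ≤ Real.pi) (J : ℕ) :
    ‖∑ k ∈ Finset.range (2 * J), Complex.exp (Complex.I * θ) ^ k‖ ≤
      2 * J * (1 - 1 / 20 * min 1 ((J * θ) ^ 2)) := by
  have hpi : Real.pi ^ 2 < 10 := by nlinarith [Real.pi_lt_d2, Real.pi_gt_three]
  rcases le_or_gt (J * |θ|) Real.pi with h | h
  · have h1 : ∑ k ∈ Finset.range (2 * J), Complex.exp (Complex.I * θ) ^ k =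
        (1 + Complex.exp (Complex.I * θ) ^ J) *
          ∑ k ∈ Finset.range J, Complex.exp (Complex.I * θ) ^ k := by
      rw [two_mul, Finset.sum_range_add, add_mul, one_mul, Finset.mul_sum]
      simp_rw [pow_add]
    have h2 : ‖∑ k ∈ Finset.range J, Complex.exp (Complex.I * θ) ^ k‖ ≤ J := by
      refine (norm_sum_le _ _).trans ?_
      simp_rw [norm_pow, mul_comm Complex.I, Complex.norm_exp_ofReal_mul_I]
      simp
    have h3 : ‖1 + Complex.exp (Complex.I * θ) ^ J‖ = 2 * Real.cos (J * θ / 2) := by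
      have h4 := Complex.norm_exp_I_mul_ofReal_sub_one (J * θ + Real.pi)
      rw [add_div, Real.sin_add_pi_div_two] at h4
      have h5 : Complex.exp (Complex.I * ((J * θ + Real.pi : ℝ) : ℂ)) - 1 =
          -(1 + Complex.exp (Complex.I * θ) ^ J) := by
        rw [← Complex.exp_nat_mul]
        push_cast
        rw [mul_add, Complex.exp_add, mul_comm Complex.I (Real.pi : ℂ), Complex.exp_pi_mul_I]
        ring_nf
      rw [h5, norm_neg] at h4
      rw [h4, Real.norm_of_nonneg]
      have : |J * θ / 2| ≤ Real.pi / 2 := by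
        rw [abs_div, abs_mul, Nat.abs_cast, abs_two]; linarith
      have := Real.cos_nonneg_of_neg_pi_div_two_le_of_le (abs_le.1 this).1 (abs_le.1 this).2
      positivity
    have h6 : Real.cos (J * θ / 2) ≤ 1 - 1 / 20 * (J * θ) ^ 2 := by
      refine (Real.cos_le_one_sub_mul_cos_sq (x := J * θ / 2) ?_).trans ?_
      · rw [abs_div, abs_mul, Nat.abs_cast, abs_two]; linarith [Real.pi_pos]
      · have : 1 / 5 ≤ 2 / Real.pi ^ 2 := by
          rw [div_le_div_iff₀ (by norm_num) (by positivity)]; linarith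
        nlinarith [mul_le_mul_of_nonneg_right this (sq_nonneg (J * θ / 2))]
    rw [h1, norm_mul, h3]
    calc 2 * Real.cos (J * θ / 2) * ‖∑ k ∈ Finset.range J, Complex.exp (Complex.I * θ) ^ k‖
        ≤ 2 * Real.cos (J * θ / 2) * J := by
          refine mul_le_mul_of_nonneg_left h2 ?_
          rw [← h3]; exact norm_nonneg _
      _ ≤ 2 * (1 - 1 / 20 * min 1 ((J * θ) ^ 2)) * J := by
          gcongr
          exact h6.trans (by gcongr; exact min_le_right _ _)
      _ = _ := by ring
  · have hθ0 : θ ≠ 0 := by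
      rintro rfl
      simp at h
      linarith [Real.pi_pos]
    refine (norm_geom_sum_exp_le hθ0 hθ _).trans ?_
    -- When `J|θ| > π` the geometric bound already saves half of the trivial bound `2J`.
    have : Real.pi / |θ| ≤ J := by
      rw [div_le_iff₀ (abs_pos.2 hθ0)]; exact h.le
    have : min 1 ((J * θ) ^ 2) ≤ 1 := min_le_left _ _
    nlinarith [J.cast_nonneg (α := ℝ)]

end Trigonometric

/-! ### Laplace series and their powers. -/

section LaplaceSeries

/-- The Laplace series of a weight sequence at a real point. -/
def lap (w : ℕ → ℝ) (s : ℝ) : ℝ := ∑' k : ℕ, w k * Real.exp (-(s * k))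

/-- The Laplace series of a weight sequence at a complex point. -/
def lapC (w : ℕ → ℝ) (z : ℂ) : ℂ := ∑' k : ℕ, (w k : ℂ) * Complex.exp (-(z * k))

/-- The coefficients of the `p`-th power of a power series. -/
def powCoeff (w : ℕ → ℝ) (p k : ℕ) : ℝ := PowerSeries.coeff k ((PowerSeries.mk w) ^ p)

variable {w : ℕ → ℝ}

theorem powCoeff_nonneg (hw : ∀ k, 0 ≤ w k) (p k : ℕ) : 0 ≤ powCoeff w p k := by
  unfold powCoeff
  induction p generalizing k with
  | zero => rw [pow_zero, PowerSeries.coeff_one]; split_ifs <;> norm_num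
  | succ p ih =>
    rw [pow_succ, PowerSeries.coeff_mul]
    exact Finset.sum_nonneg fun q _ => mul_nonneg (ih _) (by simpa using hw _)

theorem powCoeff_succ (w : ℕ → ℝ) (p k : ℕ) : powCoeff w (p + 1) k =
    ∑ q ∈ Finset.HasAntidiagonal.antidiagonal k, powCoeff w p q.1 * w q.2 := by
  simp [powCoeff, pow_succ, PowerSeries.coeff_mul]

theorem powCoeff_mul_pow (w : ℕ → ℝ) (r : ℝ) (p k : ℕ) :
    powCoeff (fun j => w j * r ^ j) p k = powCoeff w p k * r ^ k := by
  have h1 : PowerSeries.mk (fun j => w j * r ^ j) = PowerSeries.rescale r (PowerSeries.mk w) := by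
    ext n; simp [PowerSeries.coeff_rescale, mul_comm]
  rw [powCoeff, h1, ← map_pow, PowerSeries.coeff_rescale, powCoeff, mul_comm]

/-- Absolute convergence lets the Cauchy product be iterated, so formal powers of the series agree
with powers of its sum. -/
theorem hasSum_powCoeff {x : ℂ} (hx : Summable fun k => ‖(w k : ℂ) * x ^ k‖) (p : ℕ) :
    (Summable fun k => ‖(powCoeff w p k : ℂ) * x ^ k‖) ∧
      ∑' k, (powCoeff w p k : ℂ) * x ^ k = (∑' k, (w k : ℂ) * x ^ k) ^ p := by
  induction p with
  | zero =>
    have h : ∀ k : ℕ, k ≠ 0 → (powCoeff w 0 k : ℂ) * x ^ k = 0 := by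
      intro k hk; simp [powCoeff, PowerSeries.coeff_one, hk]
    refine ⟨summable_of_ne_finset_zero (s := {0}) fun k hk => ?_, ?_⟩
    · rw [h k (by simpa using hk), norm_zero]
    · rw [tsum_eq_single 0 h]; simp [powCoeff]
  | succ p ih =>
    obtain ⟨h1, h2⟩ := ih
    have h3 : ∀ k : ℕ, (powCoeff w (p + 1) k : ℂ) * x ^ k = ∑ q ∈ Finset.HasAntidiagonal.antidiagonal k,
        ((powCoeff w p q.1 : ℂ) * x ^ q.1) * ((w q.2 : ℂ) * x ^ q.2) := by
      intro k
      rw [powCoeff_succ, Complex.ofReal_sum, Finset.sum_mul]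
      refine Finset.sum_congr rfl fun q hq => ?_
      rw [← Finset.HasAntidiagonal.mem_antidiagonal.1 hq, pow_add]
      push_cast
      ring
    have h4 := summable_norm_sum_mul_antidiagonal_of_summable_norm h1 hx
    have h5 := tsum_mul_tsum_eq_tsum_sum_antidiagonal_of_summable_norm h1 hx
    refine ⟨h4.congr fun k => by rw [h3 k], ?_⟩
    rw [tsum_congr h3, ← h5, h2, pow_succ]

theorem exp_neg_mul_natCast (z : ℂ) (k : ℕ) : Complex.exp (-(z * k)) = Complex.exp (-z) ^ k := by
  rw [← Complex.exp_nat_mul]; ring_nf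

theorem summable_norm_lapC (hw : ∀ k, 0 ≤ w k) {z : ℂ}
    (hs : Summable fun k : ℕ => w k * Real.exp (-(z.re * k))) :
    Summable fun k : ℕ => ‖(w k : ℂ) * Complex.exp (-(z * k))‖ := by
  refine hs.congr fun k => ?_
  rw [norm_mul, Complex.norm_real, Real.norm_of_nonneg (hw k), Complex.norm_exp]
  simp

theorem hasSum_lapC_pow (hw : ∀ k, 0 ≤ w k) {z : ℂ}
    (hs : Summable fun k : ℕ => w k * Real.exp (-(z.re * k))) (p : ℕ) :
    (Summable fun k : ℕ => ‖(powCoeff w p k : ℂ) * Complex.exp (-(z * k))‖) ∧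
      ∑' k : ℕ, (powCoeff w p k : ℂ) * Complex.exp (-(z * k)) = lapC w z ^ p := by
  have h := summable_norm_lapC hw hs
  unfold lapC
  simp_rw [exp_neg_mul_natCast] at h ⊢
  exact hasSum_powCoeff h p

theorem lapC_ofReal (w : ℕ → ℝ) (s : ℝ) : lapC w s = lap w s := by
  rw [lapC, lap, Complex.ofReal_tsum]
  simp

theorem lap_powCoeff (hw : ∀ k, 0 ≤ w k) {s : ℝ}
    (hs : Summable fun k : ℕ => w k * Real.exp (-(s * k))) (p : ℕ) :
    HasSum (fun k : ℕ => powCoeff w p k * Real.exp (-(s * k))) (lap w s ^ p) := by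
  obtain ⟨h1, h2⟩ := hasSum_lapC_pow (z := (s : ℂ)) hw (by simpa using hs) p
  rw [lapC_ofReal] at h2
  have h3 := h1.of_norm.hasSum
  rw [h2] at h3
  have h4 : HasSum (fun k : ℕ => ((powCoeff w p k * Real.exp (-(s * k)) : ℝ) : ℂ))
      ((lap w s ^ p : ℝ) : ℂ) := by
    push_cast
    exact h3
  exact Complex.hasSum_ofReal.1 h4

theorem continuous_lapC_vertical (hw : ∀ k, 0 ≤ w k) {s : ℝ}
    (hs : Summable fun k : ℕ => w k * Real.exp (-(s * k))) :
    Continuous fun θ : ℝ => lapC w (s + θ * Complex.I) := by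
  refine continuous_tsum (fun k => by fun_prop) hs fun k θ => le_of_eq ?_
  rw [norm_mul, Complex.norm_real, Real.norm_of_nonneg (hw k), Complex.norm_exp]
  simp

end LaplaceSeries

/-! ### Fourier coefficients and Parseval's identity. -/

section Fourier

theorem integral_exp_int_mul (m : ℤ) :
    ∫ θ in (-Real.pi)..Real.pi, Complex.exp (θ * Complex.I * m) =
      if m = 0 then 2 * (Real.pi : ℂ) else 0 := by
  split_ifs with hm
  · simp [hm]; ring
  · have hc : (m : ℂ) * Complex.I ≠ 0 :=
      mul_ne_zero (by exact_mod_cast hm) Complex.I_ne_zero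
    have h1 : ∀ θ : ℝ, Complex.exp (θ * Complex.I * m) = Complex.exp ((m * Complex.I) * θ) := by
      intro θ; ring_nf
    simp_rw [h1]
    rw [integral_exp_mul_complex hc]
    have h2 : Complex.exp (m * Complex.I * (Real.pi : ℝ)) =
        Complex.exp (m * Complex.I * ((-Real.pi : ℝ) : ℂ)) := by
      rw [Complex.exp_eq_exp_iff_exists_int]
      exact ⟨m, by push_cast; ring⟩
    rw [h2, sub_self, zero_div]

/-- Fourier coefficients of an absolutely convergent series. -/
theorem integral_tsum_exp {b : ℕ → ℂ} (hb : Summable fun k => ‖b k‖) (N : ℤ) :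
    ∫ θ in (-Real.pi)..Real.pi, (∑' k : ℕ, b k * Complex.exp (-(θ * Complex.I * k))) *
      Complex.exp (θ * Complex.I * N) = 2 * Real.pi * ∑' k : ℕ, if (k : ℤ) = N then b k else 0 := by
  have hn : ∀ (k : ℕ) (θ : ℝ), ‖b k * Complex.exp (-(θ * Complex.I * k)) *
      Complex.exp (θ * Complex.I * N)‖ = ‖b k‖ := by
    intro k θ
    rw [norm_mul, norm_mul, Complex.norm_exp, Complex.norm_exp]
    simp
  have h1 := intervalIntegral.hasSum_integral_of_dominated_convergence (μ := volume)
    (a := -Real.pi) (b := Real.pi)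
    (F := fun (k : ℕ) (θ : ℝ) => b k * Complex.exp (-(θ * Complex.I * k)) *
      Complex.exp (θ * Complex.I * N))
    (f := fun θ : ℝ => (∑' k : ℕ, b k * Complex.exp (-(θ * Complex.I * k))) *
      Complex.exp (θ * Complex.I * N)) (fun k _ => ‖b k‖)
    (fun k => (by fun_prop : Continuous _).aestronglyMeasurable)
    (fun k => Eventually.of_forall fun θ _ => (hn k θ).le)
    (Eventually.of_forall fun θ _ => hb) intervalIntegrable_const
    (Eventually.of_forall fun θ _ => by
      refine HasSum.mul_right _ (Summable.hasSum ?_)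
      refine Summable.of_norm (hb.congr fun k => ?_)
      rw [norm_mul, Complex.norm_exp]
      simp)
  rw [← h1.tsum_eq, ← tsum_mul_left]
  refine tsum_congr fun k => ?_
  have h2 : ∀ θ : ℝ, b k * Complex.exp (-(θ * Complex.I * k)) * Complex.exp (θ * Complex.I * N) =
      b k * Complex.exp (θ * Complex.I * ((N - k : ℤ) : ℂ)) := by
    intro θ
    rw [mul_assoc, ← Complex.exp_add]
    push_cast
    ring_nf
  simp_rw [h2]
  rw [intervalIntegral.integral_const_mul, integral_exp_int_mul]
  by_cases h : (k : ℤ) = N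
  · rw [if_pos h, if_pos (by omega)]; ring
  · rw [if_neg h, if_neg (by omega)]; ring

/-- Parseval's identity for absolutely convergent series with real coefficients. -/
theorem integral_norm_sq_tsum_exp {b : ℕ → ℝ} (hb : Summable fun k => ‖(b k : ℂ)‖) :
    ∫ θ in (-Real.pi)..Real.pi, ‖∑' k : ℕ, (b k : ℂ) * Complex.exp (-(θ * Complex.I * k))‖ ^ 2 =
      2 * Real.pi * ∑' k, b k ^ 2 := by
  set g : ℝ → ℂ := fun θ => ∑' k : ℕ, (b k : ℂ) * Complex.exp (-(θ * Complex.I * k)) with hg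
  have hterm : ∀ (k : ℕ) (θ : ℝ), ‖(b k : ℂ) * Complex.exp (-(θ * Complex.I * k))‖ = ‖(b k : ℂ)‖ := by
    intro k θ
    rw [norm_mul, Complex.norm_exp]
    simp
  have hgc : Continuous g := continuous_tsum (fun k => by fun_prop) hb fun k θ => (hterm k θ).le
  have hgn : ∀ θ, ‖g θ‖ ≤ ∑' k, ‖(b k : ℂ)‖ := fun θ => by
    refine (norm_tsum_le_tsum_norm (hb.congr fun k => (hterm k θ).symm)).trans (le_of_eq ?_)
    exact tsum_congr fun k => hterm k θ
  -- Expanding only the conjugate factor of `|g|²` reduces Parseval to the coefficient formula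
  -- already proved.
  have hsq : ∀ θ, ((‖g θ‖ ^ 2 : ℝ) : ℂ) = ∑' k : ℕ, g θ * (b k * Complex.exp (θ * Complex.I * k)) := by
    intro θ
    rw [tsum_mul_left, Complex.ofReal_pow, ← Complex.mul_conj']
    congr 1
    rw [hg, Complex.conj_tsum]
    refine tsum_congr fun k => ?_
    rw [map_mul, Complex.conj_ofReal, ← Complex.exp_conj]
    simp
  have h1 := intervalIntegral.hasSum_integral_of_dominated_convergence (μ := volume)
    (a := -Real.pi) (b := Real.pi)
    (F := fun (k : ℕ) (θ : ℝ) => g θ * (b k * Complex.exp (θ * Complex.I * k)))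
    (f := fun θ : ℝ => ((‖g θ‖ ^ 2 : ℝ) : ℂ))
    (fun k _ => (∑' k, ‖(b k : ℂ)‖) * ‖(b k : ℂ)‖)
    (fun k => (by fun_prop : Continuous _).aestronglyMeasurable)
    (fun k => Eventually.of_forall fun θ _ => by
      have : ‖(b k : ℂ) * Complex.exp (θ * Complex.I * k)‖ = ‖(b k : ℂ)‖ := by
        rw [norm_mul, Complex.norm_exp]; simp
      rw [norm_mul, this]
      exact mul_le_mul_of_nonneg_right (hgn θ) (norm_nonneg _))
    (Eventually.of_forall fun θ _ => hb.mul_left _) intervalIntegrable_const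
    (Eventually.of_forall fun θ _ => by
      rw [hsq θ]
      refine Summable.hasSum (Summable.mul_left _ (Summable.of_norm (hb.congr fun k => ?_)))
      rw [norm_mul, Complex.norm_exp]; simp)
  have h2 := h1.tsum_eq
  rw [intervalIntegral.integral_ofReal] at h2
  apply Complex.ofReal_injective
  rw [← h2]
  push_cast
  rw [← tsum_mul_left]
  refine tsum_congr fun k => ?_
  have h3 := integral_tsum_exp hb (k : ℤ)
  have h4 : ∀ θ : ℝ, g θ * (b k * Complex.exp (θ * Complex.I * k)) =
      b k * (g θ * Complex.exp (θ * Complex.I * (k : ℤ))) := by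
    intro θ; push_cast; ring
  simp_rw [h4]
  rw [intervalIntegral.integral_const_mul, h3, tsum_eq_single k (fun j hj => if_neg (by omega)),
    if_pos rfl]
  ring

end Fourier

/-! ### Tilted laws and the analytic conditions for the limit theorem. -/

/-- The mean of the distribution proportional to `w_k e^(-sk)`. -/
def tiltMean (w : ℕ → ℝ) (s : ℝ) : ℝ := lap (fun k => w k * k) s / lap w s

/-- The variance of the distribution proportional to `w_k e^(-sk)`. -/
def tiltVar (w : ℕ → ℝ) (s : ℝ) : ℝ := lap (fun k => w k * (k : ℝ) ^ 2) s / lap w s - tiltMean w s ^ 2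

/-- Weights whose tilted distributions satisfy the hypotheses of the local limit theorem. -/
structure TameWeight (w : ℕ → ℝ) (α : ℝ) : Prop where
  alpha_pos : 0 < α
  nonneg : ∀ k, 0 ≤ w k
  summable : ∀ s, 0 < s → ∀ j : ℕ, Summable fun k : ℕ => w k * (k : ℝ) ^ j * Real.exp (-(s * k))
  lap_pos : ∀ s, 0 < s → 0 < lap w s
  variance : Tendsto (fun s => tiltVar w s * s ^ 2) (𝓝[>] 0) (𝓝 α)
  doubling : ∃ K, ∀ᶠ s in 𝓝[>] 0, lap w (s / 2) ≤ K * lap w s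
  norm_le : ∃ c, 0 < c ∧ c ≤ 1 ∧ ∀ᶠ s : ℝ in 𝓝[>] 0, ∀ θ : ℝ, |θ| ≤ Real.pi →
    ‖lapC w (s + θ * Complex.I)‖ ≤ lap w s * (1 - c * min 1 ((θ / s) ^ 2))
  power : ∃ (q : ℕ) (K : ℝ), ∀ᶠ s : ℝ in 𝓝[>] 0,
    ∫ θ in (-Real.pi)..Real.pi, ‖lapC w (s + θ * Complex.I)‖ ^ (2 * q) ≤ K * s * lap w s ^ (2 * q)

/-! ### Convolutions of power functions. -/

section Convolution

/-- Since `x^a` is concave for `0 < a ≤ 1`, Bernoulli's inequality gives `a (k+1)^{a-1} ≤ (k+1)^a -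
k^a`, and the right side telescopes. -/
theorem sum_range_rpow_le {a : ℝ} (ha : 0 < a) (ha1 : a ≤ 1) (k : ℕ) :
    ∑ i ∈ Finset.range (k + 1), regWeight (fun _ => 1) a i ≤ (k : ℝ) ^ a / a := by
  induction k with
  | zero => simp [regWeight]; positivity
  | succ k ih =>
    rw [Finset.sum_range_succ]
    have hx : (0 : ℝ) < (k : ℝ) + 1 := by positivity
    have h1 : (1 + -(1 / ((k : ℝ) + 1))) ^ a ≤ 1 + a * -(1 / ((k : ℝ) + 1)) := by
      refine rpow_one_add_le_one_add_mul_self ?_ ha.le ha1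
      have : 1 / ((k : ℝ) + 1) ≤ 1 := by
        rw [div_le_one hx]; linarith [k.cast_nonneg (α := ℝ)]
      linarith
    have h2 : (k : ℝ) = (k + 1) * (1 + -(1 / ((k : ℝ) + 1))) := by field_simp; ring
    have h3 : 0 ≤ 1 + -(1 / ((k : ℝ) + 1)) := by
      by_contra! hc
      nlinarith [mul_neg_of_pos_of_neg hx hc, k.cast_nonneg (α := ℝ)]
    have h4 : (k : ℝ) ^ a ≤ ((k : ℝ) + 1) ^ a - a * ((k : ℝ) + 1) ^ (a - 1) := by
      nth_rw 1 [h2]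
      rw [Real.mul_rpow hx.le h3, Real.rpow_sub_one hx.ne']
      calc _ ≤ ((k : ℝ) + 1) ^ a * (1 + a * -(1 / ((k : ℝ) + 1))) := by gcongr
        _ = _ := by ring
    have h5 : regWeight (fun _ => 1) a (k + 1) = ((k : ℝ) + 1) ^ (a - 1) := by
      simp [regWeight]
    rw [h5]
    push_cast
    rw [le_div_iff₀ ha] at ih ⊢
    linarith

/-- Convolution of two power functions. -/
theorem sum_antidiagonal_rpow_le {a b : ℝ} (ha : 0 < a) (hb : 0 < b) (hab : a + b ≤ 1) (k : ℕ) :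
    ∑ q ∈ Finset.HasAntidiagonal.antidiagonal k,
      regWeight (fun _ => 1) a q.1 * regWeight (fun _ => 1) b q.2 ≤
      (2 / a + 2 / b) * regWeight (fun _ => 1) (a + b) k := by
  have hnn : ∀ (c : ℝ) (i : ℕ), 0 ≤ regWeight (fun _ => 1) c i :=
    regWeight_nonneg fun _ _ => zero_le_one
  rcases Nat.eq_zero_or_pos k with rfl | hk
  · simp [regWeight]
  have hk' : (0 : ℝ) < k := by exact_mod_cast hk
  have hhalf : ∀ (c : ℝ) (j : ℕ), 0 < c → c ≤ 1 → k ≤ 2 * j →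
      regWeight (fun _ => 1) c j ≤ 2 * (k : ℝ) ^ (c - 1) := by
    intro c j hc hc1 hj
    rw [regWeight, if_neg (by omega), one_mul]
    have hj' : (k : ℝ) / 2 ≤ j := by
      rw [div_le_iff₀ two_pos, mul_comm]; exact_mod_cast hj
    refine (Real.rpow_le_rpow_of_nonpos (by positivity) hj' (by linarith)).trans ?_
    rw [Real.div_rpow hk'.le two_pos.le, div_eq_mul_inv, ← Real.rpow_neg two_pos.le, mul_comm]
    gcongr
    nth_rw 2 [← Real.rpow_one (2 : ℝ)]
    exact Real.rpow_le_rpow_of_exponent_le (by norm_num) (by linarith)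
  -- In each pair the larger index is at least `k / 2`; its decreasing power is replaced by the
  -- value at `k` up to a factor `2`, which leaves a one-variable sum over the other index.
  have hterm : ∀ q ∈ Finset.HasAntidiagonal.antidiagonal k,
      regWeight (fun _ => 1) a q.1 * regWeight (fun _ => 1) b q.2 ≤
        2 * (k : ℝ) ^ (b - 1) * regWeight (fun _ => 1) a q.1 +
          2 * (k : ℝ) ^ (a - 1) * regWeight (fun _ => 1) b q.2 := by
    rintro ⟨i, j⟩ hq
    have hq' : i + j = k := Finset.HasAntidiagonal.mem_antidiagonal.1 hq
    have p1 := hnn a i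
    have p2 := hnn b j
    have p3 : 0 ≤ (k : ℝ) ^ (b - 1) := by positivity
    have p4 : 0 ≤ (k : ℝ) ^ (a - 1) := by positivity
    dsimp only
    rcases le_total i j with hij | hij
    · have := mul_le_mul_of_nonneg_left (hhalf b j hb (by linarith) (by omega)) p1
      nlinarith [mul_nonneg p4 p2]
    · have := mul_le_mul_of_nonneg_right (hhalf a i ha (by linarith) (by omega)) p2
      nlinarith [mul_nonneg p3 p1]
  have hs1 : ∑ q ∈ Finset.HasAntidiagonal.antidiagonal k, regWeight (fun _ => 1) a q.1 ≤
      (k : ℝ) ^ a / a := by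
    rw [Finset.Nat.sum_antidiagonal_eq_sum_range_succ_mk]
    exact sum_range_rpow_le ha (by linarith) k
  have hs2 : ∑ q ∈ Finset.HasAntidiagonal.antidiagonal k, regWeight (fun _ => 1) b q.2 ≤
      (k : ℝ) ^ b / b := by
    rw [← Finset.Nat.sum_antidiagonal_swap, Finset.Nat.sum_antidiagonal_eq_sum_range_succ_mk]
    exact sum_range_rpow_le hb (by linarith) k
  refine (Finset.sum_le_sum hterm).trans ?_
  rw [Finset.sum_add_distrib, ← Finset.mul_sum, ← Finset.mul_sum]
  have e1 : (k : ℝ) ^ (b - 1) * (k : ℝ) ^ a = (k : ℝ) ^ (a + b - 1) := by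
    rw [← Real.rpow_add hk']; ring_nf
  have e2 : (k : ℝ) ^ (a - 1) * (k : ℝ) ^ b = (k : ℝ) ^ (a + b - 1) := by
    rw [← Real.rpow_add hk']; ring_nf
  calc _ ≤ 2 * (k : ℝ) ^ (b - 1) * ((k : ℝ) ^ a / a) + 2 * (k : ℝ) ^ (a - 1) * ((k : ℝ) ^ b / b) := by
        gcongr
    _ = 2 / a * ((k : ℝ) ^ (b - 1) * (k : ℝ) ^ a) + 2 / b * ((k : ℝ) ^ (a - 1) * (k : ℝ) ^ b) := by
        ring
    _ = (2 / a + 2 / b) * regWeight (fun _ => 1) (a + b) k := by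
        rw [e1, e2, regWeight, if_neg (by omega)]; ring

/-- Each convolution adds `β` to the exponent. The useful case is `(j + 1) β = 1`, where the
resulting bound no longer depends on `k ≥ 1`. The constant `C` is independent of `v` and `A`, so it
can serve all tilts `s` at once. -/
theorem powCoeff_le_rpow {β : ℝ} (hβ : 0 < β) (j : ℕ) (hj : (j + 1) * β ≤ 1) :
    ∃ C, 0 ≤ C ∧ ∀ (v : ℕ → ℝ) (A : ℝ), 0 ≤ A → (∀ k, 0 ≤ v k) →
      (∀ k, v k ≤ A * regWeight (fun _ => 1) β k) →
      ∀ k, powCoeff v (j + 1) k ≤ C * A ^ (j + 1) * regWeight (fun _ => 1) ((j + 1) * β) k := by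
  have hnn : ∀ (c : ℝ) (i : ℕ), 0 ≤ regWeight (fun _ => 1) c i :=
    regWeight_nonneg fun _ _ => zero_le_one
  induction j with
  | zero =>
    refine ⟨1, zero_le_one, fun v A _ _ h k => ?_⟩
    simpa [powCoeff] using h k
  | succ j ih =>
    push_cast at hj
    obtain ⟨C, hC, h⟩ := ih (by nlinarith)
    have hj0 : (0 : ℝ) < (j + 1) * β := by positivity
    refine ⟨C * (2 / ((j + 1) * β) + 2 / β), by positivity, fun v A hA hv hvA k => ?_⟩
    rw [powCoeff_succ]
    calc _ ≤ ∑ q ∈ Finset.HasAntidiagonal.antidiagonal k,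
          (C * A ^ (j + 1) * regWeight (fun _ => 1) ((j + 1) * β) q.1) *
            (A * regWeight (fun _ => 1) β q.2) := by
          refine Finset.sum_le_sum fun q _ => ?_
          exact mul_le_mul (h v A hA hv hvA _) (hvA _) (hv _)
            (mul_nonneg (by positivity) (hnn _ _))
      _ = C * A ^ (j + 1 + 1) * ∑ q ∈ Finset.HasAntidiagonal.antidiagonal k,
          regWeight (fun _ => 1) ((j + 1) * β) q.1 * regWeight (fun _ => 1) β q.2 := by
          rw [Finset.mul_sum]
          refine Finset.sum_congr rfl fun q _ => ?_
          ring
      _ ≤ C * A ^ (j + 1 + 1) * ((2 / ((j + 1) * β) + 2 / β) *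
          regWeight (fun _ => 1) ((j + 1) * β + β) k) := by
          gcongr
          exact sum_antidiagonal_rpow_le hj0 hβ (by linarith) k
      _ = _ := by
          push_cast
          rw [show ((j : ℝ) + 1) * β + β = (j + 1 + 1) * β by ring]
          ring

end Convolution

/-! ### Bounds for characteristic functions of tilted laws. -/

section CharacteristicFunction

variable {w : ℕ → ℝ}

/-- A distribution with a uniform component on `[1/s, 2/s]` has a characteristic function that is
quadratically bounded away from `1`. -/
theorem norm_lapC_le_of_block (hw : ∀ k, 0 ≤ w k) {s : ℝ} (hs0 : 0 < s) (hs1 : s ≤ 1 / 4)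
    (hs : Summable fun k : ℕ => w k * Real.exp (-(s * k))) {κ : ℝ} (hκ : 0 ≤ κ)
    (hblock : ∀ k : ℕ, 1 / s ≤ k → (k : ℝ) ≤ 2 / s → κ * s * lap w s ≤ w k * Real.exp (-(s * k)))
    {θ : ℝ} (hθ : |θ| ≤ Real.pi) :
    ‖lapC w (s + θ * Complex.I)‖ ≤ lap w s * (1 - κ / 640 * min 1 ((θ / s) ^ 2)) := by
  set J := ⌊1 / (2 * s)⌋₊
  set a := ⌈1 / s⌉₊
  set B := Finset.Ico a (a + 2 * J)
  set m := κ * s * lap w s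
  have hD : 0 ≤ lap w s := tsum_nonneg fun k => mul_nonneg (hw k) (Real.exp_pos _).le
  have hm : 0 ≤ m := by positivity
  have hJ1 : (J : ℝ) ≤ 1 / (2 * s) := Nat.floor_le (by positivity)
  have hJ2 : 1 / 4 ≤ s * J := by
    have h1 := Nat.lt_floor_add_one (1 / (2 * s))
    rw [div_lt_iff₀ (by positivity)] at h1
    nlinarith
  have ha1 : 1 / s ≤ a := Nat.le_ceil _
  have ha2 : (a : ℝ) < 1 / s + 1 := Nat.ceil_lt_add_one (by positivity)
  have hB : ∀ k ∈ B, m ≤ w k * Real.exp (-(s * k)) := by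
    intro k hk
    obtain ⟨h1, h2⟩ := Finset.mem_Ico.1 hk
    have h1' : (a : ℝ) ≤ k := by exact_mod_cast h1
    have h2' : (k : ℝ) + 1 ≤ a + 2 * J := by exact_mod_cast h2
    refine hblock k (ha1.trans h1') ?_
    have h3 : 2 * (1 / (2 * s)) = 1 / s := by field_simp
    have h4 : 2 / s = 1 / s + 1 / s := by ring
    linarith
  -- A uniform mass `m` is removed from each point of the block `B`; the remainder `u` is
  -- nonnegative and is bounded trivially, so all the saving comes from the exponential sum over
  -- `B`.
  set u : ℕ → ℝ := fun k => w k * Real.exp (-(s * k)) - if k ∈ B then m else 0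
  have hu0 : ∀ k, 0 ≤ u k := by
    intro k
    simp only [u]
    split_ifs with hk
    · linarith [hB k hk]
    · rw [sub_zero]; exact mul_nonneg (hw k) (Real.exp_pos _).le
  have hcard : (B.card : ℝ) = 2 * J := by simp [B]
  have hfin : HasSum (fun k : ℕ => if k ∈ B then m else 0) (2 * J * m) := by
    have h1 := hasSum_sum_of_ne_finset_zero (f := fun k : ℕ => if k ∈ B then m else 0) (s := B)
      (L := .unconditional ℕ) (fun k hk => if_neg hk)
    rwa [Finset.sum_congr rfl (fun k hk => if_pos hk), Finset.sum_const, nsmul_eq_mul, hcard] at h1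
  have husum : HasSum u (lap w s - 2 * J * m) := hs.hasSum.sub hfin
  set e : ℕ → ℂ := fun k => Complex.exp (Complex.I * ((-θ : ℝ) : ℂ)) ^ k
  have he : ∀ k : ℕ, Complex.exp (-((s + θ * Complex.I) * k)) = Real.exp (-(s * k)) * e k := by
    intro k
    simp only [e]
    rw [← Complex.exp_nat_mul]
    push_cast
    rw [← Complex.exp_add]
    ring_nf
  have hen : ∀ k, ‖e k‖ = 1 := by
    intro k
    simp only [e]
    rw [norm_pow, mul_comm, Complex.norm_exp_ofReal_mul_I, one_pow]
  have hfinC : HasSum (fun k : ℕ => if k ∈ B then (m : ℂ) * e k else 0) (m * ∑ k ∈ B, e k) := by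
    have h1 := hasSum_sum_of_ne_finset_zero (f := fun k : ℕ => if k ∈ B then (m : ℂ) * e k else 0)
      (s := B) (L := .unconditional ℕ) (fun k hk => if_neg hk)
    rwa [Finset.sum_congr rfl (fun k hk => if_pos hk), ← Finset.mul_sum] at h1
  have hlap : HasSum (fun k : ℕ => (w k : ℂ) * Complex.exp (-((s + θ * Complex.I) * k)))
      (lapC w (s + θ * Complex.I)) :=
    (summable_norm_lapC hw (by simpa using hs)).of_norm.hasSum
  have hdiff := hlap.sub hfinC
  have hue : ∀ k : ℕ, (w k : ℂ) * Complex.exp (-((s + θ * Complex.I) * k)) -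
      (if k ∈ B then (m : ℂ) * e k else 0) = u k * e k := by
    intro k
    simp only [u, he]
    split_ifs <;> push_cast <;> ring
  simp_rw [hue] at hdiff
  have h1 : ‖lapC w (s + θ * Complex.I) - m * ∑ k ∈ B, e k‖ ≤ lap w s - 2 * J * m := by
    have hn : ∀ k, ‖(u k : ℂ) * e k‖ = u k := fun k => by
      rw [norm_mul, hen, mul_one, Complex.norm_real, Real.norm_of_nonneg (hu0 k)]
    rw [← hdiff.tsum_eq, ← husum.tsum_eq]
    refine (norm_tsum_le_tsum_norm (husum.summable.congr fun k => (hn k).symm)).trans (le_of_eq ?_)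
    exact tsum_congr hn
  have h2 : ‖∑ k ∈ B, e k‖ ≤ 2 * J * (1 - 1 / 20 * min 1 ((J * θ) ^ 2)) := by
    have h3 := norm_sum_exp_block_le (θ := -θ) (by rwa [abs_neg]) J
    rw [show ((J : ℝ) * -θ) ^ 2 = (J * θ) ^ 2 by ring] at h3
    refine le_trans (le_of_eq ?_) h3
    rw [Finset.sum_Ico_eq_sum_range, Nat.add_sub_cancel_left]
    simp only [e]
    simp_rw [pow_add, ← Finset.mul_sum, norm_mul]
    rw [show ‖Complex.exp (Complex.I * ((-θ : ℝ) : ℂ)) ^ a‖ = 1 from hen a, one_mul]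
  have h3 : 1 / 16 * min 1 ((θ / s) ^ 2) ≤ min 1 ((J * θ) ^ 2) := by
    refine le_min ?_ ?_
    · linarith [min_le_left 1 ((θ / s) ^ 2)]
    · have h4 : (θ / s) ^ 2 * (1 / 16) ≤ (J * θ) ^ 2 := by
        have h5 : (J * θ) ^ 2 = (θ / s) ^ 2 * (s * J) ^ 2 := by field_simp
        rw [h5]
        gcongr
        nlinarith
      linarith [min_le_right 1 ((θ / s) ^ 2)]
  have h4 : 0 ≤ min 1 ((θ / s) ^ 2) := le_min zero_le_one (sq_nonneg _)
  calc ‖lapC w (s + θ * Complex.I)‖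
      ≤ ‖lapC w (s + θ * Complex.I) - m * ∑ k ∈ B, e k‖ + ‖(m : ℂ) * ∑ k ∈ B, e k‖ := by
        simpa using norm_add_le (lapC w (s + θ * Complex.I) - m * ∑ k ∈ B, e k) (m * ∑ k ∈ B, e k)
    _ ≤ (lap w s - 2 * J * m) + m * (2 * J * (1 - 1 / 20 * min 1 ((J * θ) ^ 2))) := by
        rw [norm_mul, Complex.norm_real, Real.norm_of_nonneg hm]
        gcongr
    _ = lap w s - κ * lap w s * (s * J) * (1 / 10 * min 1 ((J * θ) ^ 2)) := by
        simp only [m]; ring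
    -- The factor `1 / 4` bounds `s J` from below, using `s ≤ 1 / 4`; squaring the same bound gives
    -- `1 / 16`. Hence `640 = 4 · 10 · 16`.
    _ ≤ lap w s - κ * lap w s * (1 / 4) * (1 / 10 * (1 / 16 * min 1 ((θ / s) ^ 2))) := by
        gcongr
    _ = _ := by ring

/-- A uniform bound for the tilted coefficients of a power bounds the moments of the
characteristic function. -/
theorem integral_norm_lapC_pow_le (hw : ∀ k, 0 ≤ w k) {s : ℝ}
    (hs : Summable fun k : ℕ => w k * Real.exp (-(s * k))) {q : ℕ} {A : ℝ}
    (hA : ∀ k : ℕ, powCoeff w q k * Real.exp (-(s * k)) ≤ A) :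
    ∫ θ in (-Real.pi)..Real.pi, ‖lapC w (s + θ * Complex.I)‖ ^ (2 * q) ≤
      2 * Real.pi * A * lap w s ^ q := by
  set b : ℕ → ℝ := fun k => powCoeff w q k * Real.exp (-(s * k))
  have hb := lap_powCoeff hw hs q
  have hb0 : ∀ k, 0 ≤ b k := fun k => mul_nonneg (powCoeff_nonneg hw _ _) (Real.exp_pos _).le
  have hbn : Summable fun k => ‖(b k : ℂ)‖ := by
    refine hb.summable.congr fun k => ?_
    rw [Complex.norm_real, Real.norm_of_nonneg (hb0 k)]
  have h1 : ∀ θ : ℝ, ‖lapC w (s + θ * Complex.I)‖ ^ (2 * q) =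
      ‖∑' k : ℕ, (b k : ℂ) * Complex.exp (-(θ * Complex.I * k))‖ ^ 2 := by
    intro θ
    rw [mul_comm 2 q, pow_mul, ← norm_pow, ← (hasSum_lapC_pow hw (by simpa using hs) q).2]
    congr 2
    refine tsum_congr fun k => ?_
    simp only [b]
    push_cast
    rw [mul_assoc, ← Complex.exp_add]
    ring_nf
  simp_rw [h1]
  rw [integral_norm_sq_tsum_exp hbn, mul_assoc (2 * Real.pi)]
  refine mul_le_mul_of_nonneg_left ?_ (by positivity)
  rw [← hb.tsum_eq, ← tsum_mul_left]
  -- The sum of squares is at most the largest term `A` times the total mass.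
  have h2 : ∀ k, b k ^ 2 ≤ A * b k := fun k => by
    rw [sq]; exact mul_le_mul_of_nonneg_right (hA k) (hb0 k)
  refine Summable.tsum_le_tsum h2 ?_ (hb.summable.mul_left A)
  exact Summable.of_nonneg_of_le (fun k => sq_nonneg _) h2 (hb.summable.mul_left A)

end CharacteristicFunction

/-! ### Regularly varying weights are tame. -/

theorem exists_rpow_mul_exp_neg_le {γ : ℝ} (hγ : 0 ≤ γ) :
    ∃ C, 0 ≤ C ∧ ∀ y, 0 < y → y ^ γ * Real.exp (-y) ≤ C := by
  obtain ⟨n, hn⟩ := exists_nat_ge γ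
  refine ⟨1 + n.factorial, by positivity, fun y hy => ?_⟩
  rw [Real.exp_neg, mul_inv_le_iff₀ (Real.exp_pos y)]
  have h1 : (1 : ℝ) ≤ Real.exp y := Real.one_le_exp hy.le
  rcases le_total y 1 with h | h
  · have := Real.rpow_le_one hy.le h hγ
    nlinarith [(n.factorial).cast_nonneg (α := ℝ)]
  · have h2 : y ^ γ ≤ y ^ n := by
      rw [← Real.rpow_natCast]; exact Real.rpow_le_rpow_of_exponent_le h hn
    have h3 := Real.pow_div_factorial_le_exp y hy.le n
    rw [div_le_iff₀ (by positivity)] at h3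
    nlinarith

section Regular

variable {h : ℝ → ℝ}

/-- A two-sided form of Karamata's theorem, used to exchange `h (1 / s)` for the Laplace series in
the pointwise bounds below. -/
theorem SlowlyVarying.eventually_regLaplace_bounds (hsv : SlowlyVarying h)
    (hpos : ∀ᶠ x in atTop, 0 < h x) (hcont : ContinuousOn h (Set.Ici 1))
    (hnn : ∀ x, 1 ≤ x → 0 ≤ h x) {α : ℝ} (hα : 0 < α) :
    ∃ K, 0 < K ∧ ∀ᶠ s : ℝ in 𝓝[>] 0, h (1 / s) ≤ K * (regLaplace h α s * s ^ α) ∧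
      regLaplace h α s * s ^ α ≤ K * h (1 / s) := by
  have hG := Real.Gamma_pos_of_pos hα
  have h1 := hsv.tendsto_regLaplace hpos hcont hnn hα
  have hinv : Tendsto (fun s : ℝ => 1 / s) (𝓝[>] 0) atTop := by
    simpa using tendsto_inv_nhdsGT_zero (𝕜 := ℝ)
  set G := Real.Gamma α
  refine ⟨max (2 / G) (2 * G), by positivity, ?_⟩
  filter_upwards [h1.eventually (lt_mem_nhds (half_lt_self hG)),
    h1.eventually (gt_mem_nhds (lt_two_mul_self hG)), hinv.eventually hpos] with s h2 h3 h4
  rw [lt_div_iff₀ h4] at h2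
  rw [div_lt_iff₀ h4] at h3
  have h5 : 0 < regLaplace h α s * s ^ α := lt_trans (by positivity) h2
  refine ⟨?_, h3.le.trans (by gcongr; exact le_max_right _ _)⟩
  calc h (1 / s) = 2 / G * (G / 2 * h (1 / s)) := by field_simp
    _ ≤ 2 / G * (regLaplace h α s * s ^ α) := by gcongr
    _ ≤ _ := by gcongr; exact le_max_left _ _

/-- The tilted weights are at least of order `s` on `[1/s, 2/s]`. -/
theorem SlowlyVarying.exists_block (hsv : SlowlyVarying h)
    (hpos : ∀ᶠ x in atTop, 0 < h x) (hcont : ContinuousOn h (Set.Ici 1))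
    (hnn : ∀ x, 1 ≤ x → 0 ≤ h x) {α : ℝ} (hα : 0 < α) :
    ∃ κ, 0 < κ ∧ ∀ᶠ s : ℝ in 𝓝[>] 0, ∀ k : ℕ, 1 / s ≤ k → (k : ℝ) ≤ 2 / s →
      κ * s * regLaplace h α s ≤ regWeight h α k * Real.exp (-(s * k)) := by
  obtain ⟨K, X, hK, hX, hP⟩ := hsv.potter hpos hcont one_pos
  obtain ⟨K₂, hK₂, hev⟩ := hsv.eventually_regLaplace_bounds hpos hcont hnn hα
  have hinv : Tendsto (fun s : ℝ => 1 / s) (𝓝[>] 0) atTop := by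
    simpa using tendsto_inv_nhdsGT_zero (𝕜 := ℝ)
  refine ⟨Real.exp (-2) / (6 * K * K₂), by positivity, ?_⟩
  filter_upwards [hev, self_mem_nhdsWithin, hinv.eventually_ge_atTop X] with s hs hs0 hsX k hk1 hk2
  have hs0 : (0 : ℝ) < s := hs0
  have hk0 : (0 : ℝ) < k := lt_of_lt_of_le (by positivity) hk1
  obtain ⟨hhk, hP⟩ := hP k (hsX.trans hk1)
  have h1 := hP (1 / s) (hX.trans hsX)
  have hy1 : 1 ≤ s * k := by rwa [div_le_iff₀ hs0, mul_comm] at hk1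
  have hy2 : s * k ≤ 2 := by rwa [le_div_iff₀ hs0, mul_comm] at hk2
  rw [Real.rpow_one, Real.rpow_one] at h1
  have h2 : 1 / s / k + k / (1 / s) ≤ 3 := by
    have e1 : 1 / s / k ≤ 1 := by rw [div_le_one hk0]; exact hk1
    have e2 : k / (1 / s) = s * k := by field_simp
    linarith
  have h3 : h (1 / s) ≤ K * h k * 3 := h1.trans (by gcongr)
  have h4 : 1 / 2 ≤ (s * k) ^ (α - 1) := by
    rw [Real.rpow_sub_one (by positivity)]
    calc (1 : ℝ) / 2 ≤ 1 / (s * k) := by gcongr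
      _ ≤ _ := by gcongr; exact Real.one_le_rpow hy1 hα.le
  have h5 : Real.exp (-2) ≤ Real.exp (-(s * k)) := Real.exp_le_exp.2 (by linarith)
  have hk : k ≠ 0 := by rintro rfl; simp at hk0
  have h6 : regLaplace h α s ≤ K₂ * (K * h k * 3) / s ^ α := by
    rw [le_div_iff₀ (by positivity)]
    exact hs.2.trans (by gcongr)
  have h7 : (s * k) ^ (α - 1) = s ^ α / s * (k : ℝ) ^ (α - 1) := by
    rw [Real.mul_rpow hs0.le hk0.le, Real.rpow_sub_one hs0.ne']
  have h8 : 1 / 2 * (s / s ^ α) ≤ (k : ℝ) ^ (α - 1) := by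
    have e1 : (k : ℝ) ^ (α - 1) = (s * k) ^ (α - 1) * (s / s ^ α) := by
      rw [h7]; field_simp
    rw [e1]; gcongr
  rw [regWeight, if_neg hk]
  calc Real.exp (-2) / (6 * K * K₂) * s * regLaplace h α s
      ≤ Real.exp (-2) / (6 * K * K₂) * s * (K₂ * (K * h k * 3) / s ^ α) := by gcongr
    _ = h k * (1 / 2 * (s / s ^ α)) * Real.exp (-2) := by field_simp; norm_num
    _ ≤ _ := by gcongr

/-- An upper bound for the tilted weights by a power function. -/
theorem SlowlyVarying.exists_upper (hsv : SlowlyVarying h)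
    (hpos : ∀ᶠ x in atTop, 0 < h x) (hcont : ContinuousOn h (Set.Ici 1))
    (hnn : ∀ x, 1 ≤ x → 0 ≤ h x) {α β : ℝ} (hα : 0 < α) (hβ : β ≤ α / 2) :
    ∃ K, 0 ≤ K ∧ ∀ᶠ s : ℝ in 𝓝[>] 0, ∀ k : ℕ, regWeight h α k * Real.exp (-(s * k)) ≤
      K * s ^ β * regLaplace h α s * regWeight (fun _ => 1) β k := by
  obtain ⟨K, X, hK, hX, hP⟩ := hsv.potter hpos hcont (half_pos hα)
  obtain ⟨K₂, hK₂, hev⟩ := hsv.eventually_regLaplace_bounds hpos hcont hnn hα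
  have hinv : Tendsto (fun s : ℝ => 1 / s) (𝓝[>] 0) atTop := by
    simpa using tendsto_inv_nhdsGT_zero (𝕜 := ℝ)
  -- With `y = s k`, Potter's bound leaves the powers `y^{α - β ± α/2}` times `e^{-y}`; the
  -- condition `β ≤ α / 2` makes both exponents nonnegative, so both products are bounded.
  obtain ⟨C₁, hC₁, hb₁⟩ := exists_rpow_mul_exp_neg_le (γ := α - β + α / 2) (by linarith)
  obtain ⟨C₂, hC₂, hb₂⟩ := exists_rpow_mul_exp_neg_le (γ := α - β - α / 2) (by linarith)
  refine ⟨K * K₂ * (C₁ + C₂), by positivity, ?_⟩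
  filter_upwards [hev, self_mem_nhdsWithin, hinv.eventually_ge_atTop X] with s hs hs0 hsX k
  have hs0 : (0 : ℝ) < s := hs0
  by_cases hk : k = 0
  · simp [regWeight, hk]
  have hk1 : (1 : ℝ) ≤ k := by exact_mod_cast Nat.one_le_iff_ne_zero.2 hk
  have hk0 : (0 : ℝ) < k := by linarith
  obtain ⟨hh, hP⟩ := hP (1 / s) hsX
  have h1 := hP k hk1
  set y := s * (k : ℝ) with hy
  have hy0 : 0 < y := by positivity
  rw [show (k : ℝ) / (1 / s) = y by rw [hy]; field_simp,
    show 1 / s / (k : ℝ) = y⁻¹ by rw [hy]; field_simp, Real.inv_rpow hy0.le] at h1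
  have h2 : (k : ℝ) ^ (α - 1) = (k : ℝ) ^ (β - 1) * (y ^ (α - β) * (s ^ β / s ^ α)) := by
    rw [hy, Real.mul_rpow hs0.le hk0.le, Real.rpow_sub_one hk0.ne' α, Real.rpow_sub_one hk0.ne' β,
      Real.rpow_sub hs0, Real.rpow_sub hk0]
    field_simp
  have h3 : y ^ (α - β) * (y ^ (α / 2) + (y ^ (α / 2))⁻¹) * Real.exp (-y) ≤ C₁ + C₂ := by
    have e1 := hb₁ y hy0
    have e2 := hb₂ y hy0
    rw [Real.rpow_add hy0] at e1
    rw [Real.rpow_sub hy0] at e2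
    calc _ = y ^ (α - β) * y ^ (α / 2) * Real.exp (-y) +
          y ^ (α - β) / y ^ (α / 2) * Real.exp (-y) := by ring
      _ ≤ _ := add_le_add e1 e2
  have h4 := hs.1
  have h5 : h (1 / s) / s ^ α ≤ K₂ * regLaplace h α s := by
    rw [div_le_iff₀ (by positivity)]; linarith
  rw [regWeight, regWeight, if_neg hk, if_neg hk, one_mul]
  calc h k * (k : ℝ) ^ (α - 1) * Real.exp (-y)
      ≤ K * h (1 / s) * (y ^ (α / 2) + (y ^ (α / 2))⁻¹) * (k : ℝ) ^ (α - 1) * Real.exp (-y) := by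
        gcongr
    _ = K * (k : ℝ) ^ (β - 1) * s ^ β * (h (1 / s) / s ^ α) *
        (y ^ (α - β) * (y ^ (α / 2) + (y ^ (α / 2))⁻¹) * Real.exp (-y)) := by
        rw [h2]; ring
    _ ≤ K * (k : ℝ) ^ (β - 1) * s ^ β * (K₂ * regLaplace h α s) * (C₁ + C₂) := by
        have : 0 ≤ h (1 / s) / s ^ α := by positivity
        have : 0 ≤ K₂ * regLaplace h α s := this.trans h5
        gcongr
    _ = _ := by ring

/-- Regularly varying weights are tame. -/
theorem SlowlyVarying.tameWeight (hsv : SlowlyVarying h)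
    (hpos : ∀ᶠ x in atTop, 0 < h x) (hcont : ContinuousOn h (Set.Ici 1))
    (hnn : ∀ x, 1 ≤ x → 0 ≤ h x) {α : ℝ} (hα : 0 < α) : TameWeight (regWeight h α) α := by
  have hw := regWeight_nonneg hnn α
  have hsum : ∀ s, 0 < s → ∀ j : ℕ,
      Summable fun k : ℕ => regWeight h α k * (k : ℝ) ^ j * Real.exp (-(s * k)) := by
    intro s hs j
    simp_rw [regWeight_mul_pow]
    exact hsv.summable_regWeight hpos hcont hnn _ hs
  have hsum0 : ∀ s, 0 < s → Summable fun k : ℕ => regWeight h α k * Real.exp (-(s * k)) :=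
    fun s hs => by simpa using hsum s hs 0
  have hinv : Tendsto (fun s : ℝ => 1 / s) (𝓝[>] 0) atTop := by
    simpa using tendsto_inv_nhdsGT_zero (𝕜 := ℝ)
  have hG := (Real.Gamma_pos_of_pos hα).ne'
  have hT0 := hsv.tendsto_regLaplace hpos hcont hnn hα
  have hlappos : ∀ s, 0 < s → 0 < lap (regWeight h α) s := by
    intro s hs
    obtain ⟨X, hX⟩ := eventually_atTop.1 hpos
    obtain ⟨k, hk⟩ := exists_nat_ge (max X 1)
    have hk1 : (1 : ℝ) ≤ k := (le_max_right _ _).trans hk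
    have hk0 : k ≠ 0 := by rintro rfl; norm_num at hk1
    refine (hsum0 s hs).tsum_pos (fun j => mul_nonneg (hw j) (Real.exp_pos _).le) k ?_
    rw [regWeight, if_neg hk0]
    have := hX k ((le_max_left _ _).trans hk)
    positivity
  have hhalf : Tendsto (fun s : ℝ => s / 2) (𝓝[>] 0) (𝓝[>] 0) := by
    refine tendsto_nhdsWithin_iff.2 ⟨?_, ?_⟩
    · have : Tendsto (fun s : ℝ => s / 2) (𝓝 0) (𝓝 (0 / 2)) := tendsto_id.div_const 2
      rw [zero_div] at this
      exact this.mono_left nhdsWithin_le_nhds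
    · filter_upwards [self_mem_nhdsWithin] with s hs
      exact half_pos (Set.mem_Ioi.1 hs)
  refine ⟨hα, hw, hsum, hlappos, ?_, ?_, ?_, ?_⟩
  · have hT1 := hsv.tendsto_regLaplace hpos hcont hnn (β := α + 1) (by positivity)
    have hT2 := hsv.tendsto_regLaplace hpos hcont hnn (β := α + 2) (by positivity)
    -- The first two moments scale as those of the Gamma law of shape `α`: the limit is `(α + 1) α -
    -- α² = α`.
    have hlim := (hT2.div hT0 hG).sub ((hT1.div hT0 hG).pow 2)
    rw [show α + 2 = α + 1 + 1 by ring, Real.Gamma_add_one (s := α + 1) (by positivity),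
      Real.Gamma_add_one hα.ne', mul_div_assoc, mul_div_cancel_right₀ _ hG,
      show (α + 1) * α - α ^ 2 = α by ring] at hlim
    refine hlim.congr' ?_
    filter_upwards [self_mem_nhdsWithin, hinv.eventually hpos] with s hs hh
    have hs0 : (0 : ℝ) < s := hs
    have hD : regLaplace h α s ≠ 0 := (hlappos s hs0).ne'
    have e2 : lap (fun k => regWeight h α k * (k : ℝ) ^ 2) s = regLaplace h (α + 2) s := by
      have := regWeight_mul_pow h α
      simp only [lap, regLaplace, this]
      norm_num
    have e1 : lap (fun k => regWeight h α k * k) s = regLaplace h (α + 1) s := by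
      have := fun k => regWeight_mul_pow h α k 1
      simp only [pow_one] at this
      simp only [lap, regLaplace, this]
      norm_num
    rw [tiltVar, tiltMean, e1, e2, show lap (regWeight h α) s = regLaplace h α s from rfl,
      show α + 1 + 1 = α + 2 by ring]
    simp only [Pi.div_apply]
    rw [Real.rpow_add hs0, Real.rpow_add hs0, Real.rpow_one, Real.rpow_two]
    have : s ^ α ≠ 0 := by positivity
    field_simp
  · have h1 := hT0.comp hhalf
    have h2 := (hsv 2 two_pos).comp hinv
    have h3 := (h1.div hT0 hG).mul h2
    rw [div_self hG, one_mul] at h3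
    -- The ratio `lap w (s / 2) / lap w s` tends to `2^α`; the extra factor `2` makes the bound
    -- eventually true.
    refine ⟨2 * 2 ^ α, ?_⟩
    filter_upwards [h3.eventually (gt_mem_nhds (one_lt_two)), self_mem_nhdsWithin,
      hinv.eventually hpos, (hinv.comp hhalf).eventually hpos] with s hs hs0 hh hh2
    have hs0 : (0 : ℝ) < s := hs0
    have hD := hlappos s hs0
    simp only [Function.comp, Pi.div_apply] at hs hh2
    have e : 2 * (1 / s) = 1 / (s / 2) := by field_simp
    rw [e, Real.div_rpow hs0.le two_pos.le] at hs
    have hsα : 0 < s ^ α := by positivity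
    have h2α : (0 : ℝ) < 2 ^ α := by positivity
    change regLaplace h α (s / 2) ≤ _
    change 0 < regLaplace h α s at hD
    change _ ≤ 2 * 2 ^ α * regLaplace h α s
    have e2 : regLaplace h α (s / 2) * (s ^ α / 2 ^ α) / h (1 / (s / 2)) /
        (regLaplace h α s * s ^ α / h (1 / s)) * (h (1 / (s / 2)) / h (1 / s)) =
        regLaplace h α (s / 2) / (2 ^ α * regLaplace h α s) := by
      have := hD.ne'
      have := hh.ne'
      have := hh2.ne'
      generalize h (1 / (s / 2)) = A at *
      generalize h (1 / s) = B at *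
      generalize regLaplace h α (s / 2) = U at *
      generalize regLaplace h α s = V at *
      field_simp
    rw [e2, div_lt_iff₀ (by positivity)] at hs
    linarith
  · obtain ⟨κ, hκ, hev⟩ := hsv.exists_block hpos hcont hnn hα
    refine ⟨min κ 1 / 640, by positivity, by linarith [min_le_right κ 1], ?_⟩
    filter_upwards [hev, self_mem_nhdsWithin, Ioo_mem_nhdsGT (show (0 : ℝ) < 1 / 4 by norm_num)]
      with s hs hs0 hs1 θ hθ
    have hs0 : (0 : ℝ) < s := hs0
    refine norm_lapC_le_of_block hw hs0 hs1.2.le (hsum0 s hs0) (by positivity) ?_ hθ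
    intro k hk1 hk2
    refine le_trans ?_ (hs k hk1 hk2)
    have := hlappos s hs0
    exact mul_le_mul (mul_le_mul_of_nonneg_right (min_le_left _ _) hs0.le) le_rfl this.le
      (by positivity)
  -- Take `q = n + 1` and `β = 1 / q`. Then `β ≤ α / 2` allows the upper bound by a power, and `q β
  -- = 1` turns the `q` factors `s^β` into a single `s` while making the `q`-fold convolution flat
  -- in `k`.
  · obtain ⟨n, hn⟩ := exists_nat_ge (2 / α)
    have hq : (0 : ℝ) < (n : ℝ) + 1 := by positivity
    set β : ℝ := 1 / ((n : ℝ) + 1)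
    have hβ0 : 0 < β := by positivity
    have hβ1 : ((n : ℝ) + 1) * β = 1 := by simp only [β]; field_simp
    have hβα : β ≤ α / 2 := by
      simp only [β]
      rw [div_le_iff₀ hq]
      rw [div_le_iff₀ hα] at hn
      nlinarith
    obtain ⟨K, hK, hev⟩ := hsv.exists_upper hpos hcont hnn hα hβα
    obtain ⟨C, hC, hpow⟩ := powCoeff_le_rpow hβ0 n hβ1.le
    refine ⟨n + 1, 2 * Real.pi * (C * K ^ (n + 1)), ?_⟩
    filter_upwards [hev, self_mem_nhdsWithin] with s hs hs0
    have hs0 : (0 : ℝ) < s := hs0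
    have hD := hlappos s hs0
    have hA : ∀ k : ℕ, powCoeff (regWeight h α) (n + 1) k * Real.exp (-(s * k)) ≤
        C * K ^ (n + 1) * s * lap (regWeight h α) s ^ (n + 1) := by
      intro k
      have e1 : ∀ j : ℕ, Real.exp (-(s * j)) = Real.exp (-s) ^ j := fun j => by
        rw [← Real.exp_nat_mul]; ring_nf
      have h1 := hpow (fun j => regWeight h α j * Real.exp (-s) ^ j)
        (K * s ^ β * regLaplace h α s)
        (mul_nonneg (by positivity) hD.le)
        (fun j => mul_nonneg (hw j) (by positivity)) (fun j => by rw [← e1]; exact hs j) k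
      rw [powCoeff_mul_pow, ← e1, hβ1, mul_pow, mul_pow, ← Real.rpow_natCast (s ^ β),
        ← Real.rpow_mul hs0.le] at h1
      push_cast at h1
      rw [mul_comm β, hβ1, Real.rpow_one] at h1
      refine h1.trans ?_
      have h2 : regWeight (fun _ => 1) 1 k ≤ 1 := by
        unfold regWeight
        split_ifs <;> simp
      have h3 : 0 ≤ C * (K ^ (n + 1) * s * regLaplace h α s ^ (n + 1)) :=
        mul_nonneg hC (mul_nonneg (by positivity) (pow_nonneg hD.le _))
      calc _ ≤ C * (K ^ (n + 1) * s * regLaplace h α s ^ (n + 1)) * 1 :=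
            mul_le_mul_of_nonneg_left h2 h3
        _ = C * K ^ (n + 1) * s * lap (regWeight h α) s ^ (n + 1) := by
            rw [show lap (regWeight h α) s = regLaplace h α s from rfl]; ring
    refine (integral_norm_lapC_pow_le hw (hsum0 s hs0) hA).trans (le_of_eq ?_)
    ring

end Regular

/-! ### Second-order expansion of the moment generating function. -/

/-- The centred moment generating function of the distribution proportional to `w_k e^(-sk)`. -/
def tiltMgf (w : ℕ → ℝ) (s : ℝ) (z : ℂ) : ℂ :=
  lapC w (s - z) * Complex.exp (-(z * tiltMean w s)) / lap w s

/-- The standard deviation of a sum of `p` copies of the tilted distribution. -/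
def tiltScale (w : ℕ → ℝ) (s : ℝ) (p : ℕ) : ℝ := √(tiltVar w s) * √p

theorem hasSum_of_eq {ι E : Type*} [AddCommMonoid E] [TopologicalSpace E] {f g : ι → E} {a b : E}
    (h : HasSum f a) (hfg : ∀ k, g k = f k) (hab : b = a) : HasSum g b := by
  rwa [funext hfg, hab]

theorem norm_exp_sub_quadratic_le (x : ℂ) :
    ‖Complex.exp x - (1 + x + x ^ 2 / 2)‖ ≤ ‖x‖ ^ 3 * Real.exp ‖x‖ := by
  have h := Complex.norm_exp_sub_sum_le_norm_mul_exp x 3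
  simpa [Finset.sum_range_succ, Nat.factorial] using h

/-- The cubic is absorbed by `e^{y/8}` through `x³ / 3! ≤ e^x` at `x = y / 8`, which gives `3072 = 6
· 8³`. -/
theorem pow_three_mul_exp_le {y : ℝ} (hy : 0 ≤ y) :
    y ^ 3 * Real.exp (y / 8) ≤ 3072 * Real.exp (y / 4) := by
  have h := Real.pow_div_factorial_le_exp (y / 8) (by positivity) 3
  have h2 : y ^ 3 ≤ 3072 * Real.exp (y / 8) := by
    norm_num [Nat.factorial] at h
    linarith
  calc y ^ 3 * Real.exp (y / 8) ≤ 3072 * Real.exp (y / 8) * Real.exp (y / 8) := by gcongr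
    _ = 3072 * Real.exp (y / 4) := by rw [mul_assoc, ← Real.exp_add]; ring_nf

namespace TameWeight

variable {w : ℕ → ℝ} {α : ℝ}

theorem summable_zero (hw : TameWeight w α) {s : ℝ} (hs : 0 < s) :
    Summable fun k : ℕ => w k * Real.exp (-(s * k)) := by simpa using hw.summable s hs 0

theorem hasSum_prob (hw : TameWeight w α) {s : ℝ} (hs : 0 < s) :
    HasSum (fun k : ℕ => w k * Real.exp (-(s * k)) / lap w s) 1 := by
  have h := (hw.summable_zero hs).hasSum.div_const (lap w s)
  have h2 : ∑' k : ℕ, w k * Real.exp (-(s * k)) = lap w s := rfl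
  rwa [h2, div_self (hw.lap_pos s hs).ne'] at h

theorem hasSum_mean (hw : TameWeight w α) {s : ℝ} (hs : 0 < s) :
    HasSum (fun k : ℕ => w k * Real.exp (-(s * k)) / lap w s * k) (tiltMean w s) := by
  have h := (hw.summable s hs 1).hasSum.div_const (lap w s)
  simp only [pow_one] at h
  exact hasSum_of_eq h (fun k => by ring) rfl

theorem hasSum_sq (hw : TameWeight w α) {s : ℝ} (hs : 0 < s) :
    HasSum (fun k : ℕ => w k * Real.exp (-(s * k)) / lap w s * (k : ℝ) ^ 2)
      (tiltVar w s + tiltMean w s ^ 2) := by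
  have h := (hw.summable s hs 2).hasSum.div_const (lap w s)
  rw [tiltVar, sub_add_cancel]
  exact hasSum_of_eq h (fun k => by ring) rfl

theorem prob_nonneg (hw : TameWeight w α) {s : ℝ} (hs : 0 < s) (k : ℕ) :
    0 ≤ w k * Real.exp (-(s * k)) / lap w s :=
  div_nonneg (mul_nonneg (hw.nonneg k) (Real.exp_pos _).le) (hw.lap_pos s hs).le

/-- Exponential moments at the scale `1/s`. -/
theorem hasSum_exp_half (hw : TameWeight w α) {s : ℝ} (hs : 0 < s) :
    HasSum (fun k : ℕ => w k * Real.exp (-(s * k)) / lap w s * Real.exp (s * k / 2))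
      (lap w (s / 2) / lap w s) := by
  have h := (hw.summable_zero (half_pos hs)).hasSum.div_const (lap w s)
  refine hasSum_of_eq h (fun k => ?_) rfl
  rw [show -(s / 2 * (k : ℝ)) = -(s * k) + s * k / 2 by ring, Real.exp_add]
  ring

/-- From `x ≤ e^x` at `x = s k / 2`: doubling controls the mean at scale `1/s`, so centring does not
spoil the exponential moments. -/
theorem mul_tiltMean_le (hw : TameWeight w α) {s : ℝ} (hs : 0 < s) :
    s * tiltMean w s ≤ 2 * (lap w (s / 2) / lap w s) := by
  refine hasSum_le (fun k => ?_) ((hw.hasSum_mean hs).mul_left s) ((hw.hasSum_exp_half hs).mul_left 2)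
  have h1 := Real.add_one_le_exp (s * k / 2)
  have h2 := hw.prob_nonneg hs k
  nlinarith [mul_le_mul_of_nonneg_left h1 h2]

theorem tiltMean_nonneg (hw : TameWeight w α) {s : ℝ} (hs : 0 < s) : 0 ≤ tiltMean w s :=
  (hw.hasSum_mean hs).nonneg fun k => mul_nonneg (hw.prob_nonneg hs k) k.cast_nonneg

theorem hasSum_tiltMgf (hw : TameWeight w α) {s : ℝ} {z : ℂ} (hz : z.re < s) :
    HasSum (fun k : ℕ => ((w k * Real.exp (-(s * k)) / lap w s : ℝ) : ℂ) *
      Complex.exp (z * (k - tiltMean w s))) (tiltMgf w s z) := by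
  have h1 : HasSum (fun k : ℕ => (w k : ℂ) * Complex.exp (-((s - z) * k))) (lapC w (s - z)) := by
    refine (summable_norm_lapC hw.nonneg ?_).of_norm.hasSum
    exact hw.summable_zero (by simpa using hz)
  have h2 := (h1.mul_right (Complex.exp (-(z * tiltMean w s)))).div_const (lap w s : ℂ)
  refine hasSum_of_eq h2 (fun k => ?_) rfl
  push_cast
  rw [show z * ((k : ℂ) - tiltMean w s) = -((s - z) * k) + (s * k + -(z * tiltMean w s)) by ring,
    Complex.exp_add, Complex.exp_add, Complex.exp_neg ((s : ℂ) * k)]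
  have := Complex.exp_ne_zero ((s : ℂ) * k)
  field_simp

/-- The second order expansion of the centred moment generating function, uniformly at the
scale `s`. -/
theorem exists_tiltMgf_expansion (hw : TameWeight w α) :
    ∃ K, ∀ᶠ s : ℝ in 𝓝[>] 0, ∀ z : ℂ, ‖z‖ ≤ s / 8 →
      ‖tiltMgf w s z - 1 - z ^ 2 * tiltVar w s / 2‖ ≤ K * (‖z‖ / s) ^ 3 := by
  obtain ⟨K, hK⟩ := hw.doubling
  refine ⟨3072 * (Real.exp (K / 2) * K), ?_⟩
  filter_upwards [hK, self_mem_nhdsWithin] with s hs hs0 z hz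
  have hs0 : (0 : ℝ) < s := hs0
  have hD := hw.lap_pos s hs0
  have hratio : lap w (s / 2) / lap w s ≤ K := by rwa [div_le_iff₀ hD]
  have hμ := hw.mul_tiltMean_le hs0
  have hμ0 := hw.tiltMean_nonneg hs0
  have hp := hw.prob_nonneg hs0
  have hre : z.re < s := by
    linarith [Complex.re_le_norm z]
  have hF := hw.hasSum_tiltMgf hre
  have h0 := Complex.hasSum_ofReal.2 (hw.hasSum_prob hs0)
  have h1 := Complex.hasSum_ofReal.2 (hw.hasSum_mean hs0)
  have h2 := Complex.hasSum_ofReal.2 (hw.hasSum_sq hs0)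
  have hE := hw.hasSum_exp_half hs0
  set μ := tiltMean w s
  set V := tiltVar w s
  -- The Taylor polynomial of degree two is integrated against the tilted law `P`; since the linear
  -- term is centred, only `1 + z² V / 2` survives, and the cubic remainder has to be summed.
  set P : ℕ → ℝ := fun k => w k * Real.exp (-(s * k)) / lap w s
  have hsum : HasSum (fun k : ℕ => (P k : ℂ) * (Complex.exp (z * (k - μ)) -
      (1 + z * (k - μ) + (z * (k - μ)) ^ 2 / 2))) (tiltMgf w s z - 1 - z ^ 2 * V / 2) := by
    have h := ((hF.sub (h0.mul_right (1 - z * μ + z ^ 2 * μ ^ 2 / 2))).sub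
      (h1.mul_right (z - z ^ 2 * μ))).sub (h2.mul_right (z ^ 2 / 2))
    refine hasSum_of_eq h (fun k => ?_) ?_
    · simp only [P]
      push_cast
      ring
    · push_cast
      ring
  set x := ‖z‖ / s
  have hx : ‖z‖ = x * s := by simp only [x]; field_simp
  have hx0 : 0 ≤ x := by positivity
  have hx8 : x ≤ 1 / 8 := by
    simp only [x]; rw [div_le_iff₀ hs0]; linarith
  have hbound : ∀ k : ℕ, ‖(P k : ℂ) * (Complex.exp (z * (k - μ)) -
      (1 + z * (k - μ) + (z * (k - μ)) ^ 2 / 2))‖ ≤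
      3072 * x ^ 3 * Real.exp (K / 2) * (P k * Real.exp (s * k / 2)) := by
    intro k
    rw [norm_mul, Complex.norm_real, Real.norm_of_nonneg (hp k)]
    have e1 := norm_exp_sub_quadratic_le (z * (k - μ))
    have e2 : ‖z * ((k : ℂ) - μ)‖ = x * (s * |(k : ℝ) - μ|) := by
      rw [norm_mul, hx, ← Complex.ofReal_natCast, ← Complex.ofReal_sub, Complex.norm_real,
        Real.norm_eq_abs]
      ring
    set y := s * |(k : ℝ) - μ|
    have hy : 0 ≤ y := by positivity
    have hyle : y ≤ s * k + s * μ := by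
      have : |(k : ℝ) - μ| ≤ k + μ := by
        rw [abs_le]; constructor <;> linarith [k.cast_nonneg (α := ℝ)]
      calc y ≤ s * (k + μ) := by simp only [y]; gcongr
        _ = _ := by ring
    rw [e2] at e1
    -- Here `y ≤ s k + s μ` and `s μ ≤ 2K`, so the remainder is dominated by the exponential moment
    -- at `s / 2`, which doubling controls.
    have e3 : Real.exp (y / 4) ≤ Real.exp (K / 2) * Real.exp (s * k / 2) := by
      rw [← Real.exp_add]
      apply Real.exp_le_exp.2
      have : 0 ≤ s * (k : ℝ) := by positivity
      linarith
    calc P k * _ ≤ P k * ((x * y) ^ 3 * Real.exp (x * y)) := by gcongr; exact hp k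
      _ ≤ P k * ((x * y) ^ 3 * Real.exp (1 / 8 * y)) := by gcongr; exact hp k
      _ = P k * x ^ 3 * (y ^ 3 * Real.exp (y / 8)) := by ring_nf
      _ ≤ P k * x ^ 3 * (3072 * Real.exp (y / 4)) :=
          mul_le_mul_of_nonneg_left (pow_three_mul_exp_le hy) (mul_nonneg (hp k) (by positivity))
      _ ≤ P k * x ^ 3 * (3072 * (Real.exp (K / 2) * Real.exp (s * k / 2))) :=
          mul_le_mul_of_nonneg_left (by gcongr) (mul_nonneg (hp k) (by positivity))
      _ = _ := by ring
  have hfin := tsum_of_norm_bounded (hE.mul_left (3072 * x ^ 3 * Real.exp (K / 2))) hbound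
  rw [hsum.tsum_eq] at hfin
  refine hfin.trans ?_
  calc _ ≤ 3072 * x ^ 3 * Real.exp (K / 2) * K := by gcongr
    _ = _ := by ring

end TameWeight

/-! ### Pointwise limit of the saddle-point kernel. -/

/-- If `p ε → 0` then `(1 + ε)^p → 1`. -/
theorem tendsto_one_add_pow {ι : Type*} {l : Filter ι} {p : ι → ℕ} {ε : ι → ℂ}
    (h : Tendsto (fun i => (p i : ℝ) * ‖ε i‖) l (𝓝 0)) :
    Tendsto (fun i => (1 + ε i) ^ p i) l (𝓝 1) := by
  have hb : ∀ (n : ℕ) (e : ℂ), ‖(1 + e) ^ n - 1‖ ≤ (1 + ‖e‖) ^ n - 1 := by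
    intro n e
    induction n with
    | zero => simp
    | succ n ih =>
      have e1 : (1 + e) ^ (n + 1) - 1 = (1 + e) * ((1 + e) ^ n - 1) + e := by ring
      have e2 : ‖1 + e‖ ≤ 1 + ‖e‖ := by simpa using norm_add_le 1 e
      rw [e1]
      calc _ ≤ ‖1 + e‖ * ‖(1 + e) ^ n - 1‖ + ‖e‖ := by
            simpa using norm_add_le ((1 + e) * ((1 + e) ^ n - 1)) e
        _ ≤ (1 + ‖e‖) * ((1 + ‖e‖) ^ n - 1) + ‖e‖ := by gcongr
        _ = _ := by ring
  rw [tendsto_iff_norm_sub_tendsto_zero]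
  have h2 : Tendsto (fun i => Real.exp ((p i : ℝ) * ‖ε i‖) - 1) l (𝓝 0) := by
    have := ((Real.continuous_exp.tendsto 0).comp h).sub_const 1
    simpa using this
  refine squeeze_zero (fun i => norm_nonneg _) (fun i => (hb _ _).trans ?_) h2
  rw [Real.exp_nat_mul]
  gcongr
  linarith [Real.add_one_le_exp ‖ε i‖]

/-- The normalized integrand, on the vertical line through the approximate saddle point, of the
Cauchy integral for the local probabilities of a sum of `p` tilted variables. -/
def llKernel (w : ℕ → ℝ) (s : ℝ) (p : ℕ) (t θ : ℝ) : ℂ :=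
  tiltMgf w s ((t / tiltScale w s p : ℝ) - θ * Complex.I) ^ p *
    Complex.exp (-(((t / tiltScale w s p : ℝ) - θ * Complex.I) * (t * tiltScale w s p : ℝ))) *
    Real.exp (t ^ 2 / 2)

/-- The local probabilities of a sum of `p` independent tilted variables. -/
def tiltProb (w : ℕ → ℝ) (s : ℝ) (p : ℕ) (N : ℤ) : ℝ :=
  if 0 ≤ N then powCoeff w p N.toNat * Real.exp (-(s * N)) / lap w s ^ p else 0

namespace TameWeight

variable {w : ℕ → ℝ} {α : ℝ}

/-- Coefficient extraction on the segment `Re z = s`. Keeping `s` free here is what later permits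
the contour to be shifted. -/
theorem integral_lapC_pow (hw : TameWeight w α) {s : ℝ} (hs : 0 < s) (p : ℕ) (N : ℤ) :
    ∫ θ in (-Real.pi)..Real.pi, lapC w (s + θ * Complex.I) ^ p * Complex.exp (θ * Complex.I * N) =
      2 * Real.pi * ((tiltProb w s p N * lap w s ^ p : ℝ) : ℂ) := by
  have hsum := hw.summable_zero hs
  have hb : Summable fun k : ℕ => ‖((powCoeff w p k * Real.exp (-(s * k)) : ℝ) : ℂ)‖ := by
    refine (lap_powCoeff hw.nonneg hsum p).summable.congr fun k => ?_
    rw [Complex.norm_real, Real.norm_of_nonneg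
      (mul_nonneg (powCoeff_nonneg hw.nonneg _ _) (Real.exp_pos _).le)]
  have h1 : ∀ θ : ℝ, lapC w (s + θ * Complex.I) ^ p =
      ∑' k : ℕ, ((powCoeff w p k * Real.exp (-(s * k)) : ℝ) : ℂ) *
        Complex.exp (-(θ * Complex.I * k)) := by
    intro θ
    rw [← (hasSum_lapC_pow hw.nonneg (by simpa using hsum) p).2]
    refine tsum_congr fun k => ?_
    push_cast
    rw [mul_assoc, ← Complex.exp_add]
    ring_nf
  simp_rw [h1]
  rw [integral_tsum_exp hb]
  congr 1
  have hD : lap w s ^ p ≠ 0 := pow_ne_zero _ (hw.lap_pos s hs).ne'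
  rcases lt_or_ge N 0 with hN | hN
  · rw [tiltProb, if_neg (by omega), zero_mul, Complex.ofReal_zero]
    refine (tsum_congr fun k => if_neg (by omega)).trans tsum_zero
  · lift N to ℕ using hN
    rw [tsum_eq_single N (fun j hj => if_neg (by exact_mod_cast hj)), if_pos rfl, tiltProb,
      if_pos (by positivity), div_mul_cancel₀ _ hD]
    simp

section Limits

variable {ι : Type*} {l : Filter ι} {χ t : ι → ℝ} {p : ι → ℕ}

theorem tendsto_tiltVar (hw : TameWeight w α) (hχ : Tendsto χ l (𝓝[>] 0)) :
    Tendsto (fun i => tiltVar w (χ i) * χ i ^ 2) l (𝓝 α) := hw.variance.comp hχ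

theorem tendsto_sqrt_tiltVar_mul (hw : TameWeight w α) (hχ : Tendsto χ l (𝓝[>] 0)) :
    Tendsto (fun i => √(tiltVar w (χ i)) * χ i) l (𝓝 √α) := by
  refine ((hw.tendsto_tiltVar hχ).sqrt).congr' ?_
  filter_upwards [hχ self_mem_nhdsWithin] with i hi
  have hi : 0 < χ i := hi
  rw [Real.sqrt_mul' _ (by positivity), Real.sqrt_sq hi.le]

theorem eventually_tiltVar_pos (hw : TameWeight w α) (hχ : Tendsto χ l (𝓝[>] 0)) :
    ∀ᶠ i in l, 0 < tiltVar w (χ i) := by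
  filter_upwards [hχ self_mem_nhdsWithin,
    (hw.tendsto_tiltVar hχ).eventually (lt_mem_nhds hw.alpha_pos)] with i hi h
  have hi : 0 < χ i := hi
  exact pos_of_mul_pos_left h (by positivity)

/-- The shift `t/σ` is negligible against `χ`: since `σ χ ~ √(α p)`, the ratio is of order `t / √p`.
Hence the shifted contour remains in the region of convergence and in the range of the expansion. -/
theorem tendsto_div_tiltScale_mul (hw : TameWeight w α) (hχ : Tendsto χ l (𝓝[>] 0))
    (hp : Tendsto p l atTop) (ht : Tendsto (fun i => |t i| ^ 3 / √(p i)) l (𝓝 0)) :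
    Tendsto (fun i => t i / tiltScale w (χ i) (p i) / χ i) l (𝓝 0) := by
  have hp' : Tendsto (fun i => (√(p i : ℝ))⁻¹) l (𝓝 0) :=
    (tendsto_inv_atTop_zero.comp Real.tendsto_sqrt_atTop).comp (tendsto_natCast_atTop_atTop.comp hp)
  have h1 : Tendsto (fun i => t i / √(p i)) l (𝓝 0) := by
    have h2 := ht.add hp'
    rw [add_zero] at h2
    refine squeeze_zero_norm (fun i => ?_) h2
    rw [norm_div, Real.norm_eq_abs, Real.norm_of_nonneg (Real.sqrt_nonneg _), ← one_div, ← add_div]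
    gcongr
    -- This is `|t| ≤ |t|³ + 1`.
    nlinarith [abs_nonneg (t i), sq_nonneg (|t i| - 1), sq_nonneg (|t i|),
      mul_nonneg (abs_nonneg (t i)) (sq_nonneg (|t i| - 1))]
  have h3 := h1.div (hw.tendsto_sqrt_tiltVar_mul hχ) (Real.sqrt_pos.2 hw.alpha_pos).ne'
  rw [zero_div] at h3
  refine h3.congr fun i => ?_
  simp only [Pi.div_apply, tiltScale]
  rw [div_div, div_div]
  ring_nf

/-- The pointwise limit of the rescaled kernel is the Gaussian. -/
theorem tendsto_llKernel (hw : TameWeight w α) (hχ : Tendsto χ l (𝓝[>] 0))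
    (hp : Tendsto p l atTop) (ht : Tendsto (fun i => |t i| ^ 3 / √(p i)) l (𝓝 0)) (u : ℝ) :
    Tendsto (fun i => llKernel w (χ i) (p i) (t i) (u / tiltScale w (χ i) (p i))) l
      (𝓝 (Real.exp (-u ^ 2 / 2) : ℂ)) := by
  obtain ⟨K, hK⟩ := hw.exists_tiltMgf_expansion
  have hpR : Tendsto (fun i => (p i : ℝ)) l atTop := tendsto_natCast_atTop_atTop.comp hp
  have hp' : Tendsto (fun i => (√(p i : ℝ))⁻¹) l (𝓝 0) :=
    (tendsto_inv_atTop_zero.comp Real.tendsto_sqrt_atTop).comp hpR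
  set r : ι → ℝ := fun i => ‖(t i : ℂ) - u * Complex.I‖
  have hr0 : ∀ i, 0 ≤ r i := fun i => norm_nonneg _
  have hr : Tendsto (fun i => r i ^ 3 / √(p i)) l (𝓝 0) := by
    have h1 := (ht.const_mul 4).add (hp'.const_mul (4 * |u| ^ 3))
    rw [mul_zero, mul_zero, add_zero] at h1
    refine squeeze_zero (fun i => by have := hr0 i; positivity) (fun i => ?_) h1
    have h2 : r i ≤ |t i| + |u| := by
      refine (norm_sub_le _ _).trans ?_
      simp
    have h3 : r i ^ 3 ≤ 4 * (|t i| ^ 3 + |u| ^ 3) := by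
      refine (pow_le_pow_left₀ (hr0 i) h2 3).trans ((add_pow_le (abs_nonneg _) (abs_nonneg _) 3).trans ?_)
      norm_num
    calc r i ^ 3 / √(p i) ≤ 4 * (|t i| ^ 3 + |u| ^ 3) / √(p i) := by gcongr
      _ = _ := by ring
  set z : ι → ℂ := fun i => ((t i / tiltScale w (χ i) (p i) : ℝ) : ℂ) -
    ((u / tiltScale w (χ i) (p i) : ℝ) : ℂ) * Complex.I
  have hz : ∀ i, z i = ((t i : ℂ) - u * Complex.I) / (tiltScale w (χ i) (p i) : ℝ) := by
    intro i; simp only [z]; push_cast; ring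
  have hzn : ∀ i, ‖z i‖ = r i / tiltScale w (χ i) (p i) := by
    intro i
    rw [hz, norm_div, Complex.norm_real, Real.norm_of_nonneg (by unfold tiltScale; positivity)]
  have hσ := hw.tendsto_sqrt_tiltVar_mul hχ
  -- The accumulated cubic error: `‖z‖ / χ` is of order `r / √p`, so `p` copies of its cube are of
  -- order `r³ / √p`.
  have hA : Tendsto (fun i => (‖z i‖ / χ i) ^ 3 * p i) l (𝓝 0) := by
    have h1 := hr.div (hσ.pow 3) (pow_ne_zero 3 (Real.sqrt_pos.2 hw.alpha_pos).ne')
    rw [zero_div] at h1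
    refine h1.congr' ?_
    filter_upwards [hpR.eventually_gt_atTop 0] with i hi
    simp only [Pi.div_apply]
    rw [hzn, tiltScale]
    have h2 : (p i : ℝ) = √(p i) ^ 2 := (Real.sq_sqrt hi.le).symm
    have h3 : √(p i : ℝ) ≠ 0 := (Real.sqrt_pos.2 hi).ne'
    generalize √(p i : ℝ) = q at *
    rw [h2]
    field_simp
  set v : ι → ℂ := fun i => z i ^ 2 * tiltVar w (χ i) / 2
  have hv : ∀ᶠ i in l, v i = ((t i : ℂ) - u * Complex.I) ^ 2 / (2 * p i) := by
    filter_upwards [hw.eventually_tiltVar_pos hχ, hpR.eventually_gt_atTop 0] with i hi hpi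
    have h1 : (tiltScale w (χ i) (p i)) ^ 2 = tiltVar w (χ i) * p i := by
      rw [tiltScale, mul_pow, Real.sq_sqrt hi.le, Real.sq_sqrt hpi.le]
    simp only [v]
    rw [hz, div_pow, ← Complex.ofReal_pow, h1]
    push_cast
    have h2 : (tiltVar w (χ i) : ℂ) ≠ 0 := by exact_mod_cast hi.ne'
    have h3 : (p i : ℂ) ≠ 0 := by exact_mod_cast hpi.ne'
    field_simp
  have hB : Tendsto (fun i => (p i : ℝ) * ‖v i‖ ^ 2) l (𝓝 0) := by
    have h1 := ((hr.pow 2).add (hp'.pow 2)).div_const 4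
    simp only [ne_eq, OfNat.ofNat_ne_zero, not_false_eq_true, zero_pow, add_zero, zero_div] at h1
    refine squeeze_zero' (Eventually.of_forall fun i => by positivity) ?_ h1
    filter_upwards [hv, hpR.eventually_gt_atTop 0] with i hi hpi
    rw [hi, norm_div, norm_pow, norm_mul, Complex.norm_ofNat, Complex.norm_natCast, inv_pow,
      Real.sq_sqrt hpi.le]
    change (p i : ℝ) * (r i ^ 2 / (2 * p i)) ^ 2 ≤ _
    have h2 : (p i : ℝ) * (r i ^ 2 / (2 * p i)) ^ 2 = r i ^ 4 / p i / 4 := by field_simp; norm_num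
    rw [h2, div_pow _ (√(p i : ℝ)), Real.sq_sqrt hpi.le, ← one_div, ← add_div]
    gcongr
    nlinarith [sq_nonneg (r i ^ 2), sq_nonneg (r i ^ 2 - 1), sq_nonneg (r i),
      mul_nonneg (sq_nonneg (r i)) (sq_nonneg (r i ^ 2 - 1))]
  -- Dividing each factor by its Gaussian part `e^v` leaves `1 + ε` with `p ε → 0`. The `p`-th power
  -- of `e^v` is then exact, because `p v = (t - iu)² / 2`, and combines with the remaining factors
  -- to `e^{-u²/2}`.
  set ε : ι → ℂ := fun i => tiltMgf w (χ i) (z i) * Complex.exp (-v i) - 1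
  have hε : Tendsto (fun i => (p i : ℝ) * ‖ε i‖) l (𝓝 0) := by
    have h1 := ((hA.const_mul K).add hB).const_mul (Real.exp 1)
    simp only [mul_zero, add_zero] at h1
    refine squeeze_zero' (Eventually.of_forall fun i => by positivity) ?_ h1
    filter_upwards [hχ.eventually hK, hχ self_mem_nhdsWithin, hpR.eventually_ge_atTop 1,
      hA.eventually (gt_mem_nhds (show (0 : ℝ) < (1 / 8) ^ 3 by positivity)),
      hB.eventually (gt_mem_nhds one_pos)] with i h2 h3 h4 h5 h6
    have h3 : 0 < χ i := h3
    have h7 : ‖z i‖ / χ i ≤ 1 / 8 := by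
      refine le_of_lt (lt_of_pow_lt_pow_left₀ 3 (by norm_num) (lt_of_le_of_lt ?_ h5))
      exact le_mul_of_one_le_right (by positivity) h4
    have h8 : ‖v i‖ ≤ 1 := by
      have : ‖v i‖ ^ 2 < 1 := lt_of_le_of_lt (le_mul_of_one_le_left (by positivity) h4) h6
      nlinarith [norm_nonneg (v i)]
    have h9 := h2 (z i) (by rw [div_le_iff₀ h3] at h7; linarith)
    have h10 := Complex.norm_exp_sub_one_sub_id_le h8
    have h11 : ε i = Complex.exp (-v i) * ((tiltMgf w (χ i) (z i) - 1 - v i) -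
        (Complex.exp (v i) - 1 - v i)) := by
      simp only [ε]
      have : Complex.exp (-v i) * Complex.exp (v i) = 1 := by rw [← Complex.exp_add]; simp
      linear_combination this
    have h12 : ‖Complex.exp (-v i)‖ ≤ Real.exp 1 := by
      rw [Complex.norm_exp]
      apply Real.exp_le_exp.2
      have := Complex.abs_re_le_norm (v i)
      rw [Complex.neg_re]
      linarith [neg_abs_le (v i).re]
    have h13 : ‖ε i‖ ≤ Real.exp 1 * (K * (‖z i‖ / χ i) ^ 3 + ‖v i‖ ^ 2) := by
      rw [h11, norm_mul]
      gcongr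
      exact (norm_sub_le _ _).trans (add_le_add h9 h10)
    calc (p i : ℝ) * ‖ε i‖ ≤ p i * (Real.exp 1 * (K * (‖z i‖ / χ i) ^ 3 + ‖v i‖ ^ 2)) := by gcongr
      _ = _ := by ring
  have hlim := (tendsto_one_add_pow hε).mul_const (Real.exp (-u ^ 2 / 2) : ℂ)
  rw [one_mul] at hlim
  refine hlim.congr' ?_
  filter_upwards [hv, hw.eventually_tiltVar_pos hχ, hpR.eventually_gt_atTop 0] with i hi hV hpi
  have ha : (tiltScale w (χ i) (p i) : ℂ) ≠ 0 := by
    have : 0 < tiltScale w (χ i) (p i) := by unfold tiltScale; positivity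
    exact_mod_cast this.ne'
  have hpc : (p i : ℂ) ≠ 0 := by exact_mod_cast hpi.ne'
  have h1 : z i * ((t i * tiltScale w (χ i) (p i) : ℝ) : ℂ) = t i * ((t i : ℂ) - u * Complex.I) := by
    rw [hz]; push_cast; field_simp
  change _ = tiltMgf w (χ i) (z i) ^ p i * Complex.exp (-(z i * ((t i * tiltScale w (χ i) (p i) : ℝ) : ℂ))) *
    (Real.exp (t i ^ 2 / 2) : ℂ)
  simp only [ε]
  rw [add_sub_cancel, mul_pow, ← Complex.exp_nat_mul, h1, hi, mul_assoc, mul_assoc]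
  push_cast
  rw [← Complex.exp_add, ← Complex.exp_add]
  congr 2
  field_simp
  ring_nf
  rw [Complex.I_sq]
  ring

end Limits

end TameWeight

/-! ### Integrating the kernel. -/

namespace TameWeight

variable {w : ℕ → ℝ} {α : ℝ}

theorem tiltMgf_vertical (w : ℕ → ℝ) (s δ θ : ℝ) : tiltMgf w s ((δ : ℝ) - θ * Complex.I) =
    lapC w ((s - δ : ℝ) + θ * Complex.I) *
      Complex.exp (-(((δ : ℝ) - θ * Complex.I) * tiltMean w s)) / lap w s := by
  rw [tiltMgf]
  congr 3
  push_cast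
  ring

theorem continuous_llKernel (hw : TameWeight w α) {s t : ℝ} {p : ℕ}
    (hδ : t / tiltScale w s p < s) : Continuous (llKernel w s p t) := by
  unfold llKernel
  simp_rw [tiltMgf_vertical]
  have := continuous_lapC_vertical hw.nonneg (hw.summable_zero (sub_pos.2 hδ))
  fun_prop

/-- Moving the contour by `δ = t/σ` tilts the law from parameter `s` to `s - δ`. Relative to its
value at `θ = 0`, the kernel thus decays like a power of a genuine characteristic function, to which
the bounds of `TameWeight` apply. -/
theorem norm_llKernel (hw : TameWeight w α) {s t : ℝ} {p : ℕ} (hs : 0 < s)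
    (hδ : t / tiltScale w s p < s) (θ : ℝ) :
    ‖llKernel w s p t θ‖ = ‖llKernel w s p t 0‖ *
      (‖lapC w ((s - t / tiltScale w s p : ℝ) + θ * Complex.I)‖ /
        lap w (s - t / tiltScale w s p)) ^ p := by
  have hD := hw.lap_pos _ (sub_pos.2 hδ)
  have h : ∀ θ : ℝ, ‖llKernel w s p t θ‖ =
      (‖lapC w ((s - t / tiltScale w s p : ℝ) + θ * Complex.I)‖ *
        Real.exp (-(t / tiltScale w s p * tiltMean w s)) / lap w s) ^ p *
      Real.exp (-(t / tiltScale w s p * (t * tiltScale w s p))) * Real.exp (t ^ 2 / 2) := by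
    intro θ
    unfold llKernel
    rw [tiltMgf_vertical, norm_mul, norm_mul, norm_pow, norm_div, norm_mul, Complex.norm_exp,
      Complex.norm_exp, Complex.norm_real, Complex.norm_real,
      Real.norm_of_nonneg (hw.lap_pos s hs).le, Real.norm_of_nonneg (Real.exp_pos _).le]
    congr 4 <;> simp
  have h0 : ‖lapC w ((s - t / tiltScale w s p : ℝ) + (0 : ℝ) * Complex.I)‖ =
      lap w (s - t / tiltScale w s p) := by
    rw [Complex.ofReal_zero, zero_mul, add_zero, lapC_ofReal, Complex.norm_real,
      Real.norm_of_nonneg hD.le]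
  rw [h, h, h0]
  generalize lap w (s - t / tiltScale w s p) = D at *
  have hD0 : D ≠ 0 := hD.ne'
  generalize ‖lapC w ((s - t / tiltScale w s p : ℝ) + θ * Complex.I)‖ = A
  have e : ∀ x : ℝ, A * x / lap w s = D * x / lap w s * (A / D) := fun x => by field_simp
  rw [e, mul_pow]
  ring

/-- The kernel integral is the normalized local probability. -/
theorem integral_llKernel (hw : TameWeight w α) {s t : ℝ} {p : ℕ}
    (hs : 0 < s) (hδ : t / tiltScale w s p < s) {N : ℤ}
    (hN : (N : ℝ) = p * tiltMean w s + t * tiltScale w s p) :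
    ∫ θ in (-Real.pi)..Real.pi, llKernel w s p t θ =
      ((2 * Real.pi * Real.exp (t ^ 2 / 2) * tiltProb w s p N : ℝ) : ℂ) := by
  set δ := t / tiltScale w s p with hδdef
  have h1 : ∀ θ : ℝ, llKernel w s p t θ =
      (lapC w ((s - δ : ℝ) + θ * Complex.I) ^ p * Complex.exp (θ * Complex.I * N)) *
        ((Real.exp (-(δ * N)) * Real.exp (t ^ 2 / 2) / lap w s ^ p : ℝ) : ℂ) := by
    intro θ
    have hNC : (N : ℂ) = p * tiltMean w s + t * tiltScale w s p := by
      have := congrArg (fun x : ℝ => (x : ℂ)) hN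
      push_cast at this
      exact this
    unfold llKernel
    rw [tiltMgf_vertical, ← hδdef, div_pow, mul_pow, ← Complex.exp_nat_mul]
    push_cast
    have h2 : Complex.exp (p * -((δ - θ * Complex.I) * tiltMean w s)) *
        Complex.exp (-((δ - θ * Complex.I) * (t * tiltScale w s p))) =
        Complex.exp (θ * Complex.I * N) * Complex.exp (-(δ * N)) := by
      rw [← Complex.exp_add, ← Complex.exp_add, hNC]
      ring_nf
    linear_combination lapC w (s - δ + θ * Complex.I) ^ p / lap w s ^ p *
      Complex.exp (t ^ 2 / 2) * h2
  simp_rw [h1]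
  rw [intervalIntegral.integral_mul_const, hw.integral_lapC_pow (sub_pos.2 hδ)]
  rw [← Complex.ofReal_ofNat, ← Complex.ofReal_mul, ← Complex.ofReal_mul, ← Complex.ofReal_mul]
  congr 1
  have hD := (hw.lap_pos s hs).ne'
  have hD' := (hw.lap_pos _ (sub_pos.2 hδ)).ne'
  unfold tiltProb
  split_ifs
  · have h3 : Real.exp (-((s - δ) * N)) * Real.exp (-(δ * N)) = Real.exp (-(s * N)) := by
      rw [← Real.exp_add]; ring_nf
    rw [← h3]
    field_simp
  · simp

section Limits

variable {ι : Type*} {l : Filter ι} [l.IsCountablyGenerated] {χ t : ι → ℝ} {p : ι → ℕ}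

/-- The interval is cut at `|θ| = χ`, the scale at which the bound on the characteristic function
saturates. The inner part, rescaled by `σ`, extends over a range growing like `√p` and converges to
the full Gaussian integral; the two outer parts vanish. -/
theorem tendsto_integral_llKernel (hw : TameWeight w α) (hχ : Tendsto χ l (𝓝[>] 0))
    (hp : Tendsto p l atTop) (ht : Tendsto (fun i => |t i| ^ 3 / √(p i)) l (𝓝 0)) :
    Tendsto (fun i => (tiltScale w (χ i) (p i) : ℂ) *
      ∫ θ in (-Real.pi)..Real.pi, llKernel w (χ i) (p i) (t i) θ) l
      (𝓝 ((√(2 * Real.pi) : ℝ) : ℂ)) := by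
  have hα := hw.alpha_pos
  have hpR : Tendsto (fun i => (p i : ℝ)) l atTop := tendsto_natCast_atTop_atTop.comp hp
  set a : ι → ℝ := fun i => tiltScale w (χ i) (p i)
  set δ : ι → ℝ := fun i => t i / a i
  set s : ι → ℝ := fun i => χ i - δ i
  have hχ0 : ∀ᶠ i in l, 0 < χ i := hχ self_mem_nhdsWithin
  have hχlim : Tendsto χ l (𝓝 0) := hχ.mono_right nhdsWithin_le_nhds
  have hδχ : ∀ᶠ i in l, |δ i| ≤ χ i / 2 := by
    have h1 := (hw.tendsto_div_tiltScale_mul hχ hp ht).abs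
    rw [abs_zero] at h1
    filter_upwards [h1.eventually (gt_mem_nhds (show (0 : ℝ) < 1 / 2 by norm_num)), hχ0] with i h2 h3
    rw [abs_div, abs_of_pos h3, div_lt_iff₀ h3] at h2
    change |δ i| < _ at h2
    linarith
  -- The shifted parameter stays comparable to `χ`, so bounds stated at scale `s i` may be used at
  -- scale `χ i`.
  have hs : ∀ᶠ i in l, χ i / 2 ≤ s i ∧ s i ≤ 2 * χ i ∧ δ i < χ i := by
    filter_upwards [hδχ, hχ0] with i h1 h2
    have := abs_le.1 h1
    simp only [s]
    refine ⟨?_, ?_, ?_⟩ <;> linarith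
  have hs0 : Tendsto s l (𝓝[>] 0) := by
    refine tendsto_nhdsWithin_iff.2 ⟨?_, ?_⟩
    · refine squeeze_zero' (g := fun i => 2 * χ i) ?_ ?_ (by simpa using hχlim.const_mul 2)
      · filter_upwards [hs, hχ0] with i h1 h2; linarith
      · filter_upwards [hs] with i h1 using h1.2.1
    · filter_upwards [hs, hχ0] with i h1 h2
      exact Set.mem_Ioi.2 (by linarith)
  have hapos : ∀ᶠ i in l, 0 < a i := by
    filter_upwards [hw.eventually_tiltVar_pos hχ, hpR.eventually_gt_atTop 0] with i h1 h2
    simp only [a, tiltScale]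
    positivity
  have haχ : ∀ᶠ i in l, (a i * χ i) ^ 2 ≤ 2 * α * p i := by
    filter_upwards [(hw.tendsto_tiltVar hχ).eventually (gt_mem_nhds (lt_two_mul_self hα)),
      hw.eventually_tiltVar_pos hχ] with i h1 h2
    have e : (a i * χ i) ^ 2 = tiltVar w (χ i) * χ i ^ 2 * p i := by
      simp only [a, tiltScale]
      rw [mul_pow, mul_pow, Real.sq_sqrt h2.le, Real.sq_sqrt (Nat.cast_nonneg _)]
      ring
    rw [e]
    gcongr
  have haχlim : Tendsto (fun i => a i * χ i) l atTop := by
    have h1 := (hw.tendsto_sqrt_tiltVar_mul hχ).pos_mul_atTop (Real.sqrt_pos.2 hα)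
      (Real.tendsto_sqrt_atTop.comp hpR)
    refine h1.congr fun i => ?_
    simp only [a, tiltScale, Function.comp]
    ring
  set H : ι → ℝ → ℂ := fun i => llKernel w (χ i) (p i) (t i)
  have hHc : ∀ᶠ i in l, Continuous (H i) := by
    filter_upwards [hs] with i h1 using hw.continuous_llKernel h1.2.2
  have hH0 : ∀ᶠ i in l, ‖H i 0‖ ≤ 2 := by
    have h1 := (hw.tendsto_llKernel hχ hp ht 0).norm
    simp only [zero_div] at h1
    norm_num at h1
    exact h1.eventually (ge_mem_nhds one_lt_two)
  obtain ⟨c, hc0, hc1, hc⟩ := hw.norm_le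
  obtain ⟨q, K, hqK⟩ := hw.power
  set ρ : ι → ℝ → ℝ := fun i θ => ‖lapC w (s i + θ * Complex.I)‖ / lap w (s i)
  have hρ : ∀ᶠ i in l, ∀ θ, ‖H i θ‖ = ‖H i 0‖ * ρ i θ ^ p i := by
    filter_upwards [hs, hχ0] with i h1 h2 θ using hw.norm_llKernel h2 h1.2.2 θ
  have hρle : ∀ᶠ i in l, ∀ θ, |θ| ≤ Real.pi → ρ i θ ≤ 1 - c * min 1 ((θ / (2 * χ i)) ^ 2) := by
    filter_upwards [hs0.eventually hc, hs, hs0 self_mem_nhdsWithin] with i h1 h2 h3 θ hθ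
    have h3 : 0 < s i := h3
    have hD := hw.lap_pos _ h3
    have h4 := h1 θ hθ
    simp only [ρ]
    rw [div_le_iff₀ hD, mul_comm (1 - _)]
    refine h4.trans ?_
    gcongr 3
    refine min_le_min le_rfl ?_
    rw [div_pow, div_pow]
    gcongr
    exact h2.2.1
  have hρ0 : ∀ᶠ i in l, ∀ θ, 0 ≤ ρ i θ := by
    filter_upwards [hs0 self_mem_nhdsWithin] with i h3 θ
    have := hw.lap_pos _ h3
    simp only [ρ]
    positivity
  -- the central part
  have hnear : Tendsto (fun i => (a i : ℂ) * ∫ θ in (-χ i)..χ i, H i θ) l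
      (𝓝 ((√(2 * Real.pi) : ℝ) : ℂ)) := by
    have hgauss : ∫ u : ℝ, ((Real.exp (-u ^ 2 / 2) : ℝ) : ℂ) = ((√(2 * Real.pi) : ℝ) : ℂ) := by
      have h1 := integral_gaussian (1 / 2)
      rw [integral_complex_ofReal]
      congr 1
      calc _ = ∫ u : ℝ, Real.exp (-(1 / 2) * u ^ 2) := by
            congr 1; funext u; ring_nf
        _ = _ := by rw [h1]; congr 1; field_simp
    rw [← hgauss]
    have hcv : ∀ᶠ i in l, ∫ u : ℝ, (Set.Ioc (-(a i * χ i)) (a i * χ i)).indicator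
        (fun u => H i (u / a i)) u = (a i : ℂ) * ∫ θ in (-χ i)..χ i, H i θ := by
      filter_upwards [hapos, hχ0] with i h1 h2
      have h3 := intervalIntegral.integral_comp_div (a := -(a i * χ i)) (b := a i * χ i) (H i) h1.ne'
      rw [integral_indicator measurableSet_Ioc, ← intervalIntegral.integral_of_le
        (by have := mul_pos h1 h2; linarith), h3, neg_div, mul_div_cancel_left₀ _ h1.ne',
        Complex.real_smul]
    refine Tendsto.congr' hcv ?_
    -- The Gaussian majorant comes from `1 - x ≤ e^{-x}` and `(σχ)² ≤ 2αp`: its rate `c / (8α)` is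
    -- `c/4`, from `(θ / 2χ)²`, times `1 / (2α)`.
    refine tendsto_integral_filter_of_dominated_convergence
      (fun u => 2 * Real.exp (-(c / (8 * α)) * u ^ 2)) ?_ ?_ ?_ ?_
    · filter_upwards [hHc] with i h1
      exact ((by fun_prop : Continuous fun u => H i (u / a i)).aestronglyMeasurable).indicator
        measurableSet_Ioc
    · filter_upwards [hapos, hχ0, haχ, hH0, hρ, hρle, hρ0, hpR.eventually_gt_atTop 0,
        hχlim.eventually (ge_mem_nhds Real.pi_pos)] with i h1 h2 h3 h4 h5 h6 h7 h8 h9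
      refine Eventually.of_forall fun u => ?_
      by_cases hu : u ∈ Set.Ioc (-(a i * χ i)) (a i * χ i)
      · rw [Set.indicator_of_mem hu, h5]
        have h10 : |u / a i| ≤ χ i := by
          rw [abs_div, abs_of_pos h1, div_le_iff₀ h1, mul_comm]
          exact abs_le.2 ⟨hu.1.le, hu.2⟩
        have h11 := h6 _ (h10.trans h9)
        have h12 : (u / a i / (2 * χ i)) ^ 2 ≤ 1 := by
          rw [div_pow, div_le_one (by positivity), ← sq_abs]
          have := abs_nonneg (u / a i)
          nlinarith
        rw [min_eq_right h12] at h11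
        have h13 : ρ i (u / a i) ≤ Real.exp (-(c * (u / a i / (2 * χ i)) ^ 2)) :=
          h11.trans (by linarith [Real.add_one_le_exp (-(c * (u / a i / (2 * χ i)) ^ 2))])
        have h14 : ρ i (u / a i) ^ p i ≤ Real.exp (-(c / (8 * α)) * u ^ 2) := by
          refine (pow_le_pow_left₀ (h7 _) h13 _).trans ?_
          rw [← Real.exp_nat_mul]
          apply Real.exp_le_exp.2
          have h15 : (p i : ℝ) * -(c * (u / a i / (2 * χ i)) ^ 2) =
              -(c * u ^ 2 / 4) * (p i / (a i * χ i) ^ 2) := by field_simp; norm_num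
          have h16 : 1 / (2 * α) ≤ p i / (a i * χ i) ^ 2 := by
            rw [div_le_div_iff₀ (by positivity) (by positivity)]; linarith
          have h17 := mul_le_mul_of_nonneg_left h16 (show 0 ≤ c * u ^ 2 / 4 by positivity)
          have h18 : c * u ^ 2 / 4 * (1 / (2 * α)) = c / (8 * α) * u ^ 2 := by field_simp; ring
          rw [h15]
          linarith
        exact mul_le_mul h4 h14 (pow_nonneg (h7 _) _) zero_le_two
      · rw [Set.indicator_of_notMem hu, norm_zero]
        positivity
    · exact (integrable_exp_neg_mul_sq (by positivity)).const_mul 2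
    · refine Eventually.of_forall fun u => ?_
      refine (hw.tendsto_llKernel hχ hp ht u).congr' ?_
      filter_upwards [haχlim.eventually_gt_atTop |u|] with i h1
      rw [Set.indicator_of_mem]
      exact ⟨by linarith [neg_abs_le u], (le_abs_self u).trans h1.le⟩
  -- the outer part
  have hfar0 : Tendsto (fun i => 8 * |K| * (√(2 * α) * ((p i : ℝ) *
      ((1 - c / 4) ^ p i * ((1 - c / 4) ^ (2 * q))⁻¹)))) l (𝓝 0) := by
    have h1 := (tendsto_self_mul_const_pow_of_lt_one (r := 1 - c / 4) (by linarith)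
      (by linarith)).comp hp
    have h2 := (h1.mul_const ((1 - c / 4) ^ (2 * q))⁻¹).const_mul (8 * |K| * √(2 * α))
    simp only [zero_mul, mul_zero] at h2
    refine h2.congr fun i => ?_
    simp only [Function.comp]
    ring
  have hfarbound : ∀ᶠ i in l, ∀ x y : ℝ, -Real.pi ≤ x → x ≤ y → y ≤ Real.pi →
      (∀ θ ∈ Set.Ioc x y, χ i ≤ |θ|) → ‖(a i : ℂ) * ∫ θ in x..y, H i θ‖ ≤
        8 * |K| * (√(2 * α) * ((p i : ℝ) * ((1 - c / 4) ^ p i * ((1 - c / 4) ^ (2 * q))⁻¹))) := by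
    filter_upwards [hapos, hχ0, haχ, hH0, hρ, hρle, hρ0, hp.eventually_ge_atTop (2 * q),
      hpR.eventually_ge_atTop 1, hs, hs0 self_mem_nhdsWithin, hs0.eventually hqK, hHc]
      with i h1 h2 h3 h4 h5 h6 h7 h8 h9 h10 h11 h12 h13 x y hx hxy hy hθ
    have h11 : 0 < s i := h11
    have hD := hw.lap_pos _ h11
    have hr : 0 < 1 - c / 4 := by linarith
    set R := (1 - c / 4) ^ p i * ((1 - c / 4) ^ (2 * q))⁻¹
    have hR : 0 ≤ R := by positivity
    have hcont : Continuous fun θ => ρ i θ ^ (2 * q) := by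
      have := continuous_lapC_vertical hw.nonneg (hw.summable_zero h11)
      simp only [ρ]
      fun_prop
    have hpt : ∀ θ ∈ Set.Ioc x y, ‖H i θ‖ ≤ 2 * (R * ρ i θ ^ (2 * q)) := by
      intro θ hθm
      have e1 := h6 θ (abs_le.2 ⟨by linarith [hθm.1], by linarith [hθm.2]⟩)
      have e2 : 1 / 4 ≤ min 1 ((θ / (2 * χ i)) ^ 2) := by
        refine le_min (by norm_num) ?_
        rw [div_pow, le_div_iff₀ (by positivity), ← sq_abs θ]
        have := hθ θ hθm
        nlinarith
      have e3 : ρ i θ ≤ 1 - c / 4 := e1.trans (by nlinarith)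
      have e4 : ρ i θ ^ p i ≤ R * ρ i θ ^ (2 * q) := by
        have e5 : p i = (p i - 2 * q) + 2 * q := by omega
        have e6 : R = (1 - c / 4) ^ (p i - 2 * q) := by
          simp only [R]
          nth_rw 1 [e5]
          rw [pow_add, mul_assoc, mul_inv_cancel₀ (by positivity), mul_one]
        nth_rw 1 [e5]
        rw [pow_add, e6]
        exact mul_le_mul_of_nonneg_right (pow_le_pow_left₀ (h7 θ) e3 _) (pow_nonneg (h7 θ) _)
      rw [h5]
      exact mul_le_mul h4 e4 (pow_nonneg (h7 θ) _) zero_le_two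
    have hint : ∫ θ in (-Real.pi)..Real.pi, ρ i θ ^ (2 * q) ≤ K * s i := by
      simp only [ρ, div_pow]
      rw [intervalIntegral.integral_div, div_le_iff₀ (by positivity)]
      exact h12
    have hI : ‖∫ θ in x..y, H i θ‖ ≤ 2 * (R * (K * s i)) := by
      refine (intervalIntegral.norm_integral_le_of_norm_le hxy
        (ae_of_all _ fun θ hθm => hpt θ hθm)
        (Continuous.intervalIntegrable (by fun_prop) _ _)).trans ?_
      rw [intervalIntegral.integral_const_mul, intervalIntegral.integral_const_mul]
      have : ∫ θ in x..y, ρ i θ ^ (2 * q) ≤ ∫ θ in (-Real.pi)..Real.pi, ρ i θ ^ (2 * q) :=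
        intervalIntegral.integral_mono_interval hx hxy hy
          (ae_of_all _ fun θ => pow_nonneg (h7 θ) _) (hcont.intervalIntegrable _ _)
      gcongr
      exact this.trans hint
    have haχ' : a i * χ i ≤ √(2 * α) * p i := by
      have e1 : a i * χ i ≤ √(2 * α * p i) := Real.le_sqrt_of_sq_le h3
      rw [Real.sqrt_mul (by positivity)] at e1
      refine e1.trans ?_
      gcongr
      exact Real.sqrt_le_iff.2 ⟨by positivity, by nlinarith⟩
    rw [norm_mul, Complex.norm_real, Real.norm_of_nonneg h1.le]
    calc a i * ‖∫ θ in x..y, H i θ‖ ≤ a i * (2 * (R * (K * s i))) := by gcongr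
      _ ≤ a i * (2 * (R * (|K| * (2 * χ i)))) := by
          gcongr
          · exact le_abs_self K
          · exact h10.2.1
      _ = 4 * |K| * R * (a i * χ i) := by ring
      _ ≤ 4 * |K| * R * (√(2 * α) * p i) := by gcongr
      _ ≤ 8 * |K| * R * (√(2 * α) * p i) := by
          gcongr
          norm_num
      _ = _ := by ring
  have hfar1 : Tendsto (fun i => (a i : ℂ) * ∫ θ in (-Real.pi)..(-χ i), H i θ) l (𝓝 0) := by
    refine squeeze_zero_norm' ?_ hfar0
    filter_upwards [hfarbound, hχ0, hχlim.eventually (ge_mem_nhds Real.pi_pos)] with i h1 h2 h3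
    refine h1 _ _ le_rfl (by linarith) (by linarith) fun θ hθ => ?_
    linarith [hθ.2, neg_abs_le θ]
  have hfar2 : Tendsto (fun i => (a i : ℂ) * ∫ θ in (χ i)..Real.pi, H i θ) l (𝓝 0) := by
    refine squeeze_zero_norm' ?_ hfar0
    filter_upwards [hfarbound, hχ0, hχlim.eventually (ge_mem_nhds Real.pi_pos)] with i h1 h2 h3
    refine h1 _ _ (by linarith) (by linarith) le_rfl fun θ hθ => ?_
    exact hθ.1.le.trans (le_abs_self θ)
  have hall := (hfar1.add hnear).add hfar2
  rw [zero_add, add_zero] at hall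
  refine hall.congr' ?_
  filter_upwards [hHc] with i h1
  rw [← mul_add, ← mul_add, intervalIntegral.integral_add_adjacent_intervals
    (h1.intervalIntegrable _ _) (h1.intervalIntegrable _ _),
    intervalIntegral.integral_add_adjacent_intervals
    (h1.intervalIntegrable _ _) (h1.intervalIntegrable _ _)]

/-- The local limit theorem for sums of tilted variables. -/
theorem tendsto_tiltProb (hw : TameWeight w α) (hχ : Tendsto χ l (𝓝[>] 0))
    (hp : Tendsto p l atTop) (ht : Tendsto (fun i => |t i| ^ 3 / √(p i)) l (𝓝 0)) {N : ι → ℤ}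
    (hN : ∀ᶠ i in l, (N i : ℝ) = p i * tiltMean w (χ i) + t i * tiltScale w (χ i) (p i)) :
    Tendsto (fun i => √(2 * Real.pi) * tiltScale w (χ i) (p i) * Real.exp (t i ^ 2 / 2) *
      tiltProb w (χ i) (p i) (N i)) l (𝓝 1) := by
  have h1 := hw.tendsto_integral_llKernel hχ hp ht
  have h2 : ∀ᶠ i in l, t i / tiltScale w (χ i) (p i) < χ i := by
    filter_upwards [(hw.tendsto_div_tiltScale_mul hχ hp ht).eventually (gt_mem_nhds one_pos),
      hχ self_mem_nhdsWithin] with i h3 h4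
    rwa [div_lt_one h4] at h3
  have h3 : Tendsto (fun i => tiltScale w (χ i) (p i) * (2 * Real.pi * Real.exp (t i ^ 2 / 2) *
      tiltProb w (χ i) (p i) (N i))) l (𝓝 √(2 * Real.pi)) := by
    rw [← tendsto_ofReal_iff]
    refine h1.congr' ?_
    filter_upwards [h2, hN, hχ self_mem_nhdsWithin] with i h4 h5 h6
    rw [hw.integral_llKernel h6 h4 h5]
    push_cast
    rfl
  have hπ : 0 < √(2 * Real.pi) := Real.sqrt_pos.2 (by positivity)
  have h4 := h3.div_const √(2 * Real.pi)
  rw [div_self hπ.ne'] at h4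
  refine h4.congr fun i => ?_
  have h5 : 2 * Real.pi = √(2 * Real.pi) * √(2 * Real.pi) :=
    (Real.mul_self_sqrt (by positivity)).symm
  rw [div_eq_iff hπ.ne']
  nth_rw 1 [h5]
  ring

end Limits

end TameWeight

/-! ### Law, mean and variance of sums of independent tilted variables. -/

section Probability

variable {Ω : Type*} [MeasurableSpace Ω] {P : Measure Ω} [IsProbabilityMeasure P]

/-- Expectations of nonnegative functions of an integer random variable. -/
theorem integrable_and_integral_of_law {X : Ω → ℕ} (hX : Measurable X) {π f : ℕ → ℝ} {a : ℝ}
    (hlaw : ∀ k, P.real {ω | X ω = k} = π k) (hf : ∀ k, 0 ≤ f k)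
    (hsum : HasSum (fun k => π k * f k) a) :
    Integrable (fun ω => f (X ω)) P ∧ ∫ ω, f (X ω) ∂P = a := by
  have hπ : ∀ k, 0 ≤ π k := fun k => by rw [← hlaw]; exact measureReal_nonneg
  have hfm : Measurable fun ω => f (X ω) := (measurable_from_nat (f := f)).comp hX
  have hl : ∫⁻ ω, ENNReal.ofReal (f (X ω)) ∂P = ENNReal.ofReal a := by
    have h1 := lintegral_map (μ := P) (f := fun k : ℕ => ENNReal.ofReal (f k)) measurable_from_nat hX
    rw [← h1, lintegral_countable', ← hsum.tsum_eq,
      -- Working with nonnegative `f` in `ENNReal` yields integrability and the value of the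
      -- integral from one computation.
      ENNReal.ofReal_tsum_of_nonneg (fun k => mul_nonneg (hπ k) (hf k)) hsum.summable]
    refine tsum_congr fun k => ?_
    rw [Measure.map_apply hX (measurableSet_singleton k), mul_comm, ENNReal.ofReal_mul (hπ k), ← hlaw,
      ofReal_measureReal]
    rfl
  have ha : 0 ≤ a := hsum.nonneg fun k => mul_nonneg (hπ k) (hf k)
  refine ⟨⟨hfm.aestronglyMeasurable, ?_⟩, ?_⟩
  · rw [hasFiniteIntegral_iff_ofReal (ae_of_all _ fun ω => hf _), hl]
    exact ENNReal.ofReal_lt_top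
  · rw [integral_eq_lintegral_of_nonneg_ae (ae_of_all _ fun ω => hf _) hfm.aestronglyMeasurable, hl,
      ENNReal.toReal_ofReal ha]

/-- The law of a sum of independent variables with a common law is a convolution power. -/
theorem measureReal_sum_eq_powCoeff {X : ℕ → Ω → ℕ} (hX : ∀ i, Measurable (X i))
    (hind : iIndepFun X P) {π : ℕ → ℝ} (hlaw : ∀ i k, P.real {ω | X i ω = k} = π k) (p N : ℕ) :
    P.real {ω | ∑ i ∈ Finset.range p, X i ω = N} = powCoeff π p N := by
  induction p generalizing N with
  | zero =>
    by_cases hN : N = 0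
    · simp [powCoeff, hN]
    · simp [powCoeff, PowerSeries.coeff_one, hN, Ne.symm hN]
  | succ p ih =>
    have hS : Measurable fun ω => ∑ i ∈ Finset.range p, X i ω :=
      Finset.measurable_sum _ fun i _ => hX i
    have hi : IndepFun (fun ω => ∑ i ∈ Finset.range p, X i ω) (X p) P := by
      have h1 := hind.indepFun_finsetSum_of_notMem hX (s := Finset.range p) (i := p) (by simp)
      have h2 : (∑ i ∈ Finset.range p, X i) = fun ω => ∑ i ∈ Finset.range p, X i ω := by
        funext ω; simp
      rwa [h2] at h1
    have hset : {ω | ∑ i ∈ Finset.range (p + 1), X i ω = N} =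
        ⋃ q ∈ Finset.HasAntidiagonal.antidiagonal N,
          ((fun ω => ∑ i ∈ Finset.range p, X i ω) ⁻¹' {q.1} ∩ X p ⁻¹' {q.2}) := by
      ext ω
      simp only [Finset.sum_range_succ, Set.mem_ofPred_eq, Set.mem_iUnion,
        Finset.HasAntidiagonal.mem_antidiagonal, Set.mem_inter_iff, Set.mem_preimage,
        Set.mem_singleton_iff, exists_prop, Prod.exists]
      constructor
      · intro h; exact ⟨_, _, h, rfl, rfl⟩
      · rintro ⟨a, b, h, rfl, rfl⟩; exact h
    rw [hset, measureReal_biUnion_finset, powCoeff_succ]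
    · refine Finset.sum_congr rfl fun q _ => ?_
      rw [measureReal_def, hi.measure_inter_preimage_eq_mul _ _ (measurableSet_singleton _)
        (measurableSet_singleton _), ENNReal.toReal_mul, ← measureReal_def, ← measureReal_def]
      exact congrArg₂ _ (ih q.1) (hlaw p q.2)
    · rintro ⟨a, b⟩ _ ⟨a', b'⟩ _ hne
      refine Set.disjoint_left.2 ?_
      rintro ω ⟨h1, h2⟩ ⟨h3, h4⟩
      simp only [Set.mem_preimage, Set.mem_singleton_iff] at h1 h2 h3 h4
      exact hne (by rw [← h1, ← h2, ← h3, ← h4])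
    · exact fun q _ => (hS (measurableSet_singleton _)).inter (hX p (measurableSet_singleton _))

theorem powCoeff_mul_const (v : ℕ → ℝ) (C : ℝ) (p k : ℕ) :
    powCoeff (fun j => v j * C) p k = powCoeff v p k * C ^ p := by
  induction p generalizing k with
  | zero => simp [powCoeff]
  | succ p ih =>
    rw [powCoeff_succ, powCoeff_succ, Finset.sum_mul]
    refine Finset.sum_congr rfl fun q _ => ?_
    rw [ih]
    ring

variable {w : ℕ → ℝ} {α s : ℝ}

/-- A sum of independent tilted variables has the local probabilities `tiltProb`. -/
theorem measureReal_shiftedSum_eq_tiltProb {X : ℕ → Ω → ℕ} (hX : ∀ i, Measurable (X i))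
    (hind : iIndepFun X P)
    (hlaw : ∀ i k, P.real {ω | X i ω = k} = w k * Real.exp (-(s * k)) / lap w s) (m p : ℕ) (N : ℤ) :
    P.real {ω | shiftedSum m p X ω = (N : ℝ) - p * m} = tiltProb w s p N := by
  have h1 : ∀ ω, shiftedSum m p X ω = ((∑ i ∈ Finset.range p, X i ω : ℕ) : ℝ) - p * m := by
    intro ω; simp [shiftedSum]
  have h2 : ∀ ω, shiftedSum m p X ω = (N : ℝ) - p * m ↔
      ((∑ i ∈ Finset.range p, X i ω : ℕ) : ℤ) = N := by
    intro ω
    rw [h1, sub_left_inj]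
    exact_mod_cast Iff.rfl
  simp_rw [h2]
  unfold tiltProb
  split_ifs with hN
  · lift N to ℕ using hN
    have h3 := measureReal_sum_eq_powCoeff hX hind hlaw p N
    have h4 : ∀ k : ℕ, w k * Real.exp (-(s * k)) / lap w s =
        w k * Real.exp (-s) ^ k * (lap w s)⁻¹ := fun k => by
      rw [← Real.exp_nat_mul, div_eq_mul_inv]; ring_nf
    simp_rw [h4] at h3
    rw [powCoeff_mul_const (fun k => w k * Real.exp (-s) ^ k), powCoeff_mul_pow, ← Real.exp_nat_mul] at h3
    simp only [Nat.cast_inj, Int.toNat_natCast]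
    rw [h3, inv_pow, div_eq_mul_inv]
    simp only [Int.cast_natCast]
    ring_nf
  · have h3 : {ω | ((∑ i ∈ Finset.range p, X i ω : ℕ) : ℤ) = N} = ∅ := by
      ext ω
      simp only [Set.mem_ofPred_eq, Set.mem_empty_iff_false, iff_false]
      omega
    rw [h3, measureReal_empty]

theorem integral_shiftedSum_and_stdDev (hw : TameWeight w α) (hs : 0 < s) {X : ℕ → Ω → ℕ}
    (hX : ∀ i, Measurable (X i)) (hind : iIndepFun X P)
    (hlaw : ∀ i k, P.real {ω | X i ω = k} = w k * Real.exp (-(s * k)) / lap w s) (m p : ℕ) :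
    ∫ ω, shiftedSum m p X ω ∂P = p * tiltMean w s - p * m ∧
      stdDev P (shiftedSum m p X) = tiltScale w s p := by
  have h1 := fun i => integrable_and_integral_of_law (hX i) (hlaw i)
    (f := fun k => (k : ℝ)) (fun k => k.cast_nonneg) (hw.hasSum_mean hs)
  have h2 := fun i => integrable_and_integral_of_law (hX i) (hlaw i)
    (f := fun k => (k : ℝ) ^ 2) (fun k => by positivity) (hw.hasSum_sq hs)
  have hm : ∀ i, Measurable fun ω => (X i ω : ℝ) := fun i => measurable_from_nat.comp (hX i)
  have hL2 : ∀ i, MemLp (fun ω => (X i ω : ℝ)) 2 P := fun i =>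
    (memLp_two_iff_integrable_sq (hm i).aestronglyMeasurable).2 (h2 i).1
  have hvar : ∀ i, variance (fun ω => (X i ω : ℝ)) P = tiltVar w s := by
    intro i
    rw [variance_eq_sub (hL2 i), (h1 i).2]
    have : ∫ ω, ((fun ω => (X i ω : ℝ)) ^ 2) ω ∂P = tiltVar w s + tiltMean w s ^ 2 := (h2 i).2
    rw [this]
    ring
  constructor
  · unfold shiftedSum
    have hint : ∀ i, Integrable (fun ω => (X i ω : ℝ) - m) P := fun i =>
      (h1 i).1.sub (integrable_const _)
    rw [integral_finsetSum _ fun i _ => hint i]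
    have : ∀ i, ∫ ω, ((X i ω : ℝ) - m) ∂P = tiltMean w s - m := fun i => by
      rw [integral_sub (h1 i).1 (integrable_const _), (h1 i).2]
      simp
    simp_rw [this]
    simp
  · have h3 : shiftedSum m p X = fun ω => (∑ i ∈ Finset.range p, fun ω => (X i ω : ℝ)) ω - p * m := by
      funext ω; simp [shiftedSum]
    have h4 : iIndepFun (fun i ω => (X i ω : ℝ)) P :=
      hind.comp (fun _ k => (k : ℝ)) fun _ => measurable_from_nat
    rw [stdDev, h3, variance_sub_const, IndepFun.variance_sum (fun i _ => hL2 i)]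
    · simp_rw [hvar]
      rw [Finset.sum_const, Finset.card_range, nsmul_eq_mul, mul_comm,
        Real.sqrt_mul' _ (Nat.cast_nonneg p), tiltScale]
    · exact fun i _ j _ hij => h4.indepFun hij
    · exact (Finset.aestronglyMeasurable_sum _ fun i _ => (hm i).aestronglyMeasurable)

end Probability

/-! ### Uniformity in `t` and the local limit theorem. -/

/-- Uniform equivalence as convergence along a filter on pairs. -/
theorem unifEquiv_of_tendsto {S : ℕ → Set ℝ} {A B : ℕ → ℝ → ℝ}
    (h : Tendsto (fun q : ℕ × ℝ => A q.1 q.2 / B q.1 q.2)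
      (comap Prod.fst atTop ⊓ 𝓟 {q : ℕ × ℝ | q.2 ∈ S q.1}) (𝓝 1)) : UnifEquiv S A B := by
  intro ε hε
  have h1 := (Metric.tendsto_nhds.1 h) ε hε
  rw [eventually_inf_principal, eventually_comap] at h1
  filter_upwards [h1] with n hn t ht
  have := hn (n, t) rfl ht
  rw [Real.dist_eq] at this
  exact this.le

/-- The local limit theorem for independent tilted variables. -/
theorem TameWeight.localLimit {w : ℕ → ℝ} {α : ℝ} (hw : TameWeight w α) {p : ℕ → ℕ}
    (hp : Tendsto p atTop atTop) {Ω : ℕ → Type*} [∀ n, MeasurableSpace (Ω n)]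
    (P : ∀ n, Measure (Ω n)) [∀ n, IsProbabilityMeasure (P n)] (X : ∀ n, ℕ → Ω n → ℕ)
    (hmeas : ∀ n i, Measurable (X n i)) (hindep : ∀ n, iIndepFun (X n) (P n)) {χ : ℕ → ℝ}
    (hχ : Tendsto χ atTop (𝓝[>] 0)) (m : ℕ)
    (hlaw : ∀ᶠ n in atTop, ∀ i k,
      (P n).real {ω | X n i ω = k} = w k * Real.exp (-(χ n * k)) / lap w (χ n)) :
    LocalLimit P (fun n => shiftedSum m (p n) (X n)) p α χ := by
  intro s hs
  have hα := hw.alpha_pos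
  -- This is where `s = o(p^{1/6})` enters: the quotient is the cube of `s / p^{1/6}`.
  have hs3 : Tendsto (fun n => s n ^ 3 / √(p n)) atTop (𝓝 0) := by
    have h1 := (hs.tendsto_div_nhds_zero).pow 3
    rw [zero_pow three_ne_zero] at h1
    refine h1.congr fun n => ?_
    rw [div_pow, ← Real.rpow_natCast ((p n : ℝ) ^ (1 / 6 : ℝ)), ← Real.rpow_mul (Nat.cast_nonneg _),
      Real.sqrt_eq_rpow]
    norm_num
  set a : ℕ → ℝ := fun n => tiltScale w (χ n) (p n)
  set L : ∀ n, Ω n → ℝ := fun n => shiftedSum m (p n) (X n)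
  have hmom : ∀ᶠ n in atTop, ∫ ω, L n ω ∂(P n) = p n * tiltMean w (χ n) - p n * m ∧
      stdDev (P n) (L n) = a n := by
    filter_upwards [hlaw, hχ self_mem_nhdsWithin] with n h1 h2
    exact integral_shiftedSum_and_stdDev hw h2 (hmeas n) (hindep n) h1 m (p n)
  have hpt : ∀ᶠ n in atTop, ∀ t, stdPoint (P n) (L n) t =
      p n * tiltMean w (χ n) - p n * m + t * a n := by
    filter_upwards [hmom] with n hn t
    rw [stdPoint, hn.1, hn.2]
  have hapos : ∀ᶠ n in atTop, 0 < a n := by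
    filter_upwards [hw.eventually_tiltVar_pos hχ, hp.eventually_gt_atTop 0] with n h1 h2
    have : (0 : ℝ) < p n := by exact_mod_cast h2
    simp only [a, tiltScale]
    positivity
  -- The map `τ` is either the identity or zero, so that numerator and denominator of the first
  -- equivalence are limits along one and the same filter on pairs.
  have key : ∀ (S : ℕ → Set ℝ) (τ : ℝ → ℝ), (∀ t, |τ t| ≤ |t|) →
      (∀ n, ∀ t ∈ S n, |t| ≤ s n) →
      (∀ n, ∀ t ∈ S n, ∃ z : ℤ, stdPoint (P n) (L n) (τ t) = z) →
      Tendsto (fun q : ℕ × ℝ => √(2 * Real.pi) * a q.1 * Real.exp (τ q.2 ^ 2 / 2) *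
        (P q.1).real {ω | L q.1 ω = stdPoint (P q.1) (L q.1) (τ q.2)})
        (comap Prod.fst atTop ⊓ 𝓟 {q : ℕ × ℝ | q.2 ∈ S q.1}) (𝓝 1) := by
    intro S τ hτ hS hz
    set l := comap (Prod.fst : ℕ × ℝ → ℕ) atTop ⊓ 𝓟 {q : ℕ × ℝ | q.2 ∈ S q.1}
    have hfst : Tendsto (Prod.fst : ℕ × ℝ → ℕ) l atTop := tendsto_comap.mono_left inf_le_left
    have hmem : ∀ᶠ q in l, q.2 ∈ S q.1 := mem_inf_of_right (mem_principal_self _)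
    have ht : Tendsto (fun q : ℕ × ℝ => |τ q.2| ^ 3 / √(p q.1)) l (𝓝 0) := by
      refine squeeze_zero' (Eventually.of_forall fun q => by positivity) ?_ (hs3.comp hfst)
      filter_upwards [hmem] with q hq
      simp only [Function.comp]
      gcongr
      exact (hτ _).trans (hS _ _ hq)
    -- The floor makes the lattice point a total function of `(n, t)`; on `S` it is exact, and `p m`
    -- undoes the shift by `m`.
    have hN : ∀ᶠ q in l, ((⌊stdPoint (P q.1) (L q.1) (τ q.2)⌋ + p q.1 * m : ℤ) : ℝ) =
        p q.1 * tiltMean w (χ q.1) + τ q.2 * a q.1 := by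
      filter_upwards [hmem, hfst.eventually hpt] with q hq h1
      obtain ⟨z, hz⟩ := hz _ _ hq
      have h2 := h1 (τ q.2)
      push_cast
      rw [hz, Int.floor_intCast, ← hz, h2]
      ring
    have h1 := hw.tendsto_tiltProb (hχ.comp hfst) (hp.comp hfst) ht (N := fun q =>
      ⌊stdPoint (P q.1) (L q.1) (τ q.2)⌋ + p q.1 * m) hN
    refine h1.congr' ?_
    filter_upwards [hfst.eventually hlaw, hN, hfst.eventually hpt] with q h2 h3 h4
    have h5 := measureReal_shiftedSum_eq_tiltProb (hmeas q.1) (hindep q.1) h2 m (p q.1)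
      (⌊stdPoint (P q.1) (L q.1) (τ q.2)⌋ + p q.1 * m)
    rw [h3, show (p q.1 * tiltMean w (χ q.1) + τ q.2 * a q.1 - p q.1 * m : ℝ) =
      stdPoint (P q.1) (L q.1) (τ q.2) by rw [h4]; ring] at h5
    simp only [Function.comp, a, L]
    rw [← h5]
  have hevS : ∀ (S : ℕ → Set ℝ) {Q : ℕ → Prop}, (∀ᶠ n in atTop, Q n) →
      ∀ᶠ q : ℕ × ℝ in comap Prod.fst atTop ⊓ 𝓟 {q : ℕ × ℝ | q.2 ∈ S q.1}, Q q.1 := fun S Q hQ =>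
    (tendsto_comap.mono_left inf_le_left : Tendsto (Prod.fst : ℕ × ℝ → ℕ) _ atTop).eventually hQ
  have hsq : 0 < √(2 * Real.pi) := Real.sqrt_pos.2 (by positivity)
  set S₁ : ℕ → Set ℝ := fun n => {t | |t| ≤ s n ∧ (∃ z : ℤ, stdPoint (P n) (L n) t = z) ∧
    ∃ z : ℤ, ∫ ω, L n ω ∂(P n) = z}
  set S₂ : ℕ → Set ℝ := fun n => {t | |t| ≤ s n ∧ ∃ z : ℤ, stdPoint (P n) (L n) t = z}
  set S₃ : ℕ → Set ℝ := fun n => {t | |t| ≤ s n}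
  refine ⟨unifEquiv_of_tendsto (S := S₁) ?_, unifEquiv_of_tendsto (S := S₂) ?_,
    unifEquiv_of_tendsto (S := S₃) ?_⟩
  · have h1 := key S₁ id (fun t => le_rfl) (fun n t ht => ht.1)
        fun n t ht => ht.2.1
    have h2 := key S₁ (fun _ => 0) (fun t => by simp) (fun n t ht => ht.1)
        fun n t ht => by simpa [stdPoint] using ht.2.2
    have h3 := h1.div h2 one_ne_zero
    rw [div_one] at h3
    refine h3.congr' ?_
    filter_upwards [hevS S₁ hapos] with q hq
    have e : stdPoint (P q.1) (L q.1) 0 = ∫ ω, L q.1 ω ∂(P q.1) := by simp [stdPoint]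
    simp only [Pi.div_apply, id, e]
    rw [neg_div, Real.exp_neg, show ((0 : ℝ) ^ 2 / 2) = 0 by norm_num, Real.exp_zero, mul_one, mul_assoc,
      mul_div_mul_left _ _ (by positivity), ← div_div, div_inv_eq_mul]
    ring
  · refine (key S₂ id (fun t => le_rfl) (fun n t ht => ht.1) fun n t ht => ht.2).congr' ?_
    filter_upwards [hevS S₂ hmom] with q hq
    simp only [id]
    rw [hq.2, neg_div, Real.exp_neg, ← div_div, div_inv_eq_mul, one_div, div_inv_eq_mul]
    ring
  -- The last equivalence is only `σ χ / √p → √α`; the Gaussian factors cancel, so no integrality is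
  -- required of `t`.
  · have h1 := (tendsto_const_nhds (x := √α)).div (hw.tendsto_sqrt_tiltVar_mul hχ)
      (Real.sqrt_pos.2 hα).ne'
    rw [div_self (Real.sqrt_pos.2 hα).ne'] at h1
    refine (h1.comp (tendsto_comap.mono_left inf_le_left :
      Tendsto (Prod.fst : ℕ × ℝ → ℕ) _ atTop)).congr' ?_
    filter_upwards [hevS S₃ hmom, hevS S₃ hapos, hevS S₃ (hχ self_mem_nhdsWithin),
      hevS S₃ (hp.eventually_gt_atTop 0)] with q h2 h3 h4 h5
    have h4 : 0 < χ q.1 := h4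
    have h5 : (0 : ℝ) < p q.1 := by exact_mod_cast h5
    simp only [Function.comp, Pi.div_apply]
    rw [h2.2]
    simp only [a, tiltScale] at h3 ⊢
    have h6 : 0 < √(tiltVar w (χ q.1)) := pos_of_mul_pos_left h3 (Real.sqrt_nonneg _)
    rw [Real.sqrt_mul h5.le, Real.sqrt_mul zero_le_two]
    have h7 := Real.sqrt_pos.2 h5
    have h8 := Real.sqrt_pos.2 hα
    have h9 := Real.sqrt_pos.2 Real.pi_pos
    have h10 := Real.sqrt_pos.2 (zero_lt_two (α := ℝ))
    have h11 := Real.exp_pos (-q.2 ^ 2 / 2)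
    field_simp

/-! ### Expansive sequences and the saddle-point equations. -/

section Expansive

variable {h : ℝ → ℝ} {α ρ : ℝ}

theorem ExpansiveData.tameWeight (hexp : ExpansiveData h α ρ) : TameWeight (regWeight h α) α :=
  hexp.slowlyVarying.tameWeight hexp.eventually_pos hexp.continuousOn hexp.nonneg hexp.alpha_pos

theorem expansiveSeq_eq (h : ℝ → ℝ) (α ρ : ℝ) (k : ℕ) :
    expansiveSeq h α ρ k = regWeight h α k * (ρ ^ k)⁻¹ := by
  unfold expansiveSeq regWeight
  split_ifs <;> simp

theorem ExpansiveData.expansiveSeq_nonneg (hexp : ExpansiveData h α ρ) (k : ℕ) :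
    0 ≤ expansiveSeq h α ρ k := by
  rw [expansiveSeq_eq]
  have := hexp.rho_pos
  exact mul_nonneg (regWeight_nonneg hexp.nonneg α k) (by positivity)

/-- The exponential factor of the sequence cancels, which identifies the Boltzmann law at `ρ e^{-χ}`
with the tilted law at `χ`. -/
theorem expansiveSeq_mul_pow (hρ : 0 < ρ) (χ : ℝ) (k : ℕ) :
    expansiveSeq h α ρ k * (ρ * Real.exp (-χ)) ^ k = regWeight h α k * Real.exp (-(χ * k)) := by
  rw [expansiveSeq_eq, mul_pow, ← Real.exp_nat_mul]
  have : ρ ^ k ≠ 0 := by positivity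
  field_simp

theorem mul_exp_neg_log_div {x : ℝ} (hρ : 0 < ρ) (hx : 0 < x) :
    ρ * Real.exp (-Real.log (ρ / x)) = x := by
  rw [Real.exp_neg, Real.exp_log (by positivity)]
  field_simp

theorem ExpansiveData.summable_mul_pow (hexp : ExpansiveData h α ρ) {x : ℝ} (hx : 0 < x) (hxρ : x < ρ)
    (j : ℕ) : Summable fun k : ℕ => expansiveSeq h α ρ k * (k : ℝ) ^ j * x ^ k := by
  have hχ : 0 < Real.log (ρ / x) := Real.log_pos ((one_lt_div hx).2 hxρ)
  refine (hexp.tameWeight.summable _ hχ j).congr fun k => ?_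
  have h1 := expansiveSeq_mul_pow (h := h) (α := α) hexp.rho_pos (Real.log (ρ / x)) k
  rw [mul_exp_neg_log_div hexp.rho_pos hx] at h1
  linear_combination -(k : ℝ) ^ j * h1

/-- The derivative of the generating series inside the disc of convergence. -/
theorem ExpansiveData.mul_deriv_genSeries (hexp : ExpansiveData h α ρ) {x : ℝ} (hx : 0 < x)
    (hxρ : x < ρ) : x * deriv (genSeries (expansiveSeq h α ρ)) x =
      ∑' k : ℕ, expansiveSeq h α ρ k * k * x ^ k := by
  obtain ⟨r, hxr, hrρ⟩ := exists_between hxρ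
  have hr : 0 < r := hx.trans hxr
  set c := expansiveSeq h α ρ
  have hu : Summable fun k : ℕ => c k * (k * r ^ (k - 1)) := by
    refine ((hexp.summable_mul_pow hr hrρ 1).div_const r).congr fun k => ?_
    rcases Nat.eq_zero_or_pos k with rfl | hk
    · simp
    · rw [pow_one, ← pow_sub_one_mul hk.ne' r]
      field_simp
      rfl
  -- Termwise differentiation on `(0, r)` with `x < r < ρ`, where the derivatives are dominated by
  -- their values at `r`.
  have hd : HasDerivAt (genSeries c) (∑' k : ℕ, c k * (k * x ^ (k - 1))) x := by
    refine hasDerivAt_tsum_of_isPreconnected (g := fun (k : ℕ) y => c k * y ^ k)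
      (g' := fun (k : ℕ) y => c k * (k * y ^ (k - 1))) (t := Set.Ioo 0 r) (y₀ := x) hu isOpen_Ioo
      isPreconnected_Ioo (fun k y _ => (hasDerivAt_pow k y).const_mul (c k)) ?_ ⟨hx, hxr⟩ ?_ ⟨hx, hxr⟩
    · rintro k y ⟨hy0, hyr⟩
      have := hexp.expansiveSeq_nonneg k
      rw [Real.norm_of_nonneg (by positivity)]
      gcongr
    · simpa using hexp.summable_mul_pow hx hxρ 0
  rw [hd.deriv, ← tsum_mul_left]
  refine tsum_congr fun k => ?_
  rcases Nat.eq_zero_or_pos k with rfl | hk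
  · simp
  · rw [← pow_sub_one_mul hk.ne' x]
    ring

/-- At a saddle point the excess `n - mN` is bounded by a function of any larger radius. -/
theorem IsSaddlePoint.excess_le (hexp : ExpansiveData h α ρ) {n N : ℕ} {x y r : ℝ}
    (hsp : IsSaddlePoint (expansiveSeq h α ρ) ρ n N x y) (hxr : x ≤ r) (hrρ : r < ρ) :
    (n : ℝ) - minIndex (expansiveSeq h α ρ) * N ≤
      (r ^ minIndex (expansiveSeq h α ρ))⁻¹ * ∑' k : ℕ, expansiveSeq h α ρ k *
        ((k : ℝ) - minIndex (expansiveSeq h α ρ)) * r ^ k := by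
  obtain ⟨hx, hxρ, hy, hlt, h1, h2⟩ := hsp
  have hmul := hexp.mul_deriv_genSeries hx hxρ
  have hc := hexp.expansiveSeq_nonneg
  have hsum0 := fun (z : ℝ) (hz : 0 < z) (hzρ : z < ρ) => hexp.summable_mul_pow hz hzρ
  have hzero : ∀ k < minIndex (expansiveSeq h α ρ), expansiveSeq h α ρ k = 0 := fun k hk => by
    by_contra hne
    exact Nat.notMem_of_lt_sInf hk hne
  set c := expansiveSeq h α ρ
  set m := minIndex c
  have hr : 0 < r := hx.trans_le hxr
  have hsum : ∀ z, 0 < z → z < ρ → Summable fun k : ℕ => c k * ((k : ℝ) - m) * z ^ k := by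
    intro z hz hzρ
    refine ((hsum0 z hz hzρ 1).sub ((hsum0 z hz hzρ 0).mul_left (m : ℝ))).congr fun k => ?_
    ring
  -- Subtracting `m` times the second equation from the first cancels the terms with denominator `1
  -- - x^m y`.
  have hexcess : (n : ℝ) - m * N = y * ∑' k : ℕ, c k * ((k : ℝ) - m) * x ^ k := by
    have h3 : ∑' k : ℕ, c k * ((k : ℝ) - m) * x ^ k =
        x * deriv (genSeries c) x - m * genSeries c x := by
      rw [hmul, genSeries, ← tsum_mul_left, ← Summable.tsum_sub]
      · refine tsum_congr fun k => ?_
        ring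
      · simpa using hsum0 x hx hxρ 1
      · simpa using (hsum0 x hx hxρ 0).mul_left (m : ℝ)
    rw [h3, ← h1, ← h2]
    ring
  -- Only `k ≥ m` contributes, and there `x^k ≤ x^m r^{k-m}`. The factor `x^m` is kept because it is
  -- `x^m y`, not `y`, that is bounded by `1`.
  have hle : ∑' k : ℕ, c k * ((k : ℝ) - m) * x ^ k ≤
      x ^ m * ((r ^ m)⁻¹ * ∑' k : ℕ, c k * ((k : ℝ) - m) * r ^ k) := by
    rw [← tsum_mul_left, ← tsum_mul_left]
    refine (hsum x hx hxρ).tsum_le_tsum (fun k => ?_) (((hsum r hr hrρ).mul_left _).mul_left _)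
    rcases lt_or_ge k m with hk | hk
    · simp [hzero k hk]
    · obtain ⟨j, rfl⟩ := Nat.exists_eq_add_of_le hk
      have e : x ^ m * ((r ^ m)⁻¹ * (c (m + j) * (((m + j : ℕ) : ℝ) - m) * r ^ (m + j))) =
          c (m + j) * (((m + j : ℕ) : ℝ) - m) * (x ^ m * r ^ j) := by
        rw [pow_add]; field_simp
      rw [e, pow_add x]
      have h4 : (0 : ℝ) ≤ ((m + j : ℕ) : ℝ) - m := by push_cast; simp
      have h5 := hc (m + j)
      gcongr
  have hG : 0 ≤ (r ^ m)⁻¹ * ∑' k : ℕ, c k * ((k : ℝ) - m) * r ^ k := by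
    refine mul_nonneg (by positivity) (tsum_nonneg fun k => ?_)
    rcases lt_or_ge k m with hk | hk
    · simp [hzero k hk]
    · have h4 : (0 : ℝ) ≤ (k : ℝ) - m := sub_nonneg.2 (by exact_mod_cast hk)
      have h5 := hc k
      positivity
  rw [hexcess]
  calc _ ≤ y * (x ^ m * ((r ^ m)⁻¹ * ∑' k : ℕ, c k * ((k : ℝ) - m) * r ^ k)) := by gcongr
    _ = x ^ m * y * ((r ^ m)⁻¹ * ∑' k : ℕ, c k * ((k : ℝ) - m) * r ^ k) := by ring
    _ ≤ _ := mul_le_of_le_one_left hG hlt.le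

/-- For each fixed `r < ρ` the bound on the excess is a constant, which `n - mN` eventually exceeds;
hence `x_n > r` eventually, while `x_n < ρ` by assumption. -/
theorem ExpansiveData.tendsto_log_of_isSaddlePoint (hexp : ExpansiveData h α ρ) {N : ℕ → ℕ}
    {x y : ℕ → ℝ}
    (hN : Tendsto (fun n : ℕ => (n : ℝ) - minIndex (expansiveSeq h α ρ) * N n) atTop atTop)
    (hsp : ∀ᶠ n in atTop, IsSaddlePoint (expansiveSeq h α ρ) ρ n (N n) (x n) (y n)) :
    Tendsto (fun n => Real.log (ρ / x n)) atTop (𝓝 0) := by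
  have hρ := hexp.rho_pos
  have hx : Tendsto x atTop (𝓝 ρ) := by
    refine tendsto_order.2 ⟨fun r hr => ?_, fun r hr => ?_⟩
    · filter_upwards [hsp, hN.eventually_gt_atTop ((r ^ minIndex (expansiveSeq h α ρ))⁻¹ *
        ∑' k : ℕ, expansiveSeq h α ρ k * ((k : ℝ) - minIndex (expansiveSeq h α ρ)) * r ^ k)]
        with n h1 h2
      by_contra! h3
      exact absurd (h1.excess_le hexp h3 hr) (not_le.2 h2)
    · filter_upwards [hsp] with n h1 using h1.x_lt.trans hr
  have h1 := ((tendsto_const_nhds (x := ρ)).div hx hρ.ne').log (by rw [div_self hρ.ne']; exact one_ne_zero)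
  rwa [div_self hρ.ne', Real.log_one] at h1

end Expansive

end

theorem mainTheorem4 {h : ℝ → ℝ} {α ρ : ℝ} (hexp : ExpansiveData h α ρ)
    {p : ℕ → ℕ} (hp : Tendsto p atTop atTop)
    {Ω : ℕ → Type*} [∀ n, MeasurableSpace (Ω n)] (P : ∀ n, Measure (Ω n))
    [∀ n, IsProbabilityMeasure (P n)]
    (X : ∀ n, ℕ → Ω n → ℕ) (hmeas : ∀ n i, Measurable (X n i))
    (hindep : ∀ n, iIndepFun (X n) (P n)) :
    -- arbitrary parameters `x_n = ρ e^{-χ_n}` with `0 < χ_n → 0`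
    (∀ χ : ℕ → ℝ, (∀ᶠ n in atTop, 0 < χ n) → Tendsto χ atTop (𝓝 0) →
      (∀ᶠ n in atTop, ∀ i,
        HasBoltzmannLaw (P n) (expansiveSeq h α ρ) (ρ * Real.exp (-χ n)) (X n i)) →
      LocalLimit P (fun n => shiftedSum (minIndex (expansiveSeq h α ρ)) (p n) (X n)) p α χ) ∧
    -- in particular, the parameters `x_n` given by the saddle-point equations
    (∀ (N : ℕ → ℕ) (x y : ℕ → ℝ), Tendsto N atTop atTop →
      Tendsto (fun n : ℕ => (n : ℝ) - minIndex (expansiveSeq h α ρ) * N n) atTop atTop →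
      (∀ᶠ n in atTop, IsSaddlePoint (expansiveSeq h α ρ) ρ n (N n) (x n) (y n)) →
      (∀ᶠ n in atTop, ∀ i, HasBoltzmannLaw (P n) (expansiveSeq h α ρ) (x n) (X n i)) →
      Tendsto (fun n => Real.log (ρ / x n)) atTop (𝓝 0) ∧
      LocalLimit P (fun n => shiftedSum (minIndex (expansiveSeq h α ρ)) (p n) (X n)) p α
        (fun n => Real.log (ρ / x n))) := by
  have hρ := hexp.rho_pos
  have main : ∀ χ : ℕ → ℝ, (∀ᶠ n in atTop, 0 < χ n) → Tendsto χ atTop (𝓝 0) →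
      (∀ᶠ n in atTop, ∀ i,
        HasBoltzmannLaw (P n) (expansiveSeq h α ρ) (ρ * Real.exp (-χ n)) (X n i)) →
      LocalLimit P (fun n => shiftedSum (minIndex (expansiveSeq h α ρ)) (p n) (X n)) p α χ := by
    intro χ hχ0 hχ hlaw
    refine hexp.tameWeight.localLimit hp P X hmeas hindep
      (tendsto_nhdsWithin_iff.2 ⟨hχ, hχ0⟩) _ ?_
    filter_upwards [hlaw] with n hn i k
    rw [hn i k, expansiveSeq_mul_pow hρ, genSeries, lap]
    simp_rw [expansiveSeq_mul_pow hρ]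
  refine ⟨main, fun N x y _ hN hsp hlaw => ?_⟩
  have hlim := hexp.tendsto_log_of_isSaddlePoint hN hsp
  refine ⟨hlim, main _ ?_ hlim ?_⟩
  · filter_upwards [hsp] with n hn
    exact Real.log_pos ((one_lt_div hn.x_pos).2 hn.x_lt)
  · filter_upwards [hsp, hlaw] with n hn h1
    rwa [mul_exp_neg_log_div hρ hn.x_pos]
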